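/- Let $d\ge 2$, let $\mathcal U\subset\mathbb R^n$ be open, and consider $$u_t+\sum_{j=1}^d f^j(u)_{x_j}=\sum_{j,k=1}^d\big(B^{jk}(u)u_{x_k}\big)_{x_j},\qquad u\in\mathcal U,\ x\in\mathbb R^d .$$ For $a\in\mathcal U$, $s\in\mathbb R$, $\nu\in S^{d-1}$, $q\in\mathbb R^n$ let $u(y)=u(y;a,s,\nu,q)$ be the solution, with $u(0)=a$, of the profile equation $$\sum_{j,k}\nu_j\nu_kB^{jk}(u)u'=\sum_j\nu_jf^j(u)-su-q. \tag{1}$$ Let $\bar u:\mathbb R\to\mathcal U$ be a nonconstant solution of (1) with $s=0$, $\nu=e_1$, $q=\bar q$, of period $\bar X>0$. Assume: (H0) $f^j,B^{jk}\in C^2(\mathcal U)$; (H1) there is $\theta>0$ with $\operatorname{Re}\sigma\big(\sum_{j,k}\nu_j\nu_kB^{jk}(u)\big)\ge\theta$ for all $u\in\mathcal U$, $\nu\in S^{d-1}$; (H2) $H(X,a,s,\nu,q):=u(X;a,s,\nu,q)-a$ is a submersion at $(\bar X,\bar u(0),0,e_1,\bar q)$. Then the solutions of (1) of period $X$ (zeros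 of $H$) near $\bar u$, modulo translation in $y$, form a manifold $\mathcal P$ of dimension $n+d$, with points denoted $\dot u$. On $\mathcal P$ let $S=s$, $N=\nu$, $\Omega=1/X$, $$M=\frac1X\int_0^Xu\,dy,\qquad F^j=\frac1X\int_0^X\Big(f^j(u)-\sum_kB^{jk}(u)\nu_ku'\Big)dy ,$$ and assume the nondegeneracy condition $\det\frac{\partial(M,\Omega N)}{\partial\dot u}(\dot{\bar u})\ne0$. For $\xi\in\mathbb R^d$ put $$\mathcal A(\xi)=\sum_{j=1}^d\xi_j\,\frac{\partial(F^j,S\Omega e_j)}{\partial(M,\Omega N)}=\sum_{j=1}^d\xi_j\,\frac{\partial(F^j,S\Omega e_j)}{\partial\dot u}\Big(\frac{\partial(M,\Omega N)}{\partial\dot u}\Big)^{-1}\quad\text{at }\dot{\bar u}.$$ Let $B^{jk}=B^{jk}(\bar u(x_1))$ and $A^jv=Df^j(\bar u)v-(DB^{j1}(\bar u)v)\bar u'$. For $\tilde\xi=(\xi_2,\dots,\xi_d)$ and $\lambda\in\mathbb C$ let $w^1,\dots,w^{2n}$ be a basis, holomorphic in $\lambda$, of the solutions $w(x_1)\in\mathbb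 C^n$ of $$(B^{11}w')'-(A^1w)'+i\sum_{j\ne1}\xi_jB^{j1}w'+i\Big(\sum_{k\ne1}\xi_kB^{1k}w\Big)'-i\sum_{j\ne1}\xi_jA^jw-\sum_{j,k\ne1}\xi_j\xi_kB^{jk}w-\lambda w=0,$$ and let the Evans function be the $2n\times2n$ determinant $$D(\xi,\lambda)=\det\begin{pmatrix}w^l(\bar X)-e^{i\bar X\xi_1}w^l(0)\\ (w^l)'(\bar X)-e^{i\bar X\xi_1}(w^l)'(0)\end{pmatrix}_{1\le l\le2n}.$$ Then, for every $\xi\in\mathbb R^d$, $0$ is an eigenvalue of $\mathcal A(\xi)$ of algebraic multiplicity at least $d-1$; and if $a_1(\xi),\dots,a_{n+1}(\xi)$ denote the eigenvalues of $\mathcal A(\xi)$, repeated by algebraic multiplicity, with $d-1$ zeros left out (suitably labelled), there are $r,\varepsilon>0$ and functions $\lambda_1,\dots,\lambda_{n+1}$ of $\xi\in\mathbb R^d$ such that, for $|\xi|<\varepsilon$, the zeros of $D(\xi,\cdot)$ in $\{|\lambda|<r\}$, repeated by multiplicity, are exactly $\lambda_1(\xi),\dots,\lambda_{n+1}(\xi)$;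 the unordered $(n+1)$-tuple $\{\lambda_j(\xi)\}$ depends continuously on $\xi$; and $$\lambda_j(\xi)=-i\,a_j(\xi)+o(|\xi|)\quad\text{as }\xi\to0,\qquad j=1,\dots,n+1 .$$ -/

import Mathlib

open Set Filter Topology

noncomputable section

/-- A system of viscous conservation laws
`u_t + ∑ j, f^j(u)_{x_j} = ∑ j k, (B^{jk}(u) u_{x_k})_{x_j}` for `u ∈ U ⊆ ℝ^n`, `U` open, in
`d = m + 1` space dimensions. The index `0 : Fin (m + 1)` is the first space direction; the
indices `j.succ`, `j : Fin m`, are the `d - 1 = m` transverse ones. -/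
structure ViscousSystem (n m : ℕ) where
  U : Set (Fin n → ℝ)
  isOpen_U : IsOpen U
  f : Fin (m + 1) → (Fin n → ℝ) → (Fin n → ℝ)
  B : Fin (m + 1) → Fin (m + 1) → (Fin n → ℝ) → Matrix (Fin n) (Fin n) ℝ

namespace ViscousSystem

variable {n m : ℕ} (S : ViscousSystem n m)

/-- The matrix `∑ j k, ν_j ν_k B^{jk}(u)`. -/
def normalB (ν : Fin (m + 1) → ℝ) (u : Fin n → ℝ) : Matrix (Fin n) (Fin n) ℝ :=
  ∑ j, ∑ k, (ν j * ν k) • S.B j k u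

/-- (H0): the `f^j` and the (entries of the) `B^{jk}` are of class `C^2` on `U`. -/
def H0 : Prop :=
  (∀ j, ContDiffOn ℝ 2 (S.f j) S.U) ∧
    ∀ j k a b, ContDiffOn ℝ 2 (fun u => S.B j k u a b) S.U

/-- (H1): `Re σ(∑ j k, ν_j ν_k B^{jk}(u)) ≥ θ > 0` for all `u ∈ U` and all unit vectors `ν`. -/
def H1 : Prop :=
  ∃ θ : ℝ, 0 < θ ∧ ∀ u ∈ S.U, ∀ ν : Fin (m + 1) → ℝ, ∑ j, ν j ^ 2 = 1 →
    ∀ μ ∈ spectrum ℂ ((S.normalB ν u).map (fun r : ℝ => (r : ℂ))), θ ≤ μ.re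

/-- `φ` takes its value in `U` and satisfies the first-order profile equation
`∑ j k, ν_j ν_k B^{jk}(φ) φ' = ∑ j, ν_j f^j(φ) - s φ - q` at the point `t`. -/
def SolvesProfileAt (s : ℝ) (ν : Fin (m + 1) → ℝ) (q : Fin n → ℝ) (φ : ℝ → Fin n → ℝ)
    (t : ℝ) : Prop :=
  φ t ∈ S.U ∧ DifferentiableAt ℝ φ t ∧
    (S.normalB ν (φ t)).mulVec (deriv φ t) = ∑ j, ν j • S.f j (φ t) - s • φ t - q

/-- `φ` is a solution of the profile equation with `φ 0 = a`, on an open interval that contains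
`0` and `y`. -/
def IsProfileUpTo (y : ℝ) (a : Fin n → ℝ) (s : ℝ) (ν : Fin (m + 1) → ℝ) (q : Fin n → ℝ)
    (φ : ℝ → Fin n → ℝ) : Prop :=
  φ 0 = a ∧ ∃ α β : ℝ, 0 ∈ Ioo α β ∧ y ∈ Ioo α β ∧ ∀ t ∈ Ioo α β, S.SolvesProfileAt s ν q φ t

open Classical in
/-- `u(y; a, s, ν, q)`: the value at `y` of the solution of the profile equation that starts at
`a`, with junk value `0` if that solution does not exist up to `y`. -/
def flow (y : ℝ) (a : Fin n → ℝ) (s : ℝ) (ν : Fin (m + 1) → ℝ) (q : Fin n → ℝ) : Fin n → ℝ :=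
  if h : ∃ φ, S.IsProfileUpTo y a s ν q φ then Classical.choose h y else 0

end ViscousSystem

/-- The coordinates `δ ↦ ν = (1, δ) / √(1 + |δ|²)` of the unit sphere near `e_1`. -/
def direction {m : ℕ} (δ : Fin m → ℝ) : Fin (m + 1) → ℝ :=
  (Real.sqrt (1 + ∑ j, δ j ^ 2))⁻¹ • (Fin.cons 1 δ : Fin (m + 1) → ℝ)

/-- The parameters `(X, a, s, δ, q)`: period, initial value, speed, direction (in the coordinates
`direction`), constant of integration. -/
abbrev WaveParam (n m : ℕ) : Type :=
  ℝ × (Fin n → ℝ) × ℝ × (Fin m → ℝ) × (Fin n → ℝ)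

namespace ViscousSystem

variable {n m : ℕ} (S : ViscousSystem n m)

/-- The solution `y ↦ u(y; a, s, ν, q)` for the parameters `p = (X, a, s, δ, q)`. -/
def wave (p : WaveParam n m) (y : ℝ) : Fin n → ℝ :=
  S.flow y p.2.1 p.2.2.1 (direction p.2.2.2.1) p.2.2.2.2

/-- The map `H (X, a, s, ν, q) = u(X; a, s, ν, q) - a`, whose zeros are the periodic waves. -/
def shoot (p : WaveParam n m) : Fin n → ℝ :=
  S.wave p p.1 - p.2.1

/-- The mean `M = (1/X) ∫_0^X u dy`. -/
def meanM (p : WaveParam n m) : Fin n → ℝ :=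
  p.1⁻¹ • ∫ y in (0 : ℝ)..p.1, S.wave p y

/-- The mean flux `F^j = (1/X) ∫_0^X (f^j(u) - ∑ k, B^{jk}(u) ν_k u') dy`, `u' = du/dy`, in the
variable `y` in which `u` has period `X`. -/
def meanF (j : Fin (m + 1)) (p : WaveParam n m) : Fin n → ℝ :=
  p.1⁻¹ • ∫ y in (0 : ℝ)..p.1,
    (S.f j (S.wave p y) -
      ∑ k, direction p.2.2.2.1 k • (S.B j k (S.wave p y)).mulVec (deriv (S.wave p) y))

/-- The averaged densities `(M, Ω N)`, where `Ω = 1 / X`. -/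
def density (p : WaveParam n m) : (Fin n → ℝ) × (Fin (m + 1) → ℝ) :=
  (S.meanM p, p.1⁻¹ • direction p.2.2.2.1)

/-- The averaged fluxes `(F^j, S Ω e_j)`. -/
def flux (j : Fin (m + 1)) (p : WaveParam n m) : (Fin n → ℝ) × (Fin (m + 1) → ℝ) :=
  (S.meanF j p, (p.2.2.1 * p.1⁻¹) • Pi.single j 1)

/-- `ubar` is a nonconstant periodic stationary profile in the direction `e_1` (so `s = 0`,
`ν = e_1`), with period `X > 0` and constant of integration `q`. -/
structure IsPeriodicProfile (ubar : ℝ → Fin n → ℝ) (X : ℝ) (q : Fin n → ℝ) : Prop where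
  solves : ∀ x, S.SolvesProfileAt 0 (Pi.single 0 1) q ubar x
  period_pos : 0 < X
  periodic : Function.Periodic ubar X
  nonconstant : ∃ x, ubar x ≠ ubar 0

/-- The parameters `(X, ubar 0, 0, 0, q)` of the wave `ubar`; `δ = 0` is `ν = e_1`. -/
def baseParam (m : ℕ) (ubar : ℝ → Fin n → ℝ) (X : ℝ) (q : Fin n → ℝ) : WaveParam n m :=
  (X, ubar 0, 0, 0, q)

/-- (H2): `H` is a submersion at the parameters of `ubar`. -/
def H2 (ubar : ℝ → Fin n → ℝ) (X : ℝ) (q : Fin n → ℝ) : Prop :=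
  DifferentiableAt ℝ S.shoot (baseParam m ubar X q) ∧
    Function.Surjective (fderiv ℝ S.shoot (baseParam m ubar X q))

/-- The tangent space at (the class of) `ubar` to the manifold of periodic waves modulo
translation. The waves are the zeros of the submersion `H`, with tangent space `ker dH`. Near
`ubar`, every translation class is represented by the waves whose initial value lies in the
Poincaré section through `ubar 0` orthogonal to `ubar' 0`; this cuts out of `ker dH` a complement
of the direction of translations `(0, ubar' 0, 0, 0, 0)`. -/
def waveTangent (ubar : ℝ → Fin n → ℝ) (X : ℝ) (q : Fin n → ℝ) :
    Submodule ℝ (WaveParam n m) where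
  carrier := {v | fderiv ℝ S.shoot (baseParam m ubar X q) v = 0 ∧ v.2.1 ⬝ᵥ deriv ubar 0 = 0}
  add_mem' := by
    rintro v w ⟨hv, hv'⟩ ⟨hw, hw'⟩
    exact ⟨by rw [map_add, hv, hw, add_zero],
      by rw [Prod.snd_add, Prod.fst_add, add_dotProduct, hv', hw', add_zero]⟩
  zero_mem' := ⟨map_zero _, by simp⟩
  smul_mem' := by
    rintro c v ⟨hv, hv'⟩
    exact ⟨by rw [map_smul, hv, smul_zero],
      by rw [Prod.smul_snd, Prod.smul_fst, smul_dotProduct, hv', smul_zero]⟩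

/-- `∂(M, Ω N)/∂u̇` at `ubar`. -/
def dDensity (ubar : ℝ → Fin n → ℝ) (X : ℝ) (q : Fin n → ℝ) :
    S.waveTangent ubar X q →ₗ[ℝ] (Fin n → ℝ) × (Fin (m + 1) → ℝ) :=
  (fderiv ℝ S.density (baseParam m ubar X q)).toLinearMap ∘ₗ (S.waveTangent ubar X q).subtype

/-- `∂(F^j, S Ω e_j)/∂u̇` at `ubar`. -/
def dFlux (ubar : ℝ → Fin n → ℝ) (X : ℝ) (q : Fin n → ℝ) (j : Fin (m + 1)) :
    S.waveTangent ubar X q →ₗ[ℝ] (Fin n → ℝ) × (Fin (m + 1) → ℝ) :=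
  (fderiv ℝ (S.flux j) (baseParam m ubar X q)).toLinearMap ∘ₗ (S.waveTangent ubar X q).subtype

/-- The nondegeneracy condition `det ∂(M, Ω N)/∂u̇ ≠ 0`: the Jacobian map is invertible (its
determinant is taken in coordinates of the tangent space, and its vanishing does not depend on
them). -/
def Nondegenerate (ubar : ℝ → Fin n → ℝ) (X : ℝ) (q : Fin n → ℝ) : Prop :=
  Function.Bijective (S.dDensity ubar X q)

/-- `𝒜(ξ) = ∑ j, ξ_j ∂(F^j, S Ω e_j)/∂(M, Ω N)`, where
`∂(F^j, S Ω e_j)/∂(M, Ω N) = ∂(F^j, S Ω e_j)/∂u̇ ∘ (∂(M, Ω N)/∂u̇)⁻¹`. -/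
def averagedSymbol {ubar : ℝ → Fin n → ℝ} {X : ℝ} {q : Fin n → ℝ}
    (h : S.Nondegenerate ubar X q) (ξ : Fin (m + 1) → ℝ) :
    Module.End ℝ ((Fin n → ℝ) × (Fin (m + 1) → ℝ)) :=
  ∑ j, ξ j • (S.dFlux ubar X q j ∘ₗ (LinearEquiv.ofBijective (S.dDensity ubar X q) h).symm)

/-- The coefficient `B^{jk} = B^{jk}(ubar(x))` of the linearized operator, as a complex matrix. -/
def linB (ubar : ℝ → Fin n → ℝ) (j k : Fin (m + 1)) (x : ℝ) : Matrix (Fin n) (Fin n) ℂ :=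
  (S.B j k (ubar x)).map (fun r : ℝ => (r : ℂ))

/-- The coefficient `A^j v = Df^j(ubar) v - (DB^{j1}(ubar) v) ubar'` of the linearized operator
at `x`, as a complex matrix. Here `(DB^{j1}(ubar) v) ubar'` is the derivative at `u = ubar x` in
the direction `v` of `u ↦ B^{j1}(u) p`, with the vector `p = ubar' x` kept fixed. -/
def linA (ubar : ℝ → Fin n → ℝ) (j : Fin (m + 1)) (x : ℝ) : Matrix (Fin n) (Fin n) ℂ :=
  (LinearMap.toMatrix' (fderiv ℝ (S.f j) (ubar x) -
    fderiv ℝ (fun u => (S.B j 0 u).mulVec (deriv ubar x)) (ubar x)).toLinearMap).map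
      (fun r : ℝ => (r : ℂ))

/-- `w` lies in the kernel of `L_η - lam`, where `η` is the transverse frequency: it is a solution
of the eigenvalue equation
`(B^{11} w')' - (A^1 w)' + i ∑_j η_j B^{j1} w' + i (∑_k η_k B^{1k} w)'
  - i ∑_j η_j A^j w - ∑_{j,k} η_j η_k B^{jk} w - lam w = 0` (sums over the transverse indices). -/
def IsEigenSolution (ubar : ℝ → Fin n → ℝ) (η : Fin m → ℝ) (lam : ℂ) (w : ℝ → Fin n → ℂ) :
    Prop :=
  ContDiff ℝ 2 w ∧ ∀ x : ℝ,
    deriv (fun y => (S.linB ubar 0 0 y).mulVec (deriv w y)) x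
      - deriv (fun y => (S.linA ubar 0 y).mulVec (w y)) x
      + Complex.I • ∑ j : Fin m, (η j : ℂ) • (S.linB ubar j.succ 0 x).mulVec (deriv w x)
      + Complex.I • deriv (fun y => ∑ k : Fin m, (η k : ℂ) • (S.linB ubar 0 k.succ y).mulVec (w y)) x
      - Complex.I • ∑ j : Fin m, (η j : ℂ) • (S.linA ubar j.succ x).mulVec (w x)
      - ∑ j : Fin m, ∑ k : Fin m,
          ((η j : ℂ) * (η k : ℂ)) • (S.linB ubar j.succ k.succ x).mulVec (w x)
      - lam • w x = 0

/-- `w η lam l`, `l = 1, …, 2n`, is for every `(η, lam)` a basis of the `2n`-dimensional kernel of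
`L_η - lam`, holomorphic in `lam`. (Analytic dependence on `η` is allowed but not required.) -/
structure IsEvansBasis (ubar : ℝ → Fin n → ℝ)
    (w : (Fin m → ℝ) → ℂ → (Fin n ⊕ Fin n) → ℝ → Fin n → ℂ) : Prop where
  solution : ∀ η lam l, S.IsEigenSolution ubar η lam (w η lam l)
  independent : ∀ η lam, LinearIndependent ℂ (w η lam)
  holomorphic : ∀ η l x, Differentiable ℂ (fun lam => w η lam l x)
  holomorphic_deriv : ∀ η l x, Differentiable ℂ (fun lam => deriv (w η lam l) x)

end ViscousSystem

/-- The Evans function `D(ξ, lam)`: the `2n × 2n` determinant with columns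
`(w^l(X) - e^{i X ξ_1} w^l(0), (w^l)'(X) - e^{i X ξ_1} (w^l)'(0))`, where the `w^l` are taken at
the transverse frequency `(ξ_2, …, ξ_d)` and at `lam`. -/
def evans {n m : ℕ} (w : (Fin m → ℝ) → ℂ → (Fin n ⊕ Fin n) → ℝ → Fin n → ℂ) (X : ℝ)
    (ξ : Fin (m + 1) → ℝ) (lam : ℂ) : ℂ :=
  Matrix.det (Matrix.of fun (r l : Fin n ⊕ Fin n) =>
    Sum.elim
      (fun i => w (fun j => ξ j.succ) lam l X i
        - Complex.exp (Complex.I * X * ξ 0) * w (fun j => ξ j.succ) lam l 0 i)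
      (fun i => deriv (w (fun j => ξ j.succ) lam l) X i
        - Complex.exp (Complex.I * X * ξ 0) * deriv (w (fun j => ξ j.succ) lam l) 0 i) r)

end

/-- Hurwitz: zeros persist under locally uniform convergence. -/
lemma eventually_exists_zero_near {ι : Type*} {l : Filter ι} {F : ι → ℂ → ℂ} {g : ℂ → ℂ} {z₀ : ℂ}
    (hF : ∀ᶠ i in l, Differentiable ℂ (F i)) (hg : Differentiable ℂ g)
    (hlim : ∀ R ε : ℝ, 0 < ε → ∀ᶠ i in l, ∀ z, ‖z‖ ≤ R → ‖F i z - g z‖ < ε)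
    (hz₀ : g z₀ = 0) (hne : ∃ z, g z ≠ 0) {κ : ℝ} (hκ : 0 < κ) :
    ∀ᶠ i in l, ∃ z, F i z = 0 ∧ ‖z - z₀‖ < κ := by
  have hga : AnalyticOnNhd ℂ g univ := fun z _ => hg.analyticAt z
  have hev : ∀ᶠ z in 𝓝[≠] z₀, g z ≠ 0 := by
    rcases (hg.analyticAt z₀).eventually_eq_zero_or_eventually_ne_zero with h | h
    · obtain ⟨z, hz⟩ := hne
      exact absurd (hga.eqOn_zero_of_preconnected_of_eventuallyEq_zero isPreconnected_univ
        (mem_univ z₀) h (mem_univ z)) hz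
    · exact h
  obtain ⟨δ, hδ, hδ'⟩ := Metric.eventually_nhds_iff.1 (eventually_nhdsWithin_iff.1 hev)
  set r := min (κ / 2) (δ / 2) with hr
  have hr0 : 0 < r := by positivity
  have hrκ : r < κ := (min_le_left _ _).trans_lt (by linarith)
  have hrδ : r < δ := (min_le_right _ _).trans_lt (by linarith)
  have hsph : ∀ z ∈ Metric.sphere z₀ r, g z ≠ 0 := by
    intro z hz
    rw [mem_sphere_iff_norm] at hz
    refine hδ' (by rw [dist_eq_norm, hz]; exact hrδ) ?_
    rintro rfl
    simp at hz
    linarith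
  obtain ⟨zm, hzm, hmin⟩ := (isCompact_sphere z₀ r).exists_isMinOn
    (NormedSpace.sphere_nonempty.2 hr0.le) (hg.continuous.norm.continuousOn)
  set m := ‖g zm‖ with hm
  have hm0 : 0 < m := norm_pos_iff.2 (hsph zm hzm)
  filter_upwards [hF, hlim (‖z₀‖ + r) (m / 8) (by positivity)] with i hFi hi
  have hb : ∀ z ∈ Metric.closedBall z₀ r, ‖F i z - g z‖ < m / 8 := by
    intro z hz
    refine hi z ?_
    rw [mem_closedBall_iff_norm] at hz
    calc ‖z‖ = ‖z₀ + (z - z₀)‖ := by ring_nf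
      _ ≤ ‖z₀‖ + ‖z - z₀‖ := norm_add_le _ _
      _ ≤ _ := by gcongr
  have h0 : ‖F i z₀‖ < m / 8 := by
    have := hb z₀ (Metric.mem_closedBall_self hr0.le)
    rwa [hz₀, sub_zero] at this
  have hs : ∀ z ∈ Metric.sphere z₀ r, m / 2 ≤ ‖F i z - F i z₀‖ := by
    intro z hz
    have h1 : m ≤ ‖g z‖ := hmin hz
    have h2 := hb z (Metric.sphere_subset_closedBall hz)
    have h3 : ‖g z‖ ≤ ‖F i z - F i z₀‖ + ‖F i z - g z‖ + ‖F i z₀‖ := by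
      calc ‖g z‖ = ‖(F i z - F i z₀) - (F i z - g z) + F i z₀‖ := by ring_nf
        _ ≤ _ := (norm_add_le _ _).trans (by gcongr; exact norm_sub_le _ _)
    linarith
  have hfr : ∃ᶠ z in 𝓝 z₀, F i z ≠ F i z₀ := by
    intro hcon
    have hcon' : F i =ᶠ[𝓝 z₀] fun _ => F i z₀ := by
      filter_upwards [hcon] with z hz using not_not.1 hz
    have hall : EqOn (F i) (fun _ => F i z₀) univ :=
      AnalyticOnNhd.eqOn_of_preconnected_of_eventuallyEq (fun z _ => hFi.analyticAt z)
        (fun z _ => analyticAt_const) isPreconnected_univ (mem_univ z₀) hcon'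
    have := hs zm hzm
    rw [hall (mem_univ zm)] at this
    simp at this
    linarith
  have hsub := hFi.diffContOnCl.ball_subset_image_closedBall (z₀ := z₀) hr0 hs hfr
  obtain ⟨z, hz, hz'⟩ := hsub (show (0 : ℂ) ∈ Metric.ball (F i z₀) (m / 2 / 2) by
    rw [mem_ball_iff_norm, zero_sub, norm_neg]; linarith)
  exact ⟨z, hz', (mem_closedBall_iff_norm.1 hz).trans_lt hrκ⟩

/-- Zeros near `z₀` can be chosen to converge to `z₀`. -/
lemma exists_zeros_tendsto {ι : Type*} {l : Filter ι} {F : ι → ℂ → ℂ} {g : ℂ → ℂ} {z₀ : ℂ}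
    (hF : ∀ᶠ i in l, Differentiable ℂ (F i)) (hg : Differentiable ℂ g)
    (hlim : ∀ R ε : ℝ, 0 < ε → ∀ᶠ i in l, ∀ z, ‖z‖ ≤ R → ‖F i z - g z‖ < ε)
    (hz₀ : g z₀ = 0) (hne : ∃ z, g z ≠ 0) :
    ∃ ζ : ι → ℂ, Tendsto ζ l (𝓝 z₀) ∧ ∀ᶠ i in l, F i (ζ i) = 0 := by
  classical
  have key : ∀ i, ∃ z, (Differentiable ℂ (F i) → (∃ y, F i y = 0) →
      F i z = 0 ∧ ∀ y, F i y = 0 → ‖z - z₀‖ ≤ ‖y - z₀‖) := by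
    intro i
    by_cases h : Differentiable ℂ (F i) ∧ ∃ y, F i y = 0
    · obtain ⟨hd, y, hy⟩ := h
      have hcl : IsClosed {z | F i z = 0} := isClosed_eq hd.continuous continuous_const
      obtain ⟨z, hz, hz'⟩ := hcl.exists_infDist_eq_dist ⟨y, hy⟩ z₀
      refine ⟨z, fun _ _ => ⟨hz, fun y hy => ?_⟩⟩
      rw [← dist_eq_norm, ← dist_eq_norm, dist_comm z, ← hz', dist_comm]
      exact Metric.infDist_le_dist_of_mem hy
    · exact ⟨0, fun h1 h2 => absurd ⟨h1, h2⟩ h⟩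
  choose ζ hζ using key
  refine ⟨ζ, ?_, ?_⟩
  · rw [Metric.tendsto_nhds]
    intro ε hε
    filter_upwards [hF, eventually_exists_zero_near hF hg hlim hz₀ hne hε] with i hi hz
    obtain ⟨z, hz, hz'⟩ := hz
    rw [dist_eq_norm]
    exact ((hζ i hi ⟨z, hz⟩).2 z hz).trans_lt hz'
  · filter_upwards [hF, eventually_exists_zero_near hF hg hlim hz₀ hne one_pos] with i hi hz
    obtain ⟨z, hz, hz'⟩ := hz
    exact (hζ i hi ⟨z, hz⟩).1

lemma Differentiable.dslope_complex {f : ℂ → ℂ} (hf : Differentiable ℂ f) (c : ℂ) :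
    Differentiable ℂ (dslope f c) := by
  rw [← differentiableOn_univ]
  exact (Complex.differentiableOn_dslope univ_mem).2 hf.differentiableOn

/-- Dividing by a convergent zero preserves locally uniform convergence. -/
lemma eventually_norm_dslope_sub_lt {ι : Type*} {l : Filter ι} {F : ι → ℂ → ℂ} {g g₁ : ℂ → ℂ}
    {z₀ : ℂ} {ζ : ι → ℂ}
    (hF : ∀ᶠ i in l, Differentiable ℂ (F i)) (hg₁ : Differentiable ℂ g₁)
    (hg : ∀ z, g z = (z - z₀) * g₁ z)
    (hlim : ∀ R ε : ℝ, 0 < ε → ∀ᶠ i in l, ∀ z, ‖z‖ ≤ R → ‖F i z - g z‖ < ε)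
    (hζ : Tendsto ζ l (𝓝 z₀)) (hζ0 : ∀ᶠ i in l, F i (ζ i) = 0) (R ε : ℝ) (hε : 0 < ε) :
    ∀ᶠ i in l, ∀ z, ‖z‖ ≤ R → ‖dslope (F i) (ζ i) z - g₁ z‖ < ε := by
  set R' := max (|R|) ‖z₀‖ + 2 with hR'
  have hR'0 : 0 < R' := by positivity
  obtain ⟨C, hC⟩ := (isCompact_closedBall (0 : ℂ) R').exists_bound_of_continuousOn
    hg₁.continuous.continuousOn
  have hC0 : 0 ≤ C := (norm_nonneg _).trans (hC 0 (Metric.mem_closedBall_self hR'0.le))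
  have hζ' : ∀ᶠ i in l, ‖ζ i - z₀‖ < min 1 (ε / (4 * (C + 1))) := by
    have := Metric.tendsto_nhds.1 hζ (min 1 (ε / (4 * (C + 1)))) (by positivity)
    simpa only [dist_eq_norm] using this
  filter_upwards [hF, hζ', hζ0, hlim R' (ε / 4) (by positivity)] with i hFi hi hi0 hil z hz
  have hd : Differentiable ℂ fun z => dslope (F i) (ζ i) z - g₁ z := (hFi.dslope_complex _).sub hg₁
  have hbd : ∀ y ∈ frontier (Metric.ball (0 : ℂ) R'), ‖dslope (F i) (ζ i) y - g₁ y‖ ≤ ε / 2 := by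
    intro y hy
    rw [frontier_ball _ hR'0.ne', mem_sphere_zero_iff_norm] at hy
    have hy1 : 1 ≤ ‖y - ζ i‖ := by
      have h1 : ‖y‖ ≤ ‖y - ζ i‖ + (‖ζ i - z₀‖ + ‖z₀‖) := by
        calc ‖y‖ = ‖(y - ζ i) + ((ζ i - z₀) + z₀)‖ := by ring_nf
          _ ≤ _ := (norm_add_le _ _).trans (by gcongr; exact norm_add_le _ _)
      have h2 := hi.trans_le (min_le_left _ _)
      have h3 : ‖z₀‖ ≤ max (|R|) ‖z₀‖ := le_max_right _ _
      linarith
    have e1 : (y - ζ i) * (dslope (F i) (ζ i) y - g₁ y)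
        = (F i y - g y) + (ζ i - z₀) * g₁ y := by
      have := sub_smul_dslope (F i) (ζ i) y
      rw [hi0, sub_zero, smul_eq_mul] at this
      rw [mul_sub, this, hg]; ring
    have e2 : ‖(F i y - g y) + (ζ i - z₀) * g₁ y‖ ≤ ε / 2 := by
      refine (norm_add_le _ _).trans ?_
      have h1 := hil y hy.le
      have h2 : ‖(ζ i - z₀) * g₁ y‖ ≤ ε / (4 * (C + 1)) * C := by
        rw [norm_mul]
        exact mul_le_mul (hi.le.trans (min_le_right _ _))
          (hC y (by simpa using hy.le)) (norm_nonneg _) (by positivity)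
      have h3 : ε / (4 * (C + 1)) * C ≤ ε / 4 := by
        rw [div_mul_eq_mul_div, div_le_div_iff₀ (by positivity) (by positivity)]
        nlinarith
      linarith
    calc ‖dslope (F i) (ζ i) y - g₁ y‖ ≤ ‖y - ζ i‖ * ‖dslope (F i) (ζ i) y - g₁ y‖ :=
          le_mul_of_one_le_left (norm_nonneg _) hy1
      _ = ‖(F i y - g y) + (ζ i - z₀) * g₁ y‖ := by rw [← norm_mul, e1]
      _ ≤ ε / 2 := e2
  have := Complex.norm_le_of_forall_mem_frontier_norm_le Metric.isBounded_ball
    hd.diffContOnCl hbd (subset_closure (show z ∈ Metric.ball (0 : ℂ) R' by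
      rw [mem_ball_zero_iff]
      have : R ≤ max (|R|) ‖z₀‖ := (le_abs_self R).trans (le_max_left _ _)
      linarith))
  exact this.trans_lt (by linarith)

/-- Under locally uniform convergence of entire functions, the zeros of the limit are limits of
zeros, with multiplicity, and the cofactors converge. -/
lemma exists_root_lists_tendsto {ι : Type*} {l : Filter ι} {N : ℕ} :
    ∀ {F : ι → ℂ → ℂ} {g h : ℂ → ℂ} {Λ₀ : Fin N → ℂ},
    (∀ᶠ i in l, Differentiable ℂ (F i)) → Differentiable ℂ h →
    (∀ z, g z = (∏ j, (z - Λ₀ j)) * h z) → (∃ z, h z ≠ 0) →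
    (∀ R ε : ℝ, 0 < ε → ∀ᶠ i in l, ∀ z, ‖z‖ ≤ R → ‖F i z - g z‖ < ε) →
    ∃ (Λ : ι → Fin N → ℂ) (H : ι → ℂ → ℂ), (∀ j, Tendsto (fun i => Λ i j) l (𝓝 (Λ₀ j))) ∧
      (∀ᶠ i in l, Differentiable ℂ (H i) ∧ ∀ z, F i z = (∏ j, (z - Λ i j)) * H i z) ∧
      ∀ R ε : ℝ, 0 < ε → ∀ᶠ i in l, ∀ z, ‖z‖ ≤ R → ‖H i z - h z‖ < ε := by
  induction N with
  | zero =>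
    intro F g h Λ₀ hF hh hg hne hlim
    refine ⟨fun _ => Λ₀, F, fun j => j.elim0, ?_, ?_⟩
    · filter_upwards [hF] with i hi using ⟨hi, by simp⟩
    · simpa [hg] using hlim
  | succ N ih =>
    intro F g h Λ₀ hF hh hg hne hlim
    set g₁ : ℂ → ℂ := fun z => (∏ j : Fin N, (z - Λ₀ j.succ)) * h z with hg₁
    have hg₁d : Differentiable ℂ g₁ := by
      refine Differentiable.mul ?_ hh
      exact Differentiable.fun_finsetProd fun j _ => differentiable_id.sub_const _
    have hgg : ∀ z, g z = (z - Λ₀ 0) * g₁ z := fun z => by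
      rw [hg, Fin.prod_univ_succ, hg₁, mul_assoc]
    have hgd : Differentiable ℂ g := by
      have : g = fun z => (z - Λ₀ 0) * g₁ z := funext hgg
      rw [this]; exact (differentiable_id.sub_const _).mul hg₁d
    have hgne : ∃ z, g z ≠ 0 := by
      obtain ⟨z, hz⟩ := hne
      have h1 : ∀ᶠ y in 𝓝 z, h y ≠ 0 := hh.continuous.continuousAt.eventually_ne hz
      have hfin : (range Λ₀).Finite := finite_range _
      have h2 : ∃ᶠ y in 𝓝 z, y ∉ range Λ₀ := by
        intro hcon
        have : range Λ₀ ∈ 𝓝 z := by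
          filter_upwards [hcon] with y hy using not_not.1 hy
        exact (infinite_of_mem_nhds z this) hfin
      obtain ⟨y, hy1, hy2⟩ := (h2.and_eventually h1).exists
      refine ⟨y, ?_⟩
      rw [hg]
      refine mul_ne_zero (Finset.prod_ne_zero_iff.2 fun j _ => ?_) hy2
      intro hj
      exact hy1 ⟨j, (sub_eq_zero.1 hj).symm⟩
    obtain ⟨ζ, hζ, hζ0⟩ := exists_zeros_tendsto (z₀ := Λ₀ 0) hF hgd hlim (by simp [hgg]) hgne
    obtain ⟨Λ, H, h1, h2, h3⟩ := ih (F := fun i => dslope (F i) (ζ i)) (g := g₁) (h := h)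
      (Λ₀ := fun j => Λ₀ j.succ) (hF.mono fun i hi => hi.dslope_complex _) hh (fun z => rfl) hne
      (eventually_norm_dslope_sub_lt hF hg₁d hgg hlim hζ hζ0)
    refine ⟨fun i => Fin.cons (ζ i) (Λ i), H, ?_, ?_, h3⟩
    · intro j
      refine Fin.cases ?_ (fun j => ?_) j
      · simpa using hζ
      · simpa using h1 j
    · filter_upwards [h2, hζ0] with i hi hi0
      refine ⟨hi.1, fun z => ?_⟩
      have := sub_smul_dslope (F i) (ζ i) z
      rw [hi0, sub_zero, smul_eq_mul] at this
      rw [Fin.prod_univ_succ]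
      simp only [Fin.cons_zero, Fin.cons_succ]
      rw [mul_assoc, ← hi.2, this]

/-- `Λ` lists, with multiplicity, the zeros of the entire function `f` in the closed disc of radius
`R`, none of which lies on the boundary. -/
def HasRootList {N : ℕ} (f : ℂ → ℂ) (R : ℝ) (Λ : Fin N → ℂ) : Prop :=
  (∀ j, ‖Λ j‖ < R) ∧ ∃ h : ℂ → ℂ, Differentiable ℂ h ∧ (∀ z, ‖z‖ ≤ R → h z ≠ 0) ∧
    ∀ z, f z = (∏ j, (z - Λ j)) * h z

lemma eventually_forall_norm_sub_lt {T : Type*} [TopologicalSpace T] {G : T → ℂ → ℂ}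
    (hG : Continuous (Function.uncurry G)) (t₀ : T) (R ε : ℝ) (hε : 0 < ε) :
    ∀ᶠ t in 𝓝 t₀, ∀ z, ‖z‖ ≤ R → ‖G t z - G t₀ z‖ < ε := by
  have := (isCompact_closedBall (0 : ℂ) R).eventually_forall_of_forall_eventually (x₀ := t₀)
    (P := fun t z => ‖G t z - G t₀ z‖ < ε) (by
      intro z _
      have hc : Continuous fun p : T × ℂ => ‖G p.1 p.2 - G t₀ p.2‖ :=
        (hG.sub (hG.comp (continuous_const.prodMk continuous_snd))).norm
      exact hc.continuousAt.eventually_lt continuousAt_const (by simpa using hε))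
  filter_upwards [this] with t ht z hz using ht z (by simpa using hz)

/-- Continuity of roots. -/
lemma HasRootList.eventually_exists {T : Type*} [TopologicalSpace T] {G : T → ℂ → ℂ}
    (hG : Continuous (Function.uncurry G)) (hd : ∀ t, Differentiable ℂ (G t)) {t₀ : T} {R : ℝ}
    (hR : 0 < R) {N : ℕ} {Λ₀ : Fin N → ℂ} (h₀ : HasRootList (G t₀) R Λ₀) {κ : ℝ} (hκ : 0 < κ) :
    ∀ᶠ t in 𝓝 t₀, ∃ Λ : Fin N → ℂ, HasRootList (G t) R Λ ∧ ∀ j, ‖Λ j - Λ₀ j‖ < κ := by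
  obtain ⟨hΛ₀, h, hh, hh0, hG₀⟩ := h₀
  obtain ⟨Λ, H, h1, h2, h3⟩ := exists_root_lists_tendsto (l := 𝓝 t₀) (Eventually.of_forall hd) hh
    hG₀ ⟨0, hh0 0 (by simpa using hR.le)⟩ (eventually_forall_norm_sub_lt hG t₀)
  obtain ⟨zm, hzm, hmin⟩ := (isCompact_closedBall (0 : ℂ) R).exists_isMinOn
    (Metric.nonempty_closedBall.2 hR.le) hh.continuous.norm.continuousOn
  have hm : 0 < ‖h zm‖ := norm_pos_iff.2 (hh0 zm (by simpa using hzm))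
  have e1 : ∀ᶠ t in 𝓝 t₀, ∀ j, ‖Λ t j‖ < R := eventually_all.2 fun j =>
    (h1 j).norm.eventually_lt tendsto_const_nhds (hΛ₀ j)
  have e2 : ∀ᶠ t in 𝓝 t₀, ∀ j, ‖Λ t j - Λ₀ j‖ < κ := eventually_all.2 fun j => by
    have := Metric.tendsto_nhds.1 (h1 j) κ hκ
    simpa only [dist_eq_norm] using this
  filter_upwards [e1, e2, h2, h3 R ‖h zm‖ hm] with t a1 a2 a3 a4
  refine ⟨Λ t, ⟨a1, H t, a3.1, fun z hz h0 => ?_, a3.2⟩, a2⟩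
  have b1 := a4 z hz
  rw [h0, zero_sub, norm_neg] at b1
  exact absurd (hmin (show z ∈ Metric.closedBall (0 : ℂ) R by simpa using hz)) (not_le.2 b1)

lemma analyticOrderAt_prod_sub {N : ℕ} (Λ : Fin N → ℂ) (c : ℂ) :
    analyticOrderAt (fun z => ∏ j, (z - Λ j)) c = {j | Λ j = c}.encard := by
  classical
  have hs : ∀ s : Finset (Fin N), analyticOrderAt (fun z => ∏ j ∈ s, (z - Λ j)) c
      = ((s.filter fun j => Λ j = c).card : ℕ∞) := by
    intro s
    induction s using Finset.induction_on with
    | empty => simp [analyticOrderAt_eq_zero]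
    | insert a s ha ih =>
      have h1 : AnalyticAt ℂ (fun z : ℂ => z - Λ a) c := by fun_prop
      have h2 : AnalyticAt ℂ (fun z : ℂ => ∏ j ∈ s, (z - Λ j)) c :=
        (Differentiable.fun_finsetProd fun j _ => differentiable_id.sub_const _).analyticAt c
      have e : (fun z : ℂ => ∏ j ∈ insert a s, (z - Λ j))
          = (fun z => z - Λ a) * fun z => ∏ j ∈ s, (z - Λ j) := by
        funext z; simp [Finset.prod_insert ha]
      rw [e, analyticOrderAt_mul h1 h2, ih, Finset.filter_insert]
      by_cases hc : Λ a = c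
      · have h3 : analyticOrderAt (fun z : ℂ => z - Λ a) c = 1 := by
          have := (h1.analyticOrderAt_eq_natCast (n := 1)).2
            ⟨fun _ => 1, analyticAt_const, one_ne_zero, by simp [hc]⟩
          simpa using this
        rw [if_pos hc, Finset.card_insert_of_notMem (by simp [ha]), h3]
        push_cast; rw [add_comm]
      · have h3 : analyticOrderAt (fun z : ℂ => z - Λ a) c = 0 :=
          (h1.analyticOrderAt_eq_zero).2 (sub_ne_zero.2 (Ne.symm hc))
        rw [if_neg hc, h3, zero_add]
  rw [hs Finset.univ, ← Set.encard_coe_eq_coe_finsetCard]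
  simp

lemma analyticOrderAt_prod_sub_mul {N : ℕ} {f h : ℂ → ℂ} {Λ : Fin N → ℂ} (c : ℂ)
    (hh : Differentiable ℂ h) (hf : ∀ z, f z = (∏ j, (z - Λ j)) * h z) :
    analyticOrderAt f c = {j | Λ j = c}.encard + analyticOrderAt h c := by
  have e : f = (fun z => ∏ j, (z - Λ j)) * h := funext hf
  rw [e, analyticOrderAt_mul _ (hh.analyticAt c), analyticOrderAt_prod_sub]
  exact (Differentiable.fun_finsetProd fun j _ => differentiable_id.sub_const _).analyticAt c

lemma HasRootList.analyticOrderAt_eq {N : ℕ} {f : ℂ → ℂ} {R : ℝ} {Λ : Fin N → ℂ}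
    (h : HasRootList f R Λ) {c : ℂ} (hc : ‖c‖ ≤ R) :
    analyticOrderAt f c = {j | Λ j = c}.encard := by
  obtain ⟨-, k, hk, hk0, hf⟩ := h
  rw [analyticOrderAt_prod_sub_mul c hk hf, (hk.analyticAt c).analyticOrderAt_eq_zero.2 (hk0 c hc),
    add_zero]

lemma exists_perm_of_encard_le {N : ℕ} {f g : Fin N → ℂ}
    (h : ∀ c, {j | f j = c}.encard ≤ {j | g j = c}.encard) :
    ∃ σ : Equiv.Perm (Fin N), ∀ j, f j = g (σ j) := by
  classical
  have hcard : ∀ (f : Fin N → ℂ) c, {j | f j = c}.encard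
      = ((Finset.univ.val.map f).count c : ℕ∞) := by
    intro f c
    rw [Multiset.count_map, ← Finset.filter_val, Finset.card_val, ← Set.encard_coe_eq_coe_finsetCard]
    congr 1
    ext j
    simp [eq_comm]
  have hle : Finset.univ.val.map f ≤ Finset.univ.val.map g := by
    rw [Multiset.le_iff_count]
    intro c
    have := h c
    rw [hcard, hcard] at this
    exact_mod_cast this
  have heq := Multiset.eq_of_le_of_card_le hle (by simp)
  have hc : ∀ c, Nonempty ({j // f j = c} ≃ {j // g j = c}) := by
    intro c
    rw [← Fintype.card_eq]
    have h1 := hcard f c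
    have h2 := hcard g c
    rw [heq, ← h2] at h1
    have h3 : ({j | f j = c}).ncard = ({j | g j = c}).ncard := by
      rw [Set.ncard, Set.ncard, h1]
    rw [← Nat.card_coe_set_eq, ← Nat.card_coe_set_eq] at h3
    rw [← Nat.card_eq_fintype_card, ← Nat.card_eq_fintype_card]
    exact h3
  refine ⟨Equiv.ofFiberEquiv fun c => (hc c).some, fun j => ?_⟩
  exact (Equiv.ofFiberEquiv_map _ _).symm

/-- A full list of zeros is determined up to order. -/
lemma HasRootList.exists_perm {N : ℕ} {f h : ℂ → ℂ} {R : ℝ} {Λ Λ' : Fin N → ℂ}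
    (hΛ : HasRootList f R Λ) (hΛ' : ∀ j, ‖Λ' j‖ < R) (hh : Differentiable ℂ h)
    (hf : ∀ z, f z = (∏ j, (z - Λ' j)) * h z) :
    ∃ σ : Equiv.Perm (Fin N), ∀ j, Λ' j = Λ (σ j) := by
  refine exists_perm_of_encard_le fun c => ?_
  by_cases hc : ‖c‖ < R
  · rw [← hΛ.analyticOrderAt_eq hc.le, analyticOrderAt_prod_sub_mul c hh hf]
    exact le_self_add
  · have : {j | Λ' j = c} = ∅ := by
      ext j
      simp only [mem_ofPred_eq, mem_empty_iff_false, iff_false]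
      rintro rfl
      exact hc (hΛ' j)
    simp [this]

lemma hasRootList_const_mul_prod {N : ℕ} {Γ : ℂ} (hΓ : Γ ≠ 0) {b : Fin N → ℂ} {f : ℂ → ℂ} {R : ℝ}
    (hf : ∀ z, f z = Γ * ∏ j, (z - b j)) (hb : ∀ j, ‖b j‖ < R) : HasRootList f R b :=
  ⟨hb, fun _ => Γ, differentiable_const _, fun _ _ => hΓ, fun z => by rw [hf, mul_comm]⟩

section Scaling

variable {V : Type*} [NormedAddCommGroup V] [NormedSpace ℝ V] {N : ℕ}
  {G : ℝ × V → ℂ → ℂ} {Ev : V → ℂ → ℂ} {K : ℂ}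

lemma evans_eq_of_scaling
    (hEv : ∀ ρ : ℝ, ρ ≠ 0 → ∀ ξ z, Ev (ρ • ξ) (-Complex.I * ρ * z) = K * ρ ^ N * G (ρ, ξ) z)
    {ρ : ℝ} (hρ : ρ ≠ 0) (ξ : V) (z : ℂ) :
    Ev ξ z = K * ρ ^ N * G (ρ, ρ⁻¹ • ξ) (Complex.I * (ρ : ℂ)⁻¹ * z) := by
  rw [← hEv ρ hρ, smul_inv_smul₀ hρ]
  congr 1
  have : (ρ : ℂ) ≠ 0 := by exact_mod_cast hρ
  field_simp
  rw [Complex.I_sq]; ring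

lemma evans_factor_of_scaling
    (hEv : ∀ ρ : ℝ, ρ ≠ 0 → ∀ ξ z, Ev (ρ • ξ) (-Complex.I * ρ * z) = K * ρ ^ N * G (ρ, ξ) z)
    {ρ : ℝ} (hρ : ρ ≠ 0) {ξ : V} {Λ : Fin N → ℂ} {k : ℂ → ℂ}
    (hG : ∀ z, G (ρ, ξ) z = (∏ j, (z - Λ j)) * k z) (z : ℂ) :
    Ev (ρ • ξ) z = (∏ j, (z - -Complex.I * ρ * Λ j)) *
      (K * Complex.I ^ N * k (Complex.I * (ρ : ℂ)⁻¹ * z)) := by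
  have hρ' : (ρ : ℂ) ≠ 0 := by exact_mod_cast hρ
  rw [evans_eq_of_scaling hEv hρ, inv_smul_smul₀ hρ, hG]
  have : ∏ j, (z - -Complex.I * ρ * Λ j)
      = (-Complex.I * ρ) ^ N * ∏ j, (Complex.I * (ρ : ℂ)⁻¹ * z - Λ j) := by
    rw [← Fin.prod_const, ← Finset.prod_mul_distrib]
    refine Finset.prod_congr rfl fun j _ => ?_
    field_simp
    linear_combination z * Complex.I_sq
  rw [this, mul_pow]
  have h2 : (-Complex.I) ^ N * Complex.I ^ N = 1 := by
    rw [← mul_pow, neg_mul, Complex.I_mul_I]; simp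
  linear_combination (-(K * ρ ^ N * (∏ j, (Complex.I * (ρ : ℂ)⁻¹ * z - Λ j)) *
    k (Complex.I * (ρ : ℂ)⁻¹ * z))) * h2

lemma HasRootList.of_scaling (hK : K ≠ 0)
    (hEv : ∀ ρ : ℝ, ρ ≠ 0 → ∀ ξ z, Ev (ρ • ξ) (-Complex.I * ρ * z) = K * ρ ^ N * G (ρ, ξ) z)
    {ρ : ℝ} (hρ : 0 < ρ) {ξ : V} {R : ℝ} {Λ : Fin N → ℂ} (h : HasRootList (G (ρ, ξ)) R Λ) :
    HasRootList (Ev (ρ • ξ)) (ρ * R) fun j => -Complex.I * ρ * Λ j := by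
  obtain ⟨h1, k, hk, hk0, hG⟩ := h
  refine ⟨fun j => ?_, fun z => K * Complex.I ^ N * k (Complex.I * (ρ : ℂ)⁻¹ * z), ?_, ?_,
    evans_factor_of_scaling hEv hρ.ne' hG⟩
  · simp only [norm_mul, norm_neg, Complex.norm_I, one_mul, Complex.norm_real, Real.norm_eq_abs,
      abs_of_pos hρ]
    exact mul_lt_mul_of_pos_left (h1 j) hρ
  · exact (hk.comp (differentiable_id.const_mul _)).const_mul _
  · intro z hz
    refine mul_ne_zero (mul_ne_zero hK (pow_ne_zero _ Complex.I_ne_zero)) (hk0 _ ?_)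
    simp only [norm_mul, Complex.norm_I, one_mul, norm_inv, Complex.norm_real, Real.norm_eq_abs,
      abs_of_pos hρ]
    rw [inv_mul_le_iff₀ hρ]; exact hz

/-- Blow-up at the origin: if `Ev`, rescaled by `ρ`, extends continuously to `ρ = 0` with limit
a nonzero multiple of `∏ j, (σ - b ξ j)`, then the small zeros of `Ev ξ` form `N` surfaces that are
asymptotic to `-i b ξ j`. -/
theorem exists_root_surfaces [ProperSpace V] (hGc : Continuous (Function.uncurry G))
    (hGd : ∀ t, Differentiable ℂ (G t)) (hK : K ≠ 0)
    (hEv : ∀ ρ : ℝ, ρ ≠ 0 → ∀ ξ z, Ev (ρ • ξ) (-Complex.I * ρ * z) = K * ρ ^ N * G (ρ, ξ) z)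
    {Γ : ℂ} (hΓ : Γ ≠ 0) {b : V → Fin N → ℂ}
    (hb : ∀ ξ z, G (0, ξ) z = Γ * ∏ j, (z - b ξ j))
    (hbs : ∀ ρ : ℝ, 0 < ρ → ∀ ξ j, b (ρ • ξ) j = ρ * b ξ j) :
    ∃ r > (0 : ℝ), ∃ ε > (0 : ℝ), ∃ Λ a : Fin N → V → ℂ,
      (∀ ξ, ∃ σ : Equiv.Perm (Fin N), ∀ j, a j ξ = b ξ (σ j)) ∧
      (∀ ξ, ‖ξ‖ < ε → HasRootList (Ev ξ) r fun j => Λ j ξ) ∧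
      (∀ ξ₀, ‖ξ₀‖ < ε → ∀ κ > (0 : ℝ), ∀ᶠ ξ in 𝓝 ξ₀,
        ∃ σ : Equiv.Perm (Fin N), ∀ j, ‖Λ j ξ - Λ (σ j) ξ₀‖ < κ) ∧
      (∀ j, (fun ξ => Λ j ξ - (-Complex.I * a j ξ)) =o[𝓝 0] fun ξ => ‖ξ‖) := by
  have hb0 : ∀ j, b 0 j = 0 := by
    intro j
    have := hbs 2 two_pos 0 j
    rw [smul_zero] at this
    push_cast at this
    linear_combination -this
  have hstart : HasRootList (G (0, 0)) 1 (b 0) :=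
    hasRootList_const_mul_prod hΓ (hb 0) fun j => by simp [hb0]
  have hev := hstart.eventually_exists hGc hGd one_pos one_pos
  obtain ⟨δ, hδ, hδ'⟩ := Metric.eventually_nhds_iff.1 hev
  set r := δ / 2 with hr
  have hr0 : 0 < r := by positivity
  have hlist : ∀ ρ : ℝ, 0 < ρ → ρ ≤ r → ∀ ξ : V, ‖ξ‖ < δ →
      ∃ Λ : Fin N → ℂ, HasRootList (G (ρ, ξ)) 1 Λ := by
    intro ρ h1 h2 ξ h3
    obtain ⟨Λ, hΛ, -⟩ := hδ' (y := (ρ, ξ)) (by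
      rw [Prod.dist_eq]
      simp only [dist_zero_right, Real.norm_eq_abs, abs_of_pos h1]
      exact max_lt (by linarith) h3)
    exact ⟨Λ, hΛ⟩
  have hE : ∀ ξ : V, ‖ξ‖ < r * δ → ∃ Λ : Fin N → ℂ, HasRootList (Ev ξ) r Λ := by
    intro ξ hξ
    obtain ⟨Λ, hΛ⟩ := hlist r hr0 le_rfl (r⁻¹ • ξ) (by
      rw [norm_smul, norm_inv, Real.norm_eq_abs, abs_of_pos hr0, inv_mul_lt_iff₀ hr0]; exact hξ)
    have := hΛ.of_scaling hK hEv hr0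
    rw [smul_inv_smul₀ hr0.ne', mul_one] at this
    exact ⟨_, this⟩
  have hEvd : ∀ ξ, Differentiable ℂ (Ev ξ) := by
    intro ξ
    have : Ev ξ = fun z => K * r ^ N * G (r, r⁻¹ • ξ) (Complex.I * (r : ℂ)⁻¹ * z) :=
      funext (evans_eq_of_scaling hEv hr0.ne' ξ)
    rw [this]
    exact ((hGd _).comp (differentiable_id.const_mul _)).const_mul _
  have hEvc : Continuous (Function.uncurry Ev) := by
    have : Function.uncurry Ev = fun p : V × ℂ =>
        K * r ^ N * Function.uncurry G ((r, r⁻¹ • p.1), (Complex.I * (r : ℂ)⁻¹ * p.2)) :=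
      funext fun p => evans_eq_of_scaling hEv hr0.ne' p.1 p.2
    rw [this]
    exact continuous_const.mul (hGc.comp (by fun_prop))
  have hE0 : ∀ z, ‖z‖ < r → Ev 0 z = 0 → z = 0 := by
    intro z hz h0
    by_contra hne
    have hz0 : 0 < ‖z‖ := norm_pos_iff.2 hne
    obtain ⟨Λ, h1, k, hk, hk0, hG⟩ := hlist ‖z‖ hz0 hz.le 0 (by simpa using hδ)
    have hzz : (‖z‖ : ℂ) ≠ 0 := by exact_mod_cast hz0.ne'
    rw [evans_eq_of_scaling hEv hz0.ne', smul_zero, hG] at h0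
    have hnorm : ‖Complex.I * (‖z‖ : ℂ)⁻¹ * z‖ = 1 := by
      simp [hz0.ne']
    have h3 := hk0 _ hnorm.le
    have h4 : ∏ j, (Complex.I * (‖z‖ : ℂ)⁻¹ * z - Λ j) ≠ 0 := by
      refine Finset.prod_ne_zero_iff.2 fun j _ hj => ?_
      have := h1 j
      rw [← sub_eq_zero.1 hj, hnorm] at this
      exact lt_irrefl _ this
    exact (mul_ne_zero (mul_ne_zero hK (pow_ne_zero _ hzz)) (mul_ne_zero h4 h3)) h0
  choose! Λ hΛ using hE
  have hperm : ∀ ξ : V, ∃ σ : Equiv.Perm (Fin N), ∀ τ : Equiv.Perm (Fin N),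
      ‖fun j => Λ ξ j + Complex.I * b ξ (σ j)‖ ≤ ‖fun j => Λ ξ j + Complex.I * b ξ (τ j)‖ :=
    fun ξ => Finite.exists_min _
  choose σ hσ using hperm
  refine ⟨r, hr0, r * δ, by positivity, fun j ξ => Λ ξ j, fun j ξ => b ξ (σ ξ j),
    fun ξ => ⟨σ ξ, fun j => rfl⟩, hΛ, ?_, ?_⟩
  · intro ξ₀ hξ₀ κ hκ
    have h1 := (hΛ ξ₀ hξ₀).eventually_exists hEvc hEvd hr0 hκ
    have h2 : ∀ᶠ ξ : V in 𝓝 ξ₀, ‖ξ‖ < r * δ :=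
      continuous_norm.continuousAt.eventually_lt continuousAt_const hξ₀
    filter_upwards [h1, h2] with ξ h1 h2
    obtain ⟨Λ', hΛ', hclose⟩ := h1
    obtain ⟨hn, h, hh, -, hf⟩ := hΛ ξ h2
    obtain ⟨τ, hτ⟩ := hΛ'.exists_perm hn hh hf
    exact ⟨τ, fun j => by rw [hτ j]; exact hclose _⟩
  · have main : ∀ κ : ℝ, 0 < κ → ∀ᶠ ξ : V in 𝓝 0, ξ ≠ 0 →
        ∃ τ : Equiv.Perm (Fin N), ∀ j, ‖Λ ξ j + Complex.I * b ξ (τ j)‖ ≤ κ * ‖ξ‖ := by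
      intro κ hκ
      have hcpt := (isCompact_sphere (0 : V) 1).eventually_forall_of_forall_eventually
        (x₀ := (0 : ℝ)) (P := fun ρ ξ => ∃ Λ' : Fin N → ℂ, (∃ h, Differentiable ℂ h ∧
          ∀ z, G (ρ, ξ) z = (∏ j, (z - Λ' j)) * h z) ∧ (∀ j, |ρ| * ‖Λ' j‖ < r) ∧
          ∃ τ : Equiv.Perm (Fin N), ∀ j, ‖Λ' j - b ξ (τ j)‖ ≤ κ) (by
        intro ξ₀ _
        set R := 1 + ∑ j, ‖b ξ₀ j‖ with hRdef
        have hR : 0 < R := by positivity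
        have hbR : ∀ j, ‖b ξ₀ j‖ < R := fun j => by
          have := Finset.single_le_sum (f := fun j => ‖b ξ₀ j‖) (fun j _ => norm_nonneg _)
            (Finset.mem_univ j)
          linarith
        have e1 := (hasRootList_const_mul_prod hΓ (hb ξ₀) hbR).eventually_exists
          hGc hGd hR (half_pos hκ)
        have e2 : ∀ᶠ p : ℝ × V in 𝓝 (0, ξ₀), ∃ Λ : Fin N → ℂ, HasRootList (G (0, p.2)) R Λ ∧
            ∀ j, ‖Λ j - b ξ₀ j‖ < κ / 2 := by
          have hc : Tendsto (fun p : ℝ × V => ((0 : ℝ), p.2)) (𝓝 (0, ξ₀)) (𝓝 (0, ξ₀)) :=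
            (continuous_const.prodMk continuous_snd).tendsto _
          exact hc.eventually e1
        have e3 : ∀ᶠ p : ℝ × V in 𝓝 (0, ξ₀), |p.1| * R < r := by
          have hc : Continuous fun p : ℝ × V => |p.1| * R := by fun_prop
          exact hc.continuousAt.eventually_lt continuousAt_const (by simpa using hr0)
        filter_upwards [e1, e2, e3] with p h1 h2 h3
        obtain ⟨Λ', ⟨hn, h, hh, -, hf⟩, hc⟩ := h1
        obtain ⟨Λ'', ⟨hn', h', hh', -, hf'⟩, hc'⟩ := h2
        refine ⟨Λ', ⟨h, hh, hf⟩, fun j => ?_, ?_⟩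
        · exact (mul_le_mul_of_nonneg_left (hn j).le (abs_nonneg _)).trans_lt h3
        · set R' := R + ∑ j, ‖b p.2 j‖ with hR'
          have hl : HasRootList (G (0, p.2)) R' (b p.2) :=
            hasRootList_const_mul_prod hΓ (hb p.2) fun j => by
              have := Finset.single_le_sum (f := fun j => ‖b p.2 j‖) (fun j _ => norm_nonneg _)
                (Finset.mem_univ j)
              linarith
          have hRR' : R ≤ R' := le_add_of_nonneg_right (Finset.sum_nonneg fun j _ => norm_nonneg _)
          obtain ⟨τ, hτ⟩ := hl.exists_perm (fun j => (hn' j).trans_le hRR') hh' hf'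
          refine ⟨τ, fun j => ?_⟩
          rw [← hτ]
          calc ‖Λ' j - Λ'' j‖ = ‖(Λ' j - b ξ₀ j) - (Λ'' j - b ξ₀ j)‖ := by ring_nf
            _ ≤ ‖Λ' j - b ξ₀ j‖ + ‖Λ'' j - b ξ₀ j‖ := norm_sub_le _ _
            _ ≤ κ := by linarith [hc j, hc' j])
      have h1 : ∀ᶠ ξ : V in 𝓝 0, ‖ξ‖ < r * δ :=
        continuous_norm.continuousAt.eventually_lt continuousAt_const (by simp; positivity)
      have h2 := (show Tendsto (fun ξ : V => ‖ξ‖) (𝓝 0) (𝓝 0) by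
        simpa using (continuous_norm (E := V)).tendsto 0).eventually hcpt
      filter_upwards [h1, h2] with ξ h1 h2 hξ
      have hξ0 : 0 < ‖ξ‖ := norm_pos_iff.2 hξ
      set ω : V := ‖ξ‖⁻¹ • ξ with hω
      have hωξ : ‖ξ‖ • ω = ξ := by rw [hω, smul_inv_smul₀ hξ0.ne']
      obtain ⟨Λ', ⟨h, hh, hf⟩, hn, τ, hτ⟩ := h2 ω (by
        rw [mem_sphere_zero_iff_norm, hω, norm_smul, norm_inv, norm_norm, inv_mul_cancel₀ hξ0.ne'])
      have hEξ := evans_factor_of_scaling hEv hξ0.ne' hf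
      rw [hωξ] at hEξ
      obtain ⟨π, hπ⟩ := (hΛ ξ h1).exists_perm (Λ' := fun j => -Complex.I * ‖ξ‖ * Λ' j)
        (fun j => by
          have := hn j
          rw [abs_of_pos hξ0] at this
          simpa using this)
        ((hh.comp (differentiable_id.const_mul _)).const_mul _) hEξ
      refine ⟨π.symm.trans τ, fun j => ?_⟩
      have h4 := hπ (π.symm j)
      rw [Equiv.apply_symm_apply] at h4
      have h5 : b ξ (τ (π.symm j)) = ‖ξ‖ * b ω (τ (π.symm j)) := by
        rw [← hbs ‖ξ‖ hξ0, hωξ]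
      rw [← h4, Equiv.trans_apply, h5]
      calc ‖-Complex.I * ‖ξ‖ * Λ' (π.symm j) + Complex.I * (‖ξ‖ * b ω (τ (π.symm j)))‖
          = ‖(-Complex.I * ‖ξ‖) * (Λ' (π.symm j) - b ω (τ (π.symm j)))‖ := by ring_nf
        _ = ‖ξ‖ * ‖Λ' (π.symm j) - b ω (τ (π.symm j))‖ := by simp
        _ ≤ ‖ξ‖ * κ := by gcongr; exact hτ _
        _ = κ * ‖ξ‖ := mul_comm _ _
    intro j
    rw [Asymptotics.isLittleO_iff]
    intro κ hκ
    filter_upwards [main κ hκ] with ξ hξ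
    rw [norm_norm]
    have e : Λ ξ j - -Complex.I * b ξ (σ ξ j) = Λ ξ j + Complex.I * b ξ (σ ξ j) := by ring
    rw [e]
    by_cases h0 : ξ = 0
    · subst h0
      have hl := hΛ 0 (by simpa using mul_pos hr0 hδ)
      obtain ⟨hn, h, -, -, hf⟩ := hl
      have : Λ 0 j = 0 := hE0 _ (hn j) (by
        rw [hf, Finset.prod_eq_zero (Finset.mem_univ j) (sub_self _), zero_mul])
      simp [this, hb0]
    · obtain ⟨τ, hτ⟩ := hξ h0
      refine (norm_le_pi_norm (fun j => Λ ξ j + Complex.I * b ξ (σ ξ j)) j).trans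
        ((hσ ξ τ).trans ?_)
      exact (pi_norm_le_iff_of_nonneg (by positivity)).2 hτ

end Scaling

section LinearODE

open scoped NNReal

variable {E : Type*} [NormedAddCommGroup E] [NormedSpace ℝ E]

lemma gronwallBound_le {δ K ε x : ℝ} (hK : 0 ≤ K) (hε : 0 ≤ ε) :
    gronwallBound δ K ε x ≤ (δ + ε * x) * Real.exp (K * x) := by
  rcases hK.eq_or_lt with rfl | hK
  · simp [gronwallBound_K0]
  · rw [gronwallBound_of_K_ne_0 hK.ne', add_mul]
    refine add_le_add_right ?_ _
    have h1 : Real.exp (K * x) - 1 ≤ K * x * Real.exp (K * x) := by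
      have h := Real.add_one_le_exp (-(K * x))
      have h2 : Real.exp (-(K * x)) * Real.exp (K * x) = 1 := by rw [← Real.exp_add]; simp
      nlinarith [Real.exp_pos (K * x)]
    calc ε / K * (Real.exp (K * x) - 1) ≤ ε / K * (K * x * Real.exp (K * x)) := by gcongr
      _ = ε * x * Real.exp (K * x) := by field_simp

lemma norm_le_of_norm_deriv_le_forward {f f' : ℝ → E} {T δ K ε : ℝ} (hK : 0 ≤ K) (hε : 0 ≤ ε)
    (hf : ∀ t ∈ Icc 0 T, HasDerivWithinAt f (f' t) (Icc 0 T) t) (h0 : ‖f 0‖ ≤ δ)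
    (hb : ∀ t ∈ Icc 0 T, ‖f' t‖ ≤ K * ‖f t‖ + ε) {t : ℝ} (ht : t ∈ Icc 0 T) :
    ‖f t‖ ≤ (δ + ε * T) * Real.exp (K * T) := by
  have h1 := norm_le_gronwallBound_of_norm_deriv_right_le (f := f) (f' := f') (a := 0) (b := T)
    (fun t ht => (hf t ht).continuousWithinAt)
    (fun x hx => (hf x ⟨hx.1, hx.2.le⟩).mono_of_mem_nhdsWithin
      (Icc_mem_nhdsGE_of_mem hx)) h0
    (fun x hx => hb x ⟨hx.1, hx.2.le⟩) t ht
  rw [sub_zero] at h1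
  have hδ : 0 ≤ δ := (norm_nonneg _).trans h0
  refine h1.trans ((gronwallBound_le hK hε).trans ?_)
  have hT : 0 ≤ T := ht.1.trans ht.2
  gcongr
  · exact ht.2
  · exact ht.2

/-- A two-sided Grönwall estimate. -/
lemma norm_le_of_norm_deriv_le {f f' : ℝ → E} {T δ K ε : ℝ} (hK : 0 ≤ K) (hε : 0 ≤ ε)
    (hf : ∀ t ∈ Icc (-T) T, HasDerivWithinAt f (f' t) (Icc (-T) T) t) (h0 : ‖f 0‖ ≤ δ)
    (hb : ∀ t ∈ Icc (-T) T, ‖f' t‖ ≤ K * ‖f t‖ + ε) {t : ℝ} (ht : t ∈ Icc (-T) T) :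
    ‖f t‖ ≤ (δ + ε * T) * Real.exp (K * T) := by
  have hT : 0 ≤ T := by linarith [ht.1, ht.2]
  have hsub : Icc 0 T ⊆ Icc (-T) T := Icc_subset_Icc (by linarith) le_rfl
  rcases le_total 0 t with h | h
  · exact norm_le_of_norm_deriv_le_forward hK hε (fun t ht => (hf t (hsub ht)).mono hsub) h0
      (fun t ht => hb t (hsub ht)) ⟨h, ht.2⟩
  · have hneg : ∀ s ∈ Icc 0 T, -s ∈ Icc (-T) T := fun s hs => ⟨by linarith [hs.2],
      by linarith [hs.1]⟩
    have := norm_le_of_norm_deriv_le_forward (f := fun s => f (-s)) (f' := fun s => -f' (-s))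
      (T := T) (δ := δ) hK hε (fun s hs => ?_) (by simpa using h0)
      (fun s hs => by rw [norm_neg]; exact hb _ (hneg s hs)) (t := -t) ⟨by linarith, by linarith [ht.1]⟩
    · simpa using this
    · have h1 := (hf (-s) (hneg s hs)).scomp s (hasDerivAt_neg s).hasDerivWithinAt
        (s := Icc 0 T) (fun x hx => hneg x hx)
      simpa [Function.comp_def] using h1

/-- The radial retraction onto the closed ball of radius `R`. -/
noncomputable def radialClamp (R : ℝ) (x : E) : E := (R / max R ‖x‖) • x

lemma norm_radialClamp_le {R : ℝ} (hR : 0 < R) (x : E) : ‖radialClamp R x‖ ≤ R := by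
  have hm : 0 < max R ‖x‖ := lt_max_of_lt_left hR
  rw [radialClamp, norm_smul, Real.norm_eq_abs, abs_of_pos (by positivity), div_mul_eq_mul_div,
    div_le_iff₀ hm]
  gcongr; exact le_max_right _ _

lemma norm_radialClamp_le_norm {R : ℝ} (hR : 0 < R) (x : E) : ‖radialClamp R x‖ ≤ ‖x‖ := by
  have hm : 0 < max R ‖x‖ := lt_max_of_lt_left hR
  rw [radialClamp, norm_smul, Real.norm_eq_abs, abs_of_pos (by positivity)]
  exact mul_le_of_le_one_left (norm_nonneg _) ((div_le_one hm).2 (le_max_left _ _))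

lemma radialClamp_of_norm_le {R : ℝ} (hR : 0 < R) {x : E} (hx : ‖x‖ ≤ R) : radialClamp R x = x := by
  rw [radialClamp, max_eq_left hx, div_self hR.ne', one_smul]

lemma lipschitzWith_radialClamp {R : ℝ} (hR : 0 < R) :
    LipschitzWith 2 (radialClamp R : E → E) := by
  refine LipschitzWith.of_dist_le_mul fun x y => ?_
  rw [dist_eq_norm, dist_eq_norm]
  set a := max R ‖x‖ with ha
  set b := max R ‖y‖ with hb
  have ha0 : 0 < a := lt_max_of_lt_left hR
  have hb0 : 0 < b := lt_max_of_lt_left hR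
  have e : radialClamp R x - radialClamp R y = (R / a) • (x - y) + (R / a - R / b) • y := by
    simp only [radialClamp, ← ha, ← hb, smul_sub, sub_smul]; abel
  have h1 : |b - a| ≤ ‖x - y‖ := by
    have h2 : |b - a| ≤ |‖y‖ - ‖x‖| := by
      rw [ha, hb]; rw [max_comm R, max_comm R]; exact abs_max_sub_max_le_abs _ _ _
    exact h2.trans (by rw [norm_sub_rev]; exact abs_norm_sub_norm_le _ _)
  have h3 : ‖(R / a - R / b) • y‖ ≤ ‖x - y‖ := by
    have : R / a - R / b = (R / a) * ((b - a) / b) := by field_simp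
    rw [norm_smul, this, norm_mul, Real.norm_eq_abs, Real.norm_eq_abs, abs_div (b - a),
      abs_of_pos hb0, abs_of_pos (by positivity : (0 : ℝ) < R / a)]
    have h4 : R / a ≤ 1 := (div_le_one ha0).2 (le_max_left _ _)
    have h5 : ‖y‖ / b ≤ 1 := (div_le_one hb0).2 (le_max_right _ _)
    calc R / a * (|b - a| / b) * ‖y‖ = (R / a) * |b - a| * (‖y‖ / b) := by ring
      _ ≤ 1 * |b - a| * 1 := by gcongr
      _ ≤ ‖x - y‖ := by simpa using h1
  have h6 : ‖(R / a) • (x - y)‖ ≤ ‖x - y‖ := by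
    rw [norm_smul, Real.norm_eq_abs, abs_of_pos (by positivity)]
    exact mul_le_of_le_one_left (norm_nonneg _) ((div_le_one ha0).2 (le_max_left _ _))
  rw [e]
  refine (norm_add_le _ _).trans ?_
  simp only [NNReal.coe_ofNat]
  linarith

/-- Existence for bounded, globally Lipschitz fields. -/
lemma exists_solution_of_bounded_of_lipschitz [CompleteSpace E] {f : ℝ → E → E} {T : ℝ} {K : ℝ≥0}
    {L : ℝ} (hT : 0 ≤ T) (hlip : ∀ t ∈ Icc (-T) T, LipschitzWith K (f t))
    (hc : ∀ x, ContinuousOn (fun t => f t x) (Icc (-T) T))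
    (hL : ∀ t ∈ Icc (-T) T, ∀ x, ‖f t x‖ ≤ L) (x₀ : E) :
    ∃ α : ℝ → E, α 0 = x₀ ∧ ∀ t ∈ Icc (-T) T, HasDerivWithinAt α (f t (α t)) (Icc (-T) T) t := by
  have h0 : (0 : ℝ) ∈ Icc (-T) T := ⟨by linarith, hT⟩
  have hL0 : 0 ≤ L := (norm_nonneg _).trans (hL 0 h0 0)
  have hpl : IsPicardLindelof f (⟨0, h0⟩ : Icc (-T) T) x₀ (L.toNNReal * T.toNNReal) 0
      L.toNNReal K := by
    refine ⟨fun t ht => (hlip t ht).lipschitzOnWith, fun x _ => hc x, fun t ht x _ => ?_, ?_⟩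
    · rw [Real.coe_toNNReal _ hL0]; exact hL t ht x
    · simp [hT]
  exact hpl.exists_eq_forall_mem_Icc_hasDerivWithinAt₀

lemma exists_linear_solution_Icc [CompleteSpace E] {A : ℝ → E →L[ℝ] E} (hA : Continuous A) {T : ℝ}
    (hT : 0 ≤ T) (x₀ : E) :
    ∃ α : ℝ → E, α 0 = x₀ ∧ ∀ t ∈ Icc (-T) T, HasDerivWithinAt α (A t (α t)) (Icc (-T) T) t := by
  obtain ⟨K, hK⟩ := (isCompact_Icc (a := -T) (b := T)).exists_bound_of_continuousOn hA.continuousOn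
  have hK0 : 0 ≤ K := (norm_nonneg _).trans (hK 0 ⟨by linarith, hT⟩)
  set R := ‖x₀‖ * Real.exp (K * T) + 1 with hR
  have hR0 : 0 < R := by positivity
  obtain ⟨α, h0, hα⟩ := exists_solution_of_bounded_of_lipschitz (f := fun t x => A t (radialClamp R x))
    (T := T) (K := K.toNNReal * 2) (L := K * R) hT
    (fun t ht => by
      have h1 : LipschitzWith K.toNNReal (A t) :=
        (A t).lipschitz.weaken (by
          rw [← NNReal.coe_le_coe, Real.coe_toNNReal _ hK0]; exact hK t ht)
      exact h1.comp (lipschitzWith_radialClamp hR0))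
    (fun x => by fun_prop)
    (fun t ht x => ((A t).le_opNorm _).trans (mul_le_mul (hK t ht) (norm_radialClamp_le hR0 _)
      (norm_nonneg _) hK0)) x₀
  refine ⟨α, h0, fun t ht => ?_⟩
  have hb := norm_le_of_norm_deriv_le (δ := ‖x₀‖) hK0 le_rfl hα (by rw [h0]) (fun t ht => by
    rw [add_zero]
    exact ((A t).le_opNorm _).trans (mul_le_mul (hK t ht) (norm_radialClamp_le_norm hR0 _)
      (norm_nonneg _) hK0)) ht
  have h2 := hα t ht
  rwa [radialClamp_of_norm_le hR0 (by rw [hR]; linarith)] at h2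

lemma linear_solution_unique_Icc {A : ℝ → E →L[ℝ] E} (hA : Continuous A) {T : ℝ}
    {α β : ℝ → E} (h0 : α 0 = β 0)
    (hα : ∀ t ∈ Icc (-T) T, HasDerivWithinAt α (A t (α t)) (Icc (-T) T) t)
    (hβ : ∀ t ∈ Icc (-T) T, HasDerivWithinAt β (A t (β t)) (Icc (-T) T) t) {t : ℝ}
    (ht : t ∈ Icc (-T) T) : α t = β t := by
  obtain ⟨K, hK⟩ := (isCompact_Icc (a := -T) (b := T)).exists_bound_of_continuousOn hA.continuousOn
  have hK0 : 0 ≤ K := (norm_nonneg _).trans (hK t ht)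
  have := norm_le_of_norm_deriv_le (f := fun t => α t - β t) (δ := 0) hK0 le_rfl
    (fun t ht => (hα t ht).sub (hβ t ht)) (by simp [h0]) (fun t ht => by
      rw [add_zero, ← map_sub]
      exact ((A t).le_opNorm _).trans (by gcongr; exact hK t ht)) ht
  simpa [sub_eq_zero] using this

lemma exists_linear_solution [CompleteSpace E] {A : ℝ → E →L[ℝ] E} (hA : Continuous A) (x₀ : E) :
    ∃ α : ℝ → E, α 0 = x₀ ∧ ∀ t, HasDerivAt α (A t (α t)) t := by
  have h := fun T : {T : ℝ // 0 ≤ T} => exists_linear_solution_Icc hA T.2 x₀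
  choose α h0 hα using h
  refine ⟨fun t => α ⟨|t| + 1, by positivity⟩ t, h0 _, fun t => ?_⟩
  set T : {T : ℝ // 0 ≤ T} := ⟨|t| + 2, by positivity⟩ with hT
  have hTv : (T : ℝ) = |t| + 2 := rfl
  have key : ∀ s, |s| ≤ |t| + 1 → α ⟨|s| + 1, by positivity⟩ s = α T s := by
    intro s hs
    have hsub : Icc (-(|s| + 1)) (|s| + 1) ⊆ Icc (-(T : ℝ)) T :=
      Icc_subset_Icc (by rw [hTv]; linarith) (by rw [hTv]; linarith)
    exact linear_solution_unique_Icc (T := |s| + 1) hA (by rw [h0, h0])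
      (hα ⟨|s| + 1, by positivity⟩)
      (fun x hx => (hα T x (hsub hx)).mono hsub)
      ⟨by linarith [neg_abs_le s], by linarith [le_abs_self s]⟩
  have hev : (fun t => α ⟨|t| + 1, by positivity⟩ t) =ᶠ[𝓝 t] α T := by
    have : ∀ᶠ s in 𝓝 t, |s| < |t| + 1 :=
      continuous_abs.continuousAt.eventually_lt continuousAt_const (by linarith)
    filter_upwards [this] with s hs using key s hs.le
  have hd : HasDerivAt (α T) (A t (α T t)) t := by
    have hlt : -(T : ℝ) < t ∧ t < T := by
      rw [hTv]; exact ⟨by linarith [neg_abs_le t], by linarith [le_abs_self t]⟩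
    exact (hα T t ⟨hlt.1.le, hlt.2.le⟩).hasDerivAt (Icc_mem_nhds hlt.1 hlt.2)
  have := hd.congr_of_eventuallyEq hev
  rwa [← key t (by linarith)] at this

open Classical in
/-- The solution `α` of the linear equation `α' = A t α` with `α 0 = x₀`. -/
noncomputable def linearFlow (A : ℝ → E →L[ℝ] E) (x₀ : E) : ℝ → E :=
  if h : ∃ α : ℝ → E, α 0 = x₀ ∧ ∀ t, HasDerivAt α (A t (α t)) t then Classical.choose h else 0

variable [CompleteSpace E] {A : ℝ → E →L[ℝ] E}

lemma linearFlow_zero (hA : Continuous A) (x₀ : E) : linearFlow A x₀ 0 = x₀ := by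
  have h := exists_linear_solution hA x₀
  rw [linearFlow, dif_pos h]
  exact (Classical.choose_spec h).1

lemma hasDerivAt_linearFlow (hA : Continuous A) (x₀ : E) (t : ℝ) :
    HasDerivAt (linearFlow A x₀) (A t (linearFlow A x₀ t)) t := by
  have h := exists_linear_solution hA x₀
  rw [linearFlow, dif_pos h]
  exact (Classical.choose_spec h).2 t

lemma eq_linearFlow (hA : Continuous A) {α : ℝ → E} (hα : ∀ t, HasDerivAt α (A t (α t)) t) (t : ℝ) :
    α t = linearFlow A (α 0) t :=
  linear_solution_unique_Icc (T := |t|) hA (linearFlow_zero hA _).symm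
    (fun s _ => (hα s).hasDerivWithinAt) (fun s _ => (hasDerivAt_linearFlow hA _ s).hasDerivWithinAt)
    ⟨neg_abs_le t, le_abs_self t⟩

lemma linearFlow_add (hA : Continuous A) (x y : E) (t : ℝ) :
    linearFlow A (x + y) t = linearFlow A x t + linearFlow A y t := by
  have := eq_linearFlow hA (α := fun t => linearFlow A x t + linearFlow A y t) (fun t => by
    rw [map_add]; exact (hasDerivAt_linearFlow hA x t).add (hasDerivAt_linearFlow hA y t)) t
  rw [linearFlow_zero hA, linearFlow_zero hA] at this
  exact this.symm

lemma linearFlow_smul {𝕜 : Type*} [RCLike 𝕜] [NormedSpace 𝕜 E] {A : ℝ → E →L[ℝ] E}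
    (hA : Continuous A) (hlin : ∀ t (c : 𝕜) x, A t (c • x) = c • A t x) (c : 𝕜) (x : E) (t : ℝ) :
    linearFlow A (c • x) t = c • linearFlow A x t := by
  have := eq_linearFlow hA (α := fun t => c • linearFlow A x t) (fun t => by
    rw [hlin]; exact (hasDerivAt_linearFlow hA x t).const_smul c) t
  rw [linearFlow_zero hA] at this
  exact this.symm

/-- Solutions of linear equations depend continuously on parameters. -/
lemma continuous_linearFlow_param {P : Type*} [TopologicalSpace P] {A : P → ℝ → E →L[ℝ] E}
    (hA : Continuous (Function.uncurry A)) {x : P → E} (hx : Continuous x) (t : ℝ) :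
    Continuous fun π => linearFlow (A π) (x π) t := by
  have hAπ : ∀ π, Continuous (A π) := fun π => hA.comp (Continuous.prodMk_right π)
  rw [continuous_iff_continuousAt]
  intro π₀
  set T := |t| with hT
  have hT0 : 0 ≤ T := abs_nonneg t
  set β := linearFlow (A π₀) (x π₀) with hβ
  have hβc : Continuous β := continuous_iff_continuousAt.2 fun s =>
    (hasDerivAt_linearFlow (hAπ π₀) _ s).continuousAt
  obtain ⟨K, hK⟩ := (isCompact_Icc (a := -T) (b := T)).exists_bound_of_continuousOn
    (hAπ π₀).continuousOn
  have hK0 : 0 ≤ K := (norm_nonneg _).trans (hK 0 ⟨by linarith, hT0⟩)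
  have e1 : ∀ᶠ π in 𝓝 π₀, ∀ s ∈ Icc (-T) T, ‖A π s‖ < K + 1 :=
    isCompact_Icc.eventually_forall_of_forall_eventually (P := fun π s => ‖A π s‖ < K + 1)
      fun s hs => hA.norm.continuousAt.eventually_lt continuousAt_const
        (by simpa using (hK s hs).trans_lt (lt_add_one K))
  rw [ContinuousAt, Metric.tendsto_nhds]
  intro ε hε
  set C := (1 + T) * Real.exp ((K + 1) * T) with hC
  have hC0 : 0 < C := by positivity
  set κ := ε / (2 * C) with hκ
  have hκ0 : 0 < κ := by positivity
  have e2 : ∀ᶠ π in 𝓝 π₀, ∀ s ∈ Icc (-T) T, ‖(A π s - A π₀ s) (β s)‖ < κ :=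
    isCompact_Icc.eventually_forall_of_forall_eventually
      (P := fun π s => ‖(A π s - A π₀ s) (β s)‖ < κ) fun s hs => by
      have hc : Continuous fun p : P × ℝ => ‖(A p.1 p.2 - A π₀ p.2) (β p.2)‖ := by
        have h1 : Continuous fun p : P × ℝ => A p.1 p.2 := hA
        have h2 := hAπ π₀
        fun_prop
      exact hc.continuousAt.eventually_lt continuousAt_const (by simpa using hκ0)
  have e3 : ∀ᶠ π in 𝓝 π₀, ‖x π - x π₀‖ < κ := by
    have := Metric.tendsto_nhds.1 (hx.continuousAt (x := π₀)) κ hκ0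
    simpa only [dist_eq_norm] using this
  filter_upwards [e1, e2, e3] with π h1 h2 h3
  have := norm_le_of_norm_deriv_le (f := fun s => linearFlow (A π) (x π) s - β s) (T := T) (δ := κ)
    (K := K + 1) (ε := κ) (by positivity) hκ0.le
    (fun s _ => ((hasDerivAt_linearFlow (hAπ π) _ s).sub
      (hasDerivAt_linearFlow (hAπ π₀) _ s)).hasDerivWithinAt)
    (by rw [linearFlow_zero (hAπ π), hβ, linearFlow_zero (hAπ π₀)]; exact h3.le)
    (fun s hs => by
      have : A π s (linearFlow (A π) (x π) s) - A π₀ s (linearFlow (A π₀) (x π₀) s)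
          = A π s (linearFlow (A π) (x π) s - β s) + (A π s - A π₀ s) (β s) := by
        simp [hβ]
      rw [this]
      refine (norm_add_le _ _).trans ?_
      gcongr
      · exact ((A π s).le_opNorm _).trans (by gcongr; exact (h1 s hs).le)
      · exact (h2 s hs).le) (t := t) ⟨neg_abs_le t, le_abs_self t⟩
  rw [dist_eq_norm]
  refine this.trans_lt ?_
  calc (κ + κ * T) * Real.exp ((K + 1) * T) = κ * C := by rw [hC]; ring
    _ = ε / 2 := by rw [hκ]; field_simp
    _ < ε := by linarith

end LinearODE

section NonlinearODE

open scoped NNReal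

variable {E : Type*} [NormedAddCommGroup E] [NormedSpace ℝ E] {g : E → E} {O : Set E}

/-- Uniqueness for autonomous `C¹` fields on an open set. -/
lemma solution_unique_of_contDiffOn (hO : IsOpen O) (hg : ContDiffOn ℝ 1 g O) {φ ψ : ℝ → E}
    {α β : ℝ} (hφ : ∀ t ∈ Ioo α β, φ t ∈ O ∧ HasDerivAt φ (g (φ t)) t)
    (hψ : ∀ t ∈ Ioo α β, ψ t ∈ O ∧ HasDerivAt ψ (g (ψ t)) t) {t₀ : ℝ} (ht₀ : t₀ ∈ Ioo α β)
    (h0 : φ t₀ = ψ t₀) : EqOn φ ψ (Ioo α β) := by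
  set u : Set ℝ := {t | t ∈ Ioo α β ∧ φ t = ψ t} with hu
  have hopen : IsOpen u := by
    rw [isOpen_iff_mem_nhds]
    rintro t ⟨ht, hteq⟩
    have hcd : ContDiffAt ℝ 1 g (φ t) := hg.contDiffAt (hO.mem_nhds (hφ t ht).1)
    obtain ⟨K, s, hs, hK⟩ := hcd.exists_lipschitzOnWith
    have hI : ∀ᶠ x in 𝓝 t, x ∈ Ioo α β := Ioo_mem_nhds ht.1 ht.2
    have h1 : ∀ᶠ x in 𝓝 t, φ x ∈ s := (hφ t ht).2.continuousAt.eventually hs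
    have h2 : ∀ᶠ x in 𝓝 t, ψ x ∈ s :=
      (hψ t ht).2.continuousAt.eventually (by rw [← hteq]; exact hs)
    have := ODE_solution_unique_of_eventually (v := fun _ => g) (s := fun _ => s) (K := K)
      (Eventually.of_forall fun _ => hK)
      (by filter_upwards [hI, h1] with x hx hx1 using ⟨(hφ x hx).2, hx1⟩)
      (by filter_upwards [hI, h2] with x hx hx1 using ⟨(hψ x hx).2, hx1⟩) hteq
    filter_upwards [hI, this] with x hx hx1 using ⟨hx, hx1⟩
  have hsub := isPreconnected_Ioo.subset_of_closure_inter_subset (s := Ioo α β) hopen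
    ⟨t₀, ht₀, ht₀, h0⟩ (by
      rintro t ⟨htc, ht⟩
      refine ⟨ht, ?_⟩
      rw [mem_closure_iff_frequently] at htc
      by_contra hne
      have h3 : ∀ᶠ x in 𝓝 t, φ x - ψ x ≠ 0 :=
        ((hφ t ht).2.continuousAt.sub (hψ t ht).2.continuousAt).eventually_ne (sub_ne_zero.2 hne)
      obtain ⟨x, hx1, hx2⟩ := (htc.and_eventually h3).exists
      exact hx2 (sub_eq_zero.2 hx1.2))
  exact fun t ht => (hsub ht).2

/-- Along a compact arc in `O`, the field `g` is uniformly strictly differentiable. -/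
lemma exists_uniform_strict_derivative (hO : IsOpen O) (hg : ContDiffOn ℝ 1 g O) {γ : ℝ → E}
    (hγ : Continuous γ) (hγO : ∀ t, γ t ∈ O) (T : ℝ) {ε : ℝ} (hε : 0 < ε) :
    ∃ δ > 0, ∀ t ∈ Icc (-T) T, ∀ h h' : E, ‖h‖ < δ → ‖h'‖ < δ → γ t + h ∈ O ∧
      ‖g (γ t + h) - g (γ t + h') - fderiv ℝ g (γ t) (h - h')‖ ≤ ε * ‖h - h'‖ := by
  have hDc : Continuous fun t => fderiv ℝ g (γ t) := by
    have h1 : ContinuousOn (fderiv ℝ g) O := hg.continuousOn_fderiv_of_isOpen hO le_rfl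
    exact h1.comp_continuous hγ hγO
  have key := (isCompact_Icc (a := -T) (b := T)).eventually_forall_of_forall_eventually
    (x₀ := ((0 : E), (0 : E))) (P := fun p t => γ t + p.1 ∈ O ∧
      ‖g (γ t + p.1) - g (γ t + p.2) - fderiv ℝ g (γ t) (p.1 - p.2)‖ ≤ ε * ‖p.1 - p.2‖) (by
    intro t₀ _
    have hs : HasStrictFDerivAt g (fderiv ℝ g (γ t₀)) (γ t₀) :=
      (hg.contDiffAt (hO.mem_nhds (hγO t₀))).hasStrictFDerivAt one_ne_zero
    have h1 := (Asymptotics.isLittleO_iff.1 hs.isLittleO) (half_pos hε)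
    have hc : Tendsto (fun z : (E × E) × ℝ => (γ z.2 + z.1.1, γ z.2 + z.1.2)) (𝓝 ((0, 0), t₀))
        (𝓝 (γ t₀, γ t₀)) := by
      have : Continuous fun z : (E × E) × ℝ => (γ z.2 + z.1.1, γ z.2 + z.1.2) := by fun_prop
      simpa using this.tendsto ((0, 0), t₀)
    have h2 := hc.eventually h1
    have h3 : ∀ᶠ z : (E × E) × ℝ in 𝓝 ((0, 0), t₀), γ z.2 + z.1.1 ∈ O := by
      have : Continuous fun z : (E × E) × ℝ => γ z.2 + z.1.1 := by fun_prop
      exact this.continuousAt.eventually (by simpa using hO.mem_nhds (hγO t₀))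
    have h4 : ∀ᶠ z : (E × E) × ℝ in 𝓝 ((0, 0), t₀),
        ‖fderiv ℝ g (γ z.2) - fderiv ℝ g (γ t₀)‖ < ε / 2 := by
      have : Continuous fun z : (E × E) × ℝ => ‖fderiv ℝ g (γ z.2) - fderiv ℝ g (γ t₀)‖ :=
        ((hDc.comp continuous_snd).sub continuous_const).norm
      exact this.continuousAt.eventually_lt continuousAt_const (by simpa using half_pos hε)
    filter_upwards [h2, h3, h4] with z a1 a2 a3
    refine ⟨a2, ?_⟩
    simp only [add_sub_add_left_eq_sub] at a1
    have e : g (γ z.2 + z.1.1) - g (γ z.2 + z.1.2) - fderiv ℝ g (γ z.2) (z.1.1 - z.1.2)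
        = (g (γ z.2 + z.1.1) - g (γ z.2 + z.1.2) - fderiv ℝ g (γ t₀) (z.1.1 - z.1.2))
          - (fderiv ℝ g (γ z.2) - fderiv ℝ g (γ t₀)) (z.1.1 - z.1.2) := by
      simp only [sub_apply]; abel
    rw [e]
    refine (norm_sub_le _ _).trans ?_
    have a4 := ((fderiv ℝ g (γ z.2) - fderiv ℝ g (γ t₀)).le_opNorm (z.1.1 - z.1.2))
    have a5 : ‖fderiv ℝ g (γ z.2) - fderiv ℝ g (γ t₀)‖ * ‖z.1.1 - z.1.2‖
      ≤ ε / 2 * ‖z.1.1 - z.1.2‖ := by gcongr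
    linarith)
  obtain ⟨δ, hδ, hδ'⟩ := Metric.eventually_nhds_iff.1 key
  refine ⟨δ, hδ, fun t ht h h' hh hh' => hδ' (y := (h, h')) ?_ t ht⟩
  rw [Prod.dist_eq]
  simpa using ⟨hh, hh'⟩

variable [CompleteSpace E]

/-- Near a reference solution `γ` the equation `y' = g y` has solutions on `[-T, T]`, and they are
differentiable in the initial value, uniformly on `[-T, T]`; the derivative is the flow of the
variational equation. -/
theorem exists_solutions_near (hO : IsOpen O) (hg : ContDiffOn ℝ 1 g O) {γ : ℝ → E}
    (hγO : ∀ t, γ t ∈ O) (hγ : ∀ t, HasDerivAt γ (g (γ t)) t) {T : ℝ} (hT : 0 ≤ T) :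
    ∃ Ψ : E → ℝ → E, (∀ᶠ y in 𝓝 (γ 0), Ψ y 0 = y ∧ ∀ t ∈ Icc (-T) T, Ψ y t ∈ O ∧
        HasDerivWithinAt (Ψ y) (g (Ψ y t)) (Icc (-T) T) t) ∧
      ∀ ε > 0, ∀ᶠ y in 𝓝 (γ 0), ∀ t ∈ Icc (-T) T,
        ‖Ψ y t - γ t - linearFlow (fun t => fderiv ℝ g (γ t)) (y - γ 0) t‖ ≤ ε * ‖y - γ 0‖ := by
  have hγc : Continuous γ := continuous_iff_continuousAt.2 fun t => (hγ t).continuousAt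
  have hDc : Continuous fun t => fderiv ℝ g (γ t) :=
    (hg.continuousOn_fderiv_of_isOpen hO le_rfl).comp_continuous hγc hγO
  obtain ⟨D, hD⟩ := (isCompact_Icc (a := -T) (b := T)).exists_bound_of_continuousOn
    hDc.continuousOn
  have hD0 : 0 ≤ D := (norm_nonneg _).trans (hD 0 ⟨by linarith, hT⟩)
  obtain ⟨δ, hδ, hδ'⟩ := exists_uniform_strict_derivative hO hg hγc hγO T one_pos
  set r := δ / 2 with hr
  have hr0 : 0 < r := by positivity
  have hrδ : r < δ := by rw [hr]; linarith
  set L := D + 1 with hL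
  have hL0 : 0 ≤ L := by positivity
  have hLip : ∀ t ∈ Icc (-T) T, ∀ h h' : E, ‖h‖ ≤ r → ‖h'‖ ≤ r →
      ‖g (γ t + h) - g (γ t + h')‖ ≤ L * ‖h - h'‖ := by
    intro t ht h h' hh hh'
    have h1 := (hδ' t ht h h' (hh.trans_lt hrδ) (hh'.trans_lt hrδ)).2
    have h2 : ‖fderiv ℝ g (γ t) (h - h')‖ ≤ D * ‖h - h'‖ :=
      ((fderiv ℝ g (γ t)).le_opNorm _).trans (by gcongr; exact hD t ht)
    calc ‖g (γ t + h) - g (γ t + h')‖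
        = ‖(g (γ t + h) - g (γ t + h') - fderiv ℝ g (γ t) (h - h')) + fderiv ℝ g (γ t) (h - h')‖ := by
          rw [sub_add_cancel]
      _ ≤ 1 * ‖h - h'‖ + D * ‖h - h'‖ := (norm_add_le _ _).trans (by gcongr)
      _ = L * ‖h - h'‖ := by rw [hL]; ring
  have hex : ∀ y : E, ∃ e : ℝ → E, e 0 = y - γ 0 ∧ ∀ t ∈ Icc (-T) T,
      HasDerivWithinAt e (g (γ t + radialClamp r (e t)) - g (γ t)) (Icc (-T) T) t := by
    intro y
    refine exists_solution_of_bounded_of_lipschitz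
      (f := fun t e => g (γ t + radialClamp r e) - g (γ t)) (K := L.toNNReal * 2) (L := L * r) hT
      (fun t ht => ?_) (fun x => ?_) (fun t ht x => ?_) (y - γ 0)
    · refine LipschitzWith.of_dist_le_mul fun x x' => ?_
      rw [dist_eq_norm, sub_sub_sub_cancel_right]
      refine (hLip t ht _ _ (norm_radialClamp_le hr0 _) (norm_radialClamp_le hr0 _)).trans ?_
      have h1 := (lipschitzWith_radialClamp (E := E) hr0).dist_le_mul x x'
      rw [dist_eq_norm] at h1
      push_cast
      rw [Real.coe_toNNReal _ hL0, mul_assoc]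
      gcongr
      simpa using h1
    · have h1 : ContinuousOn (fun t => γ t + radialClamp r x) (Icc (-T) T) :=
        (hγc.add continuous_const).continuousOn
      have h2 : MapsTo (fun t => γ t + radialClamp r x) (Icc (-T) T) O := fun t ht =>
        (hδ' t ht _ 0 ((norm_radialClamp_le hr0 x).trans_lt hrδ) (by simpa using hδ)).1
      exact (hg.continuousOn.comp h1 h2).sub (hg.continuousOn.comp_continuous hγc hγO).continuousOn
    · have h1 := hLip t ht (radialClamp r x) 0 (norm_radialClamp_le hr0 _) (by simpa using hr0.le)
      rw [add_zero, sub_zero] at h1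
      exact h1.trans (by gcongr; exact norm_radialClamp_le hr0 _)
  choose e he0 he using hex
  have hebound : ∀ y, ∀ t ∈ Icc (-T) T, ‖e y t‖ ≤ ‖y - γ 0‖ * Real.exp (L * T) := by
    intro y t ht
    have := norm_le_of_norm_deriv_le (δ := ‖y - γ 0‖) hL0 le_rfl (he y) (by rw [he0])
      (fun t ht => by
        have h1 := hLip t ht (radialClamp r (e y t)) 0 (norm_radialClamp_le hr0 _)
          (by simpa using hr0.le)
        rw [add_zero, sub_zero] at h1
        rw [add_zero]
        exact h1.trans (by gcongr; exact norm_radialClamp_le_norm hr0 _)) ht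
    simpa using this
  have hsmall : ∀ η : ℝ, 0 < η → ∀ᶠ y in 𝓝 (γ 0), ‖y - γ 0‖ * Real.exp (L * T) < η := by
    intro η hη
    have hc : Continuous fun y => ‖y - γ 0‖ * Real.exp (L * T) := by fun_prop
    exact hc.continuousAt.eventually_lt continuousAt_const (by simpa using hη)
  refine ⟨fun y t => γ t + e y t, ?_, ?_⟩
  · filter_upwards [hsmall r hr0] with y hy
    refine ⟨by rw [he0]; abel, fun t ht => ?_⟩
    have hle : ‖e y t‖ ≤ r := (hebound y t ht).trans hy.le
    refine ⟨(hδ' t ht _ 0 (hle.trans_lt hrδ) (by simpa using hδ)).1, ?_⟩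
    have h1 := (hγ t).hasDerivWithinAt.add (he y t ht)
    rw [radialClamp_of_norm_le hr0 hle] at h1
    rw [add_sub_cancel] at h1
    exact h1
  · intro ε hε
    set C := Real.exp (L * T) with hC
    set ε' := ε / (C * (T + 1) * C) with hε'
    have hC0 : 0 < C := Real.exp_pos _
    have hε'0 : 0 < ε' := by positivity
    obtain ⟨δ₂, hδ₂, hδ₂'⟩ := exists_uniform_strict_derivative hO hg hγc hγO T hε'0
    filter_upwards [hsmall r hr0, hsmall δ₂ hδ₂] with y hy hy2 t ht
    have hb := norm_le_of_norm_deriv_le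
      (f := fun t => e y t - linearFlow (fun t => fderiv ℝ g (γ t)) (y - γ 0) t) (δ := 0) (K := L)
      (ε := ε' * (‖y - γ 0‖ * C)) hL0 (by positivity)
      (fun t ht => (he y t ht).sub (hasDerivAt_linearFlow hDc _ t).hasDerivWithinAt)
      (by rw [he0, linearFlow_zero hDc]; simp) (fun t ht => by
        have hle : ‖e y t‖ ≤ r := (hebound y t ht).trans hy.le
        rw [radialClamp_of_norm_le hr0 hle]
        have h1 := (hδ₂' t ht (e y t) 0 ((hebound y t ht).trans_lt hy2) (by simpa using hδ₂)).2
        rw [add_zero, sub_zero] at h1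
        have e1 : g (γ t + e y t) - g (γ t)
            - fderiv ℝ g (γ t) (linearFlow (fun t => fderiv ℝ g (γ t)) (y - γ 0) t)
            = fderiv ℝ g (γ t) (e y t - linearFlow (fun t => fderiv ℝ g (γ t)) (y - γ 0) t)
              + (g (γ t + e y t) - g (γ t) - fderiv ℝ g (γ t) (e y t)) := by
          rw [map_sub]; abel
        rw [e1]
        refine (norm_add_le _ _).trans (add_le_add ?_ ?_)
        · refine ((fderiv ℝ g (γ t)).le_opNorm _).trans ?_
          gcongr
          exact (hD t ht).trans (by rw [hL]; linarith)
        · refine h1.trans ?_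
          gcongr
          exact hebound y t ht) ht
    have e2 : γ t + e y t - γ t - linearFlow (fun t => fderiv ℝ g (γ t)) (y - γ 0) t
        = e y t - linearFlow (fun t => fderiv ℝ g (γ t)) (y - γ 0) t := by abel
    rw [e2]
    refine hb.trans ?_
    rw [zero_add, ← hC]
    calc ε' * (‖y - γ 0‖ * C) * T * C ≤ ε' * (‖y - γ 0‖ * C) * (T + 1) * C := by
          gcongr; linarith
      _ = ε * ‖y - γ 0‖ := by rw [hε']; field_simp

/-- The solution operator of a linear equation, at time `t`. -/
noncomputable def linearFlowCLM [FiniteDimensional ℝ E] {A : ℝ → E →L[ℝ] E} (hA : Continuous A)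
    (t : ℝ) : E →L[ℝ] E :=
  LinearMap.toContinuousLinearMap
    { toFun := fun x => linearFlow A x t
      map_add' := fun x y => linearFlow_add hA x y t
      map_smul' := fun c x => linearFlow_smul (𝕜 := ℝ) hA (fun t c x => map_smul (A t) c x) c x t }

@[simp] lemma linearFlowCLM_apply [FiniteDimensional ℝ E] {A : ℝ → E →L[ℝ] E}
    (hA : Continuous A) (t : ℝ) (x : E) : linearFlowCLM hA t x = linearFlow A x t := rfl

/-- Joint differentiability in time and initial value. -/
lemma hasFDerivAt_of_uniform_expansion [FiniteDimensional ℝ E] {Ψ : E → ℝ → E} {γ : ℝ → E} {v : E}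
    {A : ℝ → E →L[ℝ] E} (hA : Continuous A) {T X : ℝ} (hX : X ∈ Ioo (-T) T)
    (hγ : HasDerivAt γ v X)
    (hΨ : ∀ ε > 0, ∀ᶠ y in 𝓝 (γ 0), ∀ t ∈ Icc (-T) T,
      ‖Ψ y t - γ t - linearFlow A (y - γ 0) t‖ ≤ ε * ‖y - γ 0‖) :
    HasFDerivAt (fun p : ℝ × E => Ψ p.2 p.1)
      ((ContinuousLinearMap.toSpanSingleton ℝ v).comp (ContinuousLinearMap.fst ℝ ℝ E) +
        (linearFlowCLM hA X).comp (ContinuousLinearMap.snd ℝ ℝ E)) (X, γ 0) := by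
  have hbase : Ψ (γ 0) X = γ X := by
    have := (hΨ 1 one_pos).self_of_nhds X ⟨hX.1.le, hX.2.le⟩
    rw [sub_self, norm_zero, mul_zero, norm_le_zero_iff] at this
    have h0 : linearFlow A 0 X = 0 := by
      have := linearFlow_smul (𝕜 := ℝ) hA (fun t c x => map_smul (A t) c x) 0 0 X
      simpa using this
    rw [h0, sub_zero] at this
    exact sub_eq_zero.1 this
  have hVc : Continuous fun t => linearFlowCLM hA t := by
    rw [continuous_clm_apply]
    intro x
    exact continuous_iff_continuousAt.2 fun t => (hasDerivAt_linearFlow hA x t).continuousAt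
  rw [hasFDerivAt_iff_isLittleO_nhds_zero, Asymptotics.isLittleO_iff]
  intro ε hε
  have t1 : Tendsto (fun h : ℝ × E => γ 0 + h.2) (𝓝 0) (𝓝 (γ 0)) := by
    have : Continuous fun h : ℝ × E => γ 0 + h.2 := by fun_prop
    simpa using this.tendsto 0
  have t2 : Tendsto (fun h : ℝ × E => X + h.1) (𝓝 0) (𝓝 X) := by
    have : Continuous fun h : ℝ × E => X + h.1 := by fun_prop
    simpa using this.tendsto 0
  have t3 : Tendsto (fun h : ℝ × E => h.1) (𝓝 0) (𝓝 0) := by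
    have : Continuous fun h : ℝ × E => h.1 := by fun_prop
    simpa using this.tendsto 0
  have e1 := t1.eventually (hΨ (ε / 3) (by positivity))
  have e2 : ∀ᶠ h : ℝ × E in 𝓝 0, X + h.1 ∈ Ioo (-T) T := t2.eventually (Ioo_mem_nhds hX.1 hX.2)
  have e3 := t3.eventually ((Asymptotics.isLittleO_iff.1
    (hasDerivAt_iff_isLittleO_nhds_zero.1 hγ)) (show (0 : ℝ) < ε / 3 by positivity))
  have e4 : ∀ᶠ h : ℝ × E in 𝓝 0, ‖linearFlowCLM hA (X + h.1) - linearFlowCLM hA X‖ < ε / 3 := by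
    have := t2.eventually (Metric.tendsto_nhds.1 (hVc.tendsto X) (ε / 3) (by positivity))
    simpa only [dist_eq_norm] using this
  filter_upwards [e1, e2, e3, e4] with h h1 h2 h3 h4
  have h1' := h1 (X + h.1) ⟨h2.1.le, h2.2.le⟩
  rw [add_sub_cancel_left] at h1'
  have h5 := ((linearFlowCLM hA (X + h.1) - linearFlowCLM hA X).le_opNorm h.2)
  have h6 : ‖linearFlowCLM hA (X + h.1) - linearFlowCLM hA X‖ * ‖h.2‖ ≤ ε / 3 * ‖h‖ := by
    gcongr
    exact norm_snd_le h
  have h7 : ε / 3 * ‖h.2‖ ≤ ε / 3 * ‖h‖ := by gcongr; exact norm_snd_le h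
  have h8 : ε / 3 * ‖h.1‖ ≤ ε / 3 * ‖h‖ := by gcongr; exact norm_fst_le h
  have e : Ψ ((X, γ 0) + h).2 ((X, γ 0) + h).1 - Ψ (X, γ 0).2 (X, γ 0).1 -
      ((ContinuousLinearMap.toSpanSingleton ℝ v).comp (ContinuousLinearMap.fst ℝ ℝ E) +
        (linearFlowCLM hA X).comp (ContinuousLinearMap.snd ℝ ℝ E)) h
      = (Ψ (γ 0 + h.2) (X + h.1) - γ (X + h.1) - linearFlow A h.2 (X + h.1))
        + (γ (X + h.1) - γ X - h.1 • v)
        + (linearFlowCLM hA (X + h.1) - linearFlowCLM hA X) h.2 := by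
    simp only [Prod.fst_add, Prod.snd_add, hbase, add_apply, sub_apply,
      ContinuousLinearMap.comp_apply,
      ContinuousLinearMap.coe_fst', ContinuousLinearMap.coe_snd',
      ContinuousLinearMap.toSpanSingleton_apply, linearFlowCLM_apply]
    abel
  rw [e]
  calc _ ≤ ‖Ψ (γ 0 + h.2) (X + h.1) - γ (X + h.1) - linearFlow A h.2 (X + h.1)‖
        + ‖γ (X + h.1) - γ X - h.1 • v‖
        + ‖(linearFlowCLM hA (X + h.1) - linearFlowCLM hA X) h.2‖ := norm_add₃_le
    _ ≤ ε * ‖h‖ := by linarith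

end NonlinearODE

section MatrixRegularity

variable {E : Type*} [NormedAddCommGroup E] [NormedSpace ℝ E] {n : ℕ} {s : Set E} {k : WithTop ℕ∞}

lemma contDiffOn_det {A : E → Matrix (Fin n) (Fin n) ℝ}
    (h : ∀ i j, ContDiffOn ℝ k (fun x => A x i j) s) : ContDiffOn ℝ k (fun x => (A x).det) s := by
  simp only [Matrix.det_apply]
  exact ContDiffOn.sum fun σ _ => (contDiffOn_prod fun i _ => h _ _).const_smul _

lemma contDiffOn_inv_mulVec {A : E → Matrix (Fin n) (Fin n) ℝ} {b : E → Fin n → ℝ}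
    (hA : ∀ i j, ContDiffOn ℝ k (fun x => A x i j) s) (hb : ContDiffOn ℝ k b s)
    (hdet : ∀ x ∈ s, (A x).det ≠ 0) : ContDiffOn ℝ k (fun x => (A x)⁻¹.mulVec (b x)) s := by
  have hadj : ∀ i j, ContDiffOn ℝ k (fun x => (A x).adjugate i j) s := by
    intro i j
    simp only [Matrix.adjugate_apply]
    refine contDiffOn_det fun a c => ?_
    simp only [Matrix.updateRow_apply]
    split_ifs
    · exact contDiffOn_const
    · exact hA a c
  rw [contDiffOn_pi]
  intro i
  simp only [Matrix.inv_def, Ring.inverse_eq_inv', Matrix.mulVec, dotProduct, Matrix.smul_apply,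
    smul_eq_mul]
  exact ContDiffOn.sum fun j _ => (((contDiffOn_det hA).inv hdet).mul (hadj i j)).mul
    ((contDiffOn_pi.1 hb) j)

lemma contDiffOn_mulVec {A : E → Matrix (Fin n) (Fin n) ℝ} {b : E → Fin n → ℝ}
    (hA : ∀ i j, ContDiffOn ℝ k (fun x => A x i j) s) (hb : ContDiffOn ℝ k b s) :
    ContDiffOn ℝ k (fun x => (A x).mulVec (b x)) s := by
  rw [contDiffOn_pi]
  intro i
  simp only [Matrix.mulVec, dotProduct]
  exact ContDiffOn.sum fun j _ => (hA i j).mul ((contDiffOn_pi.1 hb) j)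

end MatrixRegularity

section Direction

variable {m : ℕ}

lemma one_add_sum_sq_pos (δ : Fin m → ℝ) : 0 < 1 + ∑ j, δ j ^ 2 := by
  have : 0 ≤ ∑ j, δ j ^ 2 := Finset.sum_nonneg fun j _ => sq_nonneg _
  linarith

lemma sum_direction_sq (δ : Fin m → ℝ) : ∑ j, direction δ j ^ 2 = 1 := by
  have h := one_add_sum_sq_pos δ
  simp only [direction, Pi.smul_apply, smul_eq_mul, mul_pow, ← Finset.mul_sum]
  rw [inv_pow, Real.sq_sqrt h.le, Fin.sum_univ_succ]
  simp only [Fin.cons_zero, Fin.cons_succ, one_pow]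
  exact inv_mul_cancel₀ h.ne'

lemma contDiff_direction {k : WithTop ℕ∞} : ContDiff ℝ k (direction : (Fin m → ℝ) → _) := by
  have h1 : ContDiff ℝ k fun δ : Fin m → ℝ => 1 + ∑ j, δ j ^ 2 :=
    contDiff_const.add (ContDiff.sum fun j _ => (contDiff_apply ℝ ℝ j).pow 2)
  refine ContDiff.smul ((h1.sqrt fun δ => (one_add_sum_sq_pos δ).ne').inv fun δ =>
    (Real.sqrt_pos.2 (one_add_sum_sq_pos δ)).ne') ?_
  rw [contDiff_pi]
  refine Fin.cases ?_ fun j => ?_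
  · simpa using contDiff_const
  · simpa using contDiff_apply ℝ ℝ j

@[simp] lemma direction_zero : direction (0 : Fin m → ℝ) = Pi.single 0 1 := by
  funext k
  refine Fin.cases ?_ (fun j => ?_) k <;> simp [direction]

lemma hasDerivAt_direction_line (δ : Fin m → ℝ) (k : Fin (m + 1)) :
    HasDerivAt (fun ε : ℝ => direction (ε • δ) k) ((Fin.cons 0 δ : Fin (m + 1) → ℝ) k) 0 := by
  have h1 : HasDerivAt (fun ε : ℝ => (Real.sqrt (1 + ∑ j, (ε • δ) j ^ 2))⁻¹) 0 0 := by
    have h2 : HasDerivAt (fun ε : ℝ => 1 + ε ^ 2 * ∑ j, δ j ^ 2) 0 0 := by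
      have := (((hasDerivAt_pow 2 (0 : ℝ)).mul_const (∑ j, δ j ^ 2)).const_add 1)
      simpa using this
    have h3 := (h2.sqrt (by simp)).fun_inv (by simp)
    simp only [Pi.smul_apply, smul_eq_mul, mul_pow, ← Finset.mul_sum]
    simpa using h3
  have h4 : HasDerivAt (fun ε : ℝ => (Fin.cons 1 (ε • δ) : Fin (m + 1) → ℝ) k)
      ((Fin.cons 0 δ : Fin (m + 1) → ℝ) k) 0 := by
    refine Fin.cases ?_ (fun j => ?_) k
    · simpa using hasDerivAt_const (0 : ℝ) (1 : ℝ)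
    · simpa using (hasDerivAt_id (0 : ℝ)).mul_const (δ j)
  have := h1.fun_mul h4
  simpa [direction] using this

end Direction

namespace ViscousSystem

variable {n m : ℕ} (S : ViscousSystem n m)

/-- The flux in direction `j` of the planar state with value `u` and slope `w`. -/
noncomputable def planarFlux (ν : Fin (m + 1) → ℝ) (u w : Fin n → ℝ) (j : Fin (m + 1)) :
    Fin n → ℝ :=
  S.f j u - ∑ k, ν k • (S.B j k u).mulVec w

/-- The right-hand side of the profile equation, solved for the derivative; the parameters are
`(s, δ, q)`. -/
noncomputable def slope (u : Fin n → ℝ) (p : ℝ × (Fin m → ℝ) × (Fin n → ℝ)) : Fin n → ℝ :=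
  (S.normalB (direction p.2.1) u)⁻¹.mulVec
    (∑ j, direction p.2.1 j • S.f j u - p.1 • u - p.2.2)

/-- States `(u, (s, δ, q), ∫ u, ∫ flux)`. -/
abbrev AugState (n m : ℕ) : Type :=
  (Fin n → ℝ) × (ℝ × (Fin m → ℝ) × (Fin n → ℝ)) × (Fin n → ℝ) × (Fin (m + 1) → Fin n → ℝ)

/-- The profile equation as an autonomous field, augmented by the parameters and by the integrals
of the state and of the fluxes. -/
noncomputable def augField (Y : AugState n m) : AugState n m :=
  (S.slope Y.1 Y.2.1, 0, Y.1, S.planarFlux (direction Y.2.1.2.1) Y.1 (S.slope Y.1 Y.2.1))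

variable {S}

lemma det_normalB_ne_zero (h1 : S.H1) {u : Fin n → ℝ} (hu : u ∈ S.U) {ν : Fin (m + 1) → ℝ}
    (hν : ∑ j, ν j ^ 2 = 1) : (S.normalB ν u).det ≠ 0 := by
  obtain ⟨θ, hθ, h⟩ := h1
  intro h0
  have hmem : (0 : ℂ) ∈ spectrum ℂ ((S.normalB ν u).map (fun r : ℝ => (r : ℂ))) := by
    rw [spectrum.zero_mem_iff, Matrix.isUnit_iff_isUnit_det]
    have e : ((S.normalB ν u).map (fun r : ℝ => (r : ℂ))).det = ((S.normalB ν u).det : ℂ) :=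
      (RingHom.map_det Complex.ofRealHom (S.normalB ν u)).symm
    rw [e, h0]; simp
  have := h u hu ν hν 0 hmem
  simp at this
  linarith

lemma normalB_mulVec_slope (h1 : S.H1) {u : Fin n → ℝ} (hu : u ∈ S.U)
    (p : ℝ × (Fin m → ℝ) × (Fin n → ℝ)) :
    (S.normalB (direction p.2.1) u).mulVec (S.slope u p)
      = ∑ j, direction p.2.1 j • S.f j u - p.1 • u - p.2.2 := by
  have hd := det_normalB_ne_zero h1 hu (sum_direction_sq p.2.1)
  rw [slope, Matrix.mulVec_mulVec, Matrix.mul_nonsing_inv _ (isUnit_iff_ne_zero.2 hd),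
    Matrix.one_mulVec]

lemma eq_slope_of_mulVec_eq (h1 : S.H1) {u w : Fin n → ℝ} (hu : u ∈ S.U)
    (p : ℝ × (Fin m → ℝ) × (Fin n → ℝ))
    (h : (S.normalB (direction p.2.1) u).mulVec w
      = ∑ j, direction p.2.1 j • S.f j u - p.1 • u - p.2.2) : w = S.slope u p := by
  have hd := det_normalB_ne_zero h1 hu (sum_direction_sq p.2.1)
  rw [slope, ← h, Matrix.mulVec_mulVec, Matrix.nonsing_inv_mul _ (isUnit_iff_ne_zero.2 hd),
    Matrix.one_mulVec]

variable (S) in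
lemma isOpen_augDomain : IsOpen {Y : AugState n m | Y.1 ∈ S.U} :=
  S.isOpen_U.preimage continuous_fst

lemma contDiffOn_slope (h0 : S.H0) (h1 : S.H1) :
    ContDiffOn ℝ 2 (fun Y : AugState n m => S.slope Y.1 Y.2.1) {Y | Y.1 ∈ S.U} := by
  have hν : ∀ j, ContDiffOn ℝ 2 (fun Y : AugState n m => direction Y.2.1.2.1 j) {Y | Y.1 ∈ S.U} :=
    fun j => ((contDiff_pi.1 (contDiff_direction (m := m))) j).comp_contDiffOn
      (by fun_prop)
  refine contDiffOn_inv_mulVec (fun a b => ?_) ?_ ?_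
  · simp only [normalB, Matrix.sum_apply, Matrix.smul_apply, smul_eq_mul]
    refine ContDiffOn.sum fun j _ => ContDiffOn.sum fun k _ => ((hν j).mul (hν k)).mul ?_
    exact (h0.2 j k a b).comp contDiff_fst.contDiffOn fun Y hY => hY
  · refine ContDiffOn.sub (ContDiffOn.sub (ContDiffOn.sum fun j _ => (hν j).smul ?_) ?_) ?_
    · exact (h0.1 j).comp contDiff_fst.contDiffOn fun Y hY => hY
    · fun_prop
    · fun_prop
  · exact fun Y hY => det_normalB_ne_zero h1 hY (sum_direction_sq _)

lemma contDiffOn_augField (h0 : S.H0) (h1 : S.H1) :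
    ContDiffOn ℝ 2 S.augField {Y | Y.1 ∈ S.U} := by
  have hν : ∀ j, ContDiffOn ℝ 2 (fun Y : AugState n m => direction Y.2.1.2.1 j) {Y | Y.1 ∈ S.U} :=
    fun j => ((contDiff_pi.1 (contDiff_direction (m := m))) j).comp_contDiffOn
      (by fun_prop)
  refine (contDiffOn_slope h0 h1).prodMk (contDiffOn_const.prodMk
    (contDiff_fst.contDiffOn.prodMk (contDiffOn_pi.2 fun j => ?_)))
  refine ContDiffOn.sub ((h0.1 j).comp contDiff_fst.contDiffOn fun Y hY => hY)
    (ContDiffOn.sum fun k _ => (hν k).smul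
      (contDiffOn_mulVec (fun a b => ?_) (contDiffOn_slope h0 h1)))
  exact (h0.2 j k a b).comp contDiff_fst.contDiffOn fun Y hY => hY

end ViscousSystem

section HasDerivAtProd

variable {E F : Type*} [NormedAddCommGroup E] [NormedSpace ℝ E] [NormedAddCommGroup F]
  [NormedSpace ℝ F] {f : ℝ → E × F} {f' : E × F} {t : ℝ}

lemma HasDerivAt.prod_fst (h : HasDerivAt f f' t) : HasDerivAt (fun x => (f x).1) f'.1 t :=
  (ContinuousLinearMap.fst ℝ E F).hasFDerivAt.comp_hasDerivAt t h

lemma HasDerivAt.prod_snd (h : HasDerivAt f f' t) : HasDerivAt (fun x => (f x).2) f'.2 t :=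
  (ContinuousLinearMap.snd ℝ E F).hasFDerivAt.comp_hasDerivAt t h

end HasDerivAtProd

namespace ViscousSystem

variable {n m : ℕ} (S : ViscousSystem n m)

/-- The coefficient `A^j` of the linearized operator, as a real linear map. -/
noncomputable def realA (ubar : ℝ → Fin n → ℝ) (j : Fin (m + 1)) (x : ℝ) :
    (Fin n → ℝ) →L[ℝ] (Fin n → ℝ) :=
  fderiv ℝ (S.f j) (ubar x) - fderiv ℝ (fun u => (S.B j 0 u).mulVec (deriv ubar x)) (ubar x)

/-- The flux `f^j(ubar) - B^{j1}(ubar) ubar'` of the profile. -/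
noncomputable def profileFlux (ubar : ℝ → Fin n → ℝ) (j : Fin (m + 1)) (x : ℝ) : Fin n → ℝ :=
  S.f j (ubar x) - (S.B j 0 (ubar x)).mulVec (deriv ubar x)

/-- The profile as a solution of the augmented system. -/
noncomputable def augProfile (ubar : ℝ → Fin n → ℝ) (q : Fin n → ℝ) (t : ℝ) : AugState n m :=
  (ubar t, (0, 0, q), ∫ x in (0 : ℝ)..t, ubar x, fun j => ∫ x in (0 : ℝ)..t, S.profileFlux ubar j x)

variable {S} {ubar : ℝ → Fin n → ℝ} {X : ℝ} {q : Fin n → ℝ}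

lemma planarFlux_single (u w : Fin n → ℝ) (j : Fin (m + 1)) :
    S.planarFlux (Pi.single 0 1) u w j = S.f j u - (S.B j 0 u).mulVec w := by
  simp [planarFlux]

lemma normalB_single (u : Fin n → ℝ) : S.normalB (Pi.single 0 1) u = S.B 0 0 u := by
  simp [normalB, Fin.sum_univ_succ]

lemma IsPeriodicProfile.mem_U (h : S.IsPeriodicProfile ubar X q) (x : ℝ) : ubar x ∈ S.U :=
  (h.solves x).1

lemma IsPeriodicProfile.deriv_eq (h : S.IsPeriodicProfile ubar X q) (h1 : S.H1) (x : ℝ) :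
    deriv ubar x = S.slope (ubar x) (0, 0, q) := by
  refine eq_slope_of_mulVec_eq h1 (h.mem_U x) (0, 0, q) ?_
  have := (h.solves x).2.2
  simpa using this

lemma IsPeriodicProfile.hasDerivAt (h : S.IsPeriodicProfile ubar X q) (x : ℝ) :
    HasDerivAt ubar (deriv ubar x) x := (h.solves x).2.1.hasDerivAt

lemma IsPeriodicProfile.continuous (h : S.IsPeriodicProfile ubar X q) : Continuous ubar :=
  continuous_iff_continuousAt.2 fun x => (h.hasDerivAt x).continuousAt

lemma contDiffOn_slope_left (h0 : S.H0) (h1 : S.H1) (p : ℝ × (Fin m → ℝ) × (Fin n → ℝ)) :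
    ContDiffOn ℝ 2 (fun u => S.slope u p) S.U :=
  (contDiffOn_slope h0 h1).comp (t := {Y | Y.1 ∈ S.U})
    (f := fun u : Fin n → ℝ => ((u, p, 0, 0) : AugState n m)) (by fun_prop) fun u hu => hu

lemma IsPeriodicProfile.contDiff_deriv (h : S.IsPeriodicProfile ubar X q) (h0 : S.H0) (h1 : S.H1) :
    ContDiff ℝ 1 ubar ∧ ContDiff ℝ 1 (deriv ubar) := by
  have e : deriv ubar = fun x => S.slope (ubar x) (0, 0, q) := funext (h.deriv_eq h1)
  have hs := (contDiffOn_slope_left h0 h1 (0, 0, q)).of_le (m := 1) (by norm_num)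
  have hd : Differentiable ℝ ubar := fun x => (h.hasDerivAt x).differentiableAt
  have hu : ContDiff ℝ 1 ubar := by
    rw [contDiff_one_iff_deriv]
    refine ⟨hd, ?_⟩
    rw [e]
    exact hs.continuousOn.comp_continuous h.continuous h.mem_U
  refine ⟨hu, ?_⟩
  rw [e, ← contDiffOn_univ]
  exact hs.comp hu.contDiffOn fun x _ => h.mem_U x

lemma IsPeriodicProfile.continuous_profileFlux (h : S.IsPeriodicProfile ubar X q) (h0 : S.H0)
    (h1 : S.H1) (j : Fin (m + 1)) : Continuous (S.profileFlux ubar j) := by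
  refine Continuous.sub ((h0.1 j).continuousOn.comp_continuous h.continuous h.mem_U) ?_
  refine Continuous.matrix_mulVec ?_ (h.contDiff_deriv h0 h1).2.continuous
  exact continuous_matrix fun a b => (h0.2 j 0 a b).continuousOn.comp_continuous h.continuous h.mem_U

lemma IsPeriodicProfile.hasDerivAt_augProfile (h : S.IsPeriodicProfile ubar X q) (h0 : S.H0)
    (h1 : S.H1) (t : ℝ) :
    HasDerivAt (S.augProfile ubar q) (S.augField (S.augProfile ubar q t)) t := by
  have e : S.augField (S.augProfile ubar q t)
      = (deriv ubar t, 0, ubar t, fun j => S.profileFlux ubar j t) := by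
    simp only [augField, augProfile, ← h.deriv_eq h1, direction_zero]
    congr 3
    funext j
    rw [planarFlux_single, profileFlux]
  rw [e]
  refine (h.hasDerivAt t).prodMk ((hasDerivAt_const _ _).prodMk (HasDerivAt.prodMk ?_ ?_))
  · exact intervalIntegral.integral_hasDerivAt_right (h.continuous.intervalIntegrable _ _)
      h.continuous.stronglyMeasurable.stronglyMeasurableAtFilter h.continuous.continuousAt
  · rw [hasDerivAt_pi]
    intro j
    have hc := h.continuous_profileFlux h0 h1 j
    exact intervalIntegral.integral_hasDerivAt_right (hc.intervalIntegrable _ _)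
      hc.stronglyMeasurable.stronglyMeasurableAtFilter hc.continuousAt

lemma hasFDerivAt_B (h0 : S.H0) (j k : Fin (m + 1)) {u : Fin n → ℝ} (hu : u ∈ S.U) (a b : Fin n) :
    HasFDerivAt (fun u => S.B j k u a b) (fderiv ℝ (fun u => S.B j k u a b) u) u :=
  (((h0.2 j k a b).contDiffAt (S.isOpen_U.mem_nhds hu)).differentiableAt
    (by norm_num)).hasFDerivAt

lemma fderiv_mulVec_apply (h0 : S.H0) (j k : Fin (m + 1)) {u : Fin n → ℝ} (hu : u ∈ S.U)
    (c v : Fin n → ℝ) (a : Fin n) :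
    fderiv ℝ (fun u => (S.B j k u).mulVec c) u v a
      = ∑ b, fderiv ℝ (fun u => S.B j k u a b) u v * c b := by
  have h1 : HasFDerivAt (fun u => (S.B j k u).mulVec c)
      (ContinuousLinearMap.pi fun a => ∑ b, c b • fderiv ℝ (fun u => S.B j k u a b) u) u := by
    rw [hasFDerivAt_pi]
    intro a
    simp only [Matrix.mulVec, dotProduct]
    exact HasFDerivAt.fun_sum fun b _ => (hasFDerivAt_B h0 j k hu a b).mul_const (c b)
  rw [h1.fderiv]
  simp [mul_comm]

lemma hasDerivAt_mulVec_comp (h0 : S.H0) (j k : Fin (m + 1)) {u c : ℝ → Fin n → ℝ}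
    {v c' : Fin n → ℝ} {t : ℝ} (hut : u t ∈ S.U) (hu : HasDerivAt u v t) (hc : HasDerivAt c c' t) :
    HasDerivAt (fun x => (S.B j k (u x)).mulVec (c x))
      (fderiv ℝ (fun u => (S.B j k u).mulVec (c t)) (u t) v + (S.B j k (u t)).mulVec c') t := by
  rw [hasDerivAt_pi]
  intro a
  rw [Pi.add_apply, fderiv_mulVec_apply h0 j k hut]
  simp only [Matrix.mulVec, dotProduct, ← Finset.sum_add_distrib]
  refine HasDerivAt.fun_sum fun b _ => ?_
  have h2 : HasDerivAt (fun x => S.B j k (u x) a b) (fderiv ℝ (fun u => S.B j k u a b) (u t) v) t :=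
    (hasFDerivAt_B h0 j k hut a b).comp_hasDerivAt t hu
  exact h2.fun_mul ((hasDerivAt_pi.1 hc) b)

/-- The variational equation of the augmented system along the profile. -/
lemma IsPeriodicProfile.fderiv_augField (h : S.IsPeriodicProfile ubar X q) (h0 : S.H0) (h1 : S.H1)
    (t : ℝ) (Y : AugState n m) :
    (fderiv ℝ S.augField (S.augProfile ubar q t) Y).2.1 = 0 ∧
    (fderiv ℝ S.augField (S.augProfile ubar q t) Y).2.2.1 = Y.1 ∧
    (S.B 0 0 (ubar t)).mulVec (fderiv ℝ S.augField (S.augProfile ubar q t) Y).1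
      = S.realA ubar 0 t Y.1 + ∑ j, Y.2.1.2.1 j • S.profileFlux ubar j.succ t
        - ∑ k, Y.2.1.2.1 k • (S.B 0 k.succ (ubar t)).mulVec (deriv ubar t)
        - Y.2.1.1 • ubar t - Y.2.1.2.2 ∧
    ∀ j, (fderiv ℝ S.augField (S.augProfile ubar q t) Y).2.2.2 j
      = S.realA ubar j t Y.1
        - (S.B j 0 (ubar t)).mulVec (fderiv ℝ S.augField (S.augProfile ubar q t) Y).1
        - ∑ k, Y.2.1.2.1 k • (S.B j k.succ (ubar t)).mulVec (deriv ubar t) := by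
  have hU := h.mem_U t
  set Y₀ := S.augProfile ubar q t with hY₀
  set D := fderiv ℝ S.augField Y₀ Y with hD
  obtain ⟨v, ⟨s, δ, q'⟩, μ, φ⟩ := Y
  have hdiff : HasFDerivAt S.augField (fderiv ℝ S.augField Y₀) Y₀ :=
    (((contDiffOn_augField h0 h1).contDiffAt (S.isOpen_augDomain.mem_nhds hU)).differentiableAt
      (by norm_num)).hasFDerivAt
  have hl : HasDerivAt (fun ε : ℝ => Y₀ + ε • ((v, (s, δ, q'), μ, φ) : AugState n m))
      (v, (s, δ, q'), μ, φ) 0 := by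
    simpa using ((hasDerivAt_id (0 : ℝ)).smul_const
      ((v, (s, δ, q'), μ, φ) : AugState n m)).const_add Y₀
  have hmain : HasDerivAt
      (fun ε : ℝ => S.augField (Y₀ + ε • ((v, (s, δ, q'), μ, φ) : AugState n m))) D 0 := by
    have h3 : HasFDerivAt S.augField (fderiv ℝ S.augField Y₀)
        (Y₀ + (0 : ℝ) • ((v, (s, δ, q'), μ, φ) : AugState n m)) := by simpa using hdiff
    exact h3.comp_hasDerivAt 0 hl
  have hline : ∀ ε : ℝ, S.augField (Y₀ + ε • ((v, (s, δ, q'), μ, φ) : AugState n m))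
      = (S.slope (ubar t + ε • v) (ε * s, ε • δ, q + ε • q'), 0, ubar t + ε • v,
        S.planarFlux (direction (ε • δ)) (ubar t + ε • v)
          (S.slope (ubar t + ε • v) (ε * s, ε • δ, q + ε • q'))) := by
    intro ε
    simp [augField, hY₀, augProfile]
  simp only [hline] at hmain
  set c : ℝ → Fin n → ℝ := fun ε => S.slope (ubar t + ε • v) (ε * s, ε • δ, q + ε • q') with hc
  have hc0 : c 0 = deriv ubar t := by simp [hc, h.deriv_eq h1]
  have hcd : HasDerivAt c D.1 0 := hmain.prod_fst
  have hν := hasDerivAt_direction_line δ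
  have hf : ∀ j, HasDerivAt (fun ε : ℝ => S.f j (ubar t + ε • v)) (fderiv ℝ (S.f j) (ubar t) v) 0 := by
    intro j
    have h2 : HasFDerivAt (S.f j) (fderiv ℝ (S.f j) (ubar t)) (ubar t + (0 : ℝ) • v) := by
      have := ((h0.1 j).contDiffAt (S.isOpen_U.mem_nhds hU)).differentiableAt (by norm_num)
      simpa using this.hasFDerivAt
    have hl' : HasDerivAt (fun ε : ℝ => ubar t + ε • v) v 0 := by
      simpa using ((hasDerivAt_id (0 : ℝ)).smul_const v).const_add (ubar t)
    exact h2.comp_hasDerivAt 0 hl'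
  have hB : ∀ j k, HasDerivAt (fun ε : ℝ => (S.B j k (ubar t + ε • v)).mulVec (c ε))
      (fderiv ℝ (fun u => (S.B j k u).mulVec (deriv ubar t)) (ubar t) v
        + (S.B j k (ubar t)).mulVec D.1) 0 := by
    intro j k
    have hl' : HasDerivAt (fun ε : ℝ => ubar t + ε • v) v 0 := by
      simpa using ((hasDerivAt_id (0 : ℝ)).smul_const v).const_add (ubar t)
    have := hasDerivAt_mulVec_comp h0 j k (by simpa using hU) hl' hcd
    rw [hc0] at this
    simpa using this
  refine ⟨?_, ?_, ?_, ?_⟩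
  · exact (hmain.prod_snd.prod_fst).unique (hasDerivAt_const _ _)
  · refine (hmain.prod_snd.prod_snd.prod_fst).unique ?_
    simpa using ((hasDerivAt_id (0 : ℝ)).smul_const v).const_add (ubar t)
  · have hL : HasDerivAt (fun ε : ℝ => (S.normalB (direction (ε • δ)) (ubar t + ε • v)).mulVec (c ε))
        (∑ j, ∑ k, ((direction ((0 : ℝ) • δ) j * direction ((0 : ℝ) • δ) k) •
            (fderiv ℝ (fun u => (S.B j k u).mulVec (deriv ubar t)) (ubar t) v
              + (S.B j k (ubar t)).mulVec D.1)
          + ((Fin.cons 0 δ : Fin (m + 1) → ℝ) j * direction ((0 : ℝ) • δ) k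
              + direction ((0 : ℝ) • δ) j * (Fin.cons 0 δ : Fin (m + 1) → ℝ) k) •
            (S.B j k (ubar t + (0 : ℝ) • v)).mulVec (c 0))) 0 := by
      simp only [normalB, Matrix.sum_mulVec, Matrix.smul_mulVec]
      exact HasDerivAt.fun_sum fun j _ => HasDerivAt.fun_sum fun k _ =>
        ((hν j).fun_mul (hν k)).fun_smul (hB j k)
    have hR : HasDerivAt (fun ε : ℝ => ∑ j, direction (ε • δ) j • S.f j (ubar t + ε • v)
        - (ε * s) • (ubar t + ε • v) - (q + ε • q'))
        (∑ j, (direction ((0 : ℝ) • δ) j • fderiv ℝ (S.f j) (ubar t) v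
          + (Fin.cons 0 δ : Fin (m + 1) → ℝ) j • S.f j (ubar t + (0 : ℝ) • v))
          - s • ubar t - q') 0 := by
      refine HasDerivAt.fun_sub (HasDerivAt.fun_sub (HasDerivAt.fun_sum fun j _ =>
        (hν j).fun_smul (hf j)) ?_) ?_
      · have h5 : HasDerivAt (fun ε : ℝ => ε * s) s 0 := by
          simpa using (hasDerivAt_id (0 : ℝ)).mul_const s
        have h6 : HasDerivAt (fun ε : ℝ => ubar t + ε • v) v 0 := by
          simpa using ((hasDerivAt_id (0 : ℝ)).smul_const v).const_add (ubar t)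
        simpa using h5.fun_smul h6
      · simpa using ((hasDerivAt_id (0 : ℝ)).smul_const q').const_add q
    have hev : (fun ε : ℝ => (S.normalB (direction (ε • δ)) (ubar t + ε • v)).mulVec (c ε))
        =ᶠ[𝓝 0] fun ε : ℝ => ∑ j, direction (ε • δ) j • S.f j (ubar t + ε • v)
        - (ε * s) • (ubar t + ε • v) - (q + ε • q') := by
      have hcont : Continuous fun ε : ℝ => ubar t + ε • v := by fun_prop
      have : ∀ᶠ ε : ℝ in 𝓝 0, ubar t + ε • v ∈ S.U :=
        hcont.continuousAt.eventually (by simpa using S.isOpen_U.mem_nhds hU)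
      filter_upwards [this] with ε hε
      exact normalB_mulVec_slope h1 hε (ε * s, ε • δ, q + ε • q')
    have hEq := hL.unique (hR.congr_of_eventuallyEq hev)
    simp only [hc0] at hEq
    simp only [zero_smul, add_zero, direction_zero, Fin.sum_univ_succ, Pi.single_eq_same,
      Fin.cons_zero, Fin.cons_succ, mul_one, one_smul, zero_mul, ne_eq,
      Fin.succ_ne_zero, not_false_eq_true, Pi.single_eq_of_ne, mul_zero, zero_add,
      Finset.sum_const_zero, one_mul, Finset.sum_add_distrib] at hEq
    simp only [realA, profileFlux, sub_apply, smul_sub, Finset.sum_sub_distrib]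
    linear_combination (exp := 1) hEq
  · intro j
    refine (hasDerivAt_pi.1 hmain.prod_snd.prod_snd.prod_snd j).unique ?_
    have h5 : HasDerivAt (fun ε : ℝ => S.f j (ubar t + ε • v) -
        ∑ k, direction (ε • δ) k • (S.B j k (ubar t + ε • v)).mulVec (c ε))
        (fderiv ℝ (S.f j) (ubar t) v - ∑ k, (direction ((0 : ℝ) • δ) k •
            (fderiv ℝ (fun u => (S.B j k u).mulVec (deriv ubar t)) (ubar t) v
              + (S.B j k (ubar t)).mulVec D.1)
          + (Fin.cons 0 δ : Fin (m + 1) → ℝ) k •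
            (S.B j k (ubar t + (0 : ℝ) • v)).mulVec (c 0))) 0 :=
      (hf j).fun_sub (HasDerivAt.fun_sum fun k _ => (hν k).fun_smul (hB j k))
    simp only [hc0] at h5
    refine h5.congr_deriv ?_
    simp only [zero_smul, add_zero, direction_zero, Fin.sum_univ_succ, Pi.single_eq_same,
      Fin.cons_zero, Fin.cons_succ, one_smul, ne_eq,
      Fin.succ_ne_zero, not_false_eq_true, Pi.single_eq_of_ne, zero_add,
      Finset.sum_add_distrib, Finset.sum_const_zero]
    simp only [realA, sub_apply]
    abel

end ViscousSystem

namespace ViscousSystem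

variable {n m : ℕ} {S : ViscousSystem n m} {ubar : ℝ → Fin n → ℝ} {X : ℝ} {q : Fin n → ℝ}

lemma solvesProfileAt_iff (h1 : S.H1) (p : ℝ × (Fin m → ℝ) × (Fin n → ℝ)) (φ : ℝ → Fin n → ℝ)
    (t : ℝ) : S.SolvesProfileAt p.1 (direction p.2.1) p.2.2 φ t ↔
      φ t ∈ S.U ∧ HasDerivAt φ (S.slope (φ t) p) t := by
  constructor
  · rintro ⟨hU, hd, he⟩
    refine ⟨hU, ?_⟩
    rw [← eq_slope_of_mulVec_eq h1 hU p he]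
    exact hd.hasDerivAt
  · rintro ⟨hU, hd⟩
    refine ⟨hU, hd.differentiableAt, ?_⟩
    rw [hd.deriv]
    exact normalB_mulVec_slope h1 hU p

lemma wave_eq (h0 : S.H0) (h1 : S.H1) {p : WaveParam n m} {φ : ℝ → Fin n → ℝ} {T : ℝ} (hT : 0 < T)
    (hφ0 : φ 0 = p.2.1)
    (hφ : ∀ t ∈ Ioo (-T) T, φ t ∈ S.U ∧ HasDerivAt φ (S.slope (φ t) p.2.2) t) {y : ℝ}
    (hy : y ∈ Ioo (-T) T) : S.wave p y = φ y := by
  have hex : ∃ φ, S.IsProfileUpTo y p.2.1 p.2.2.1 (direction p.2.2.2.1) p.2.2.2.2 φ :=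
    ⟨φ, hφ0, -T, T, ⟨by linarith, hT⟩, hy, fun t ht => (solvesProfileAt_iff h1 p.2.2 φ t).2 (hφ t ht)⟩
  rw [wave, flow, dif_pos hex]
  obtain ⟨hψ0, α, β, h0αβ, hyαβ, hψ⟩ := Classical.choose_spec hex
  set ψ := Classical.choose hex
  have hmem : ∀ {t}, t ∈ Ioo (max α (-T)) (min β T) ↔ t ∈ Ioo α β ∧ t ∈ Ioo (-T) T := by
    intro t
    simp only [mem_Ioo, max_lt_iff, lt_min_iff]; tauto
  refine solution_unique_of_contDiffOn S.isOpen_U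
    ((contDiffOn_slope_left h0 h1 p.2.2).of_le (m := 1) (by norm_num))
    (α := max α (-T)) (β := min β T) (t₀ := 0)
    (fun t ht => (solvesProfileAt_iff h1 p.2.2 ψ t).1 (hψ t (hmem.1 ht).1))
    (fun t ht => hφ t (hmem.1 ht).2) (hmem.2 ⟨h0αβ, by linarith, hT⟩) (hψ0.trans hφ0.symm)
    (hmem.2 ⟨hyαβ, hy⟩)

/-- The initial value in the augmented system of the wave with given parameters. -/
noncomputable def augInit : WaveParam n m →L[ℝ] AugState n m :=
  LinearMap.toContinuousLinearMap
    { toFun := fun p => (p.2.1, p.2.2, 0, 0)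
      map_add' := fun p p' => by ext <;> simp
      map_smul' := fun c p => by ext <;> simp }

lemma augInit_apply (p : WaveParam n m) : augInit p = (p.2.1, p.2.2, 0, 0) := rfl

lemma mean_formulas (h0 : S.H0) (h1 : S.H1) {p : WaveParam n m} {Y : ℝ → AugState n m}
    {T : ℝ} (hT : 0 < T) (hp : p.1 ∈ Ioo 0 T) (hY0 : Y 0 = augInit p)
    (hY : ∀ t ∈ Icc (-T) T, Y t ∈ {Y : AugState n m | Y.1 ∈ S.U} ∧
        HasDerivWithinAt Y (S.augField (Y t)) (Icc (-T) T) t) :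
    S.shoot p = (Y p.1).1 - p.2.1 ∧ S.meanM p = p.1⁻¹ • (Y p.1).2.2.1 ∧
      ∀ j, S.meanF j p = p.1⁻¹ • (Y p.1).2.2.2 j := by
  have hconst : ∀ t ∈ Icc (-T) T, (Y t).2.1 = p.2.2 := by
    intro t ht
    have hd : ∀ t ∈ Icc (-T) T, HasDerivWithinAt (fun t => (Y t).2.1 - p.2.2) 0 (Icc (-T) T) t := by
      intro t ht
      have h3 : HasDerivWithinAt (fun t => (Y t).2.1) (S.augField (Y t)).2.1 (Icc (-T) T) t :=
        ((ContinuousLinearMap.fst ℝ _ _).comp (ContinuousLinearMap.snd ℝ (Fin n → ℝ) ((ℝ × (Fin m → ℝ) × (Fin n → ℝ)) × (Fin n → ℝ) × (Fin (m + 1) → Fin n → ℝ)))).hasFDerivAt.comp_hasDerivWithinAt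
          t (hY t ht).2
      exact h3.sub_const _
    have := norm_le_of_norm_deriv_le (δ := 0) (K := 0) (ε := 0) le_rfl le_rfl hd
      (by simp [hY0, augInit_apply]) (by simp) ht
    simpa [sub_eq_zero] using this
  have hda : ∀ t ∈ Ioo (-T) T, HasDerivAt Y (S.augField (Y t)) t := fun t ht =>
    (hY t ⟨ht.1.le, ht.2.le⟩).2.hasDerivAt (Icc_mem_nhds ht.1 ht.2)
  have hφ : ∀ t ∈ Ioo (-T) T, (Y t).1 ∈ S.U ∧
      HasDerivAt (fun t => (Y t).1) (S.slope (Y t).1 p.2.2) t := by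
    intro t ht
    refine ⟨(hY t ⟨ht.1.le, ht.2.le⟩).1, ?_⟩
    have := (hda t ht).prod_fst
    rwa [augField, hconst t ⟨ht.1.le, ht.2.le⟩] at this
  have hw : ∀ t ∈ Ioo (-T) T, S.wave p t = (Y t).1 := fun t ht =>
    wave_eq h0 h1 hT (by simp [hY0, augInit_apply]) hφ ht
  have hwd : ∀ t ∈ Ioo (-T) T, deriv (S.wave p) t = S.slope (Y t).1 p.2.2 := by
    intro t ht
    have hev : S.wave p =ᶠ[𝓝 t] fun t => (Y t).1 := by
      filter_upwards [Ioo_mem_nhds ht.1 ht.2] with x hx using hw x hx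
    rw [hev.deriv_eq, (hφ t ht).2.deriv]
  have hsub : uIcc 0 p.1 ⊆ Ioo (-T) T := by
    rw [uIcc_of_le hp.1.le]
    exact fun t ht => ⟨by linarith [ht.1], by linarith [ht.2, hp.2]⟩
  have hYc : ContinuousOn Y (uIcc 0 p.1) := fun t ht =>
    (hda t (hsub ht)).continuousAt.continuousWithinAt
  have hYm : MapsTo Y (uIcc 0 p.1) {Y | Y.1 ∈ S.U} := fun t ht => (hφ t (hsub ht)).1
  have hFc : ContinuousOn (fun t => S.augField (Y t)) (uIcc 0 p.1) :=
    (contDiffOn_augField h0 h1).continuousOn.comp hYc hYm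
  refine ⟨?_, ?_, fun j => ?_⟩
  · rw [shoot, hw p.1 (hsub right_mem_uIcc)]
  · rw [meanM]
    congr 1
    rw [intervalIntegral.integral_congr (g := fun t => (S.augField (Y t)).2.2.1)
        fun t ht => hw t (hsub ht),
      intervalIntegral.integral_eq_sub_of_hasDerivAt (f := fun t => (Y t).2.2.1)
        (fun t ht => (hda t (hsub ht)).prod_snd.prod_snd.prod_fst)
        (ContinuousOn.intervalIntegrable hFc.snd.snd.fst)]
    simp [hY0, augInit_apply]
  · rw [meanF]
    congr 1
    rw [intervalIntegral.integral_congr (g := fun t => (S.augField (Y t)).2.2.2 j) fun t ht => by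
        simp only [augField, planarFlux, hw t (hsub ht), hwd t (hsub ht),
          hconst t (Ioo_subset_Icc_self (hsub ht))],
      intervalIntegral.integral_eq_sub_of_hasDerivAt (f := fun t => (Y t).2.2.2 j)
        (fun t ht => (hasDerivAt_pi.1 (hda t (hsub ht)).prod_snd.prod_snd.prod_snd) j)
        (ContinuousOn.intervalIntegrable (continuousOn_pi.1 hFc.snd.snd.snd j))]
    simp [hY0, augInit_apply]

lemma fderiv_apply_of_line {E F : Type*} [NormedAddCommGroup E] [NormedSpace ℝ E]
    [NormedAddCommGroup F] [NormedSpace ℝ F] {f : E → F} {x h : E} {f' : F}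
    (hf : DifferentiableAt ℝ f x) (hl : HasDerivAt (fun ε : ℝ => f (x + ε • h)) f' 0) :
    fderiv ℝ f x h = f' := by
  have h3 : HasFDerivAt f (fderiv ℝ f x) (x + (0 : ℝ) • h) := by simpa using hf.hasFDerivAt
  have hl' : HasDerivAt (fun ε : ℝ => x + ε • h) h 0 := by
    simpa using ((hasDerivAt_id (0 : ℝ)).smul_const h).const_add x
  exact (h3.comp_hasDerivAt 0 hl').unique hl

/-- Derivatives at the profile of the shooting map and of the averaged quantities, in terms of the
variation `v` of the wave, its integral `μ`, and the integrals `φ j` of the variations of the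
fluxes. -/
theorem IsPeriodicProfile.exists_variation (hu : S.IsPeriodicProfile ubar X q) (h0 : S.H0)
    (h1 : S.H1) (h : WaveParam n m) :
    ∃ (v v' μ : ℝ → Fin n → ℝ) (φ : Fin (m + 1) → ℝ → Fin n → ℝ),
      v 0 = h.2.1 ∧ μ 0 = 0 ∧ (∀ j, φ j 0 = 0) ∧ (∀ t, HasDerivAt v (v' t) t) ∧
      (∀ t, HasDerivAt μ (v t) t) ∧
      (∀ j t, HasDerivAt (φ j) (S.realA ubar j t (v t) - (S.B j 0 (ubar t)).mulVec (v' t)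
        - ∑ k, h.2.2.2.1 k • (S.B j k.succ (ubar t)).mulVec (deriv ubar t)) t) ∧
      (∀ t, (S.B 0 0 (ubar t)).mulVec (v' t)
        = S.realA ubar 0 t (v t) + ∑ j, h.2.2.2.1 j • S.profileFlux ubar j.succ t
          - ∑ k, h.2.2.2.1 k • (S.B 0 k.succ (ubar t)).mulVec (deriv ubar t)
          - h.2.2.1 • ubar t - h.2.2.2.2) ∧
      fderiv ℝ S.shoot (baseParam m ubar X q) h = h.1 • deriv ubar X + v X - h.2.1 ∧
      fderiv ℝ S.density (baseParam m ubar X q) h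
        = (X⁻¹ • (h.1 • ubar X + μ X) - (h.1 / X ^ 2) • ∫ x in (0 : ℝ)..X, ubar x,
          X⁻¹ • (Fin.cons 0 h.2.2.2.1 : Fin (m + 1) → ℝ)
            - (h.1 / X ^ 2) • (Pi.single 0 1 : Fin (m + 1) → ℝ)) ∧
      ∀ j, fderiv ℝ (S.flux j) (baseParam m ubar X q) h
        = (X⁻¹ • (h.1 • S.profileFlux ubar j X + φ j X)
            - (h.1 / X ^ 2) • ∫ x in (0 : ℝ)..X, S.profileFlux ubar j x,
          (h.2.2.1 * X⁻¹) • (Pi.single j 1 : Fin (m + 1) → ℝ)) := by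
  have hX := hu.period_pos
  set γ := S.augProfile ubar q with hγ
  have hγd : ∀ t, HasDerivAt γ (S.augField (γ t)) t := hu.hasDerivAt_augProfile h0 h1
  have hγO : ∀ t, γ t ∈ {Y : AugState n m | Y.1 ∈ S.U} := fun t => hu.mem_U t
  have hgc := (contDiffOn_augField h0 h1).of_le (m := 1) (by norm_num)
  have hγc : Continuous γ := continuous_iff_continuousAt.2 fun t => (hγd t).continuousAt
  have hDc : Continuous fun t => fderiv ℝ S.augField (γ t) :=
    (hgc.continuousOn_fderiv_of_isOpen S.isOpen_augDomain le_rfl).comp_continuous hγc hγO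
  set T := X + 1 with hT
  have hT0 : 0 < T := by positivity
  obtain ⟨Ψ, hΨ, hΨ'⟩ := exists_solutions_near S.isOpen_augDomain hgc hγO hγd hT0.le
  set b := baseParam m ubar X q with hb
  have hb0 : augInit b = γ 0 := by
    simp only [augInit_apply, hb, baseParam, hγ, augProfile, intervalIntegral.integral_same]; rfl
  have hΨd := hasFDerivAt_of_uniform_expansion hDc (X := X) (T := T)
    ⟨by linarith, by linarith⟩ (hγd X) hΨ'
  set K : WaveParam n m → AugState n m := fun p => Ψ (augInit p) p.1 with hK
  obtain ⟨L, hKd, hL⟩ : ∃ L : WaveParam n m →L[ℝ] AugState n m, HasFDerivAt K L b ∧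
      L h = h.1 • S.augField (γ X)
        + linearFlow (fun t => fderiv ℝ S.augField (γ t)) (augInit h) X := by
    have h2 : HasFDerivAt (fun p : WaveParam n m => (p.1, augInit p))
        ((ContinuousLinearMap.fst ℝ _ _).prod augInit) b :=
      ((ContinuousLinearMap.fst ℝ _ _).prod augInit).hasFDerivAt
    have h3 := hΨd
    rw [← hb0] at h3
    exact ⟨_, HasFDerivAt.comp (g := fun p : ℝ × AugState n m => Ψ p.2 p.1) b h3 h2, by simp⟩
  set V := linearFlow (fun t => fderiv ℝ S.augField (γ t)) (augInit h) with hV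
  have hVd := hasDerivAt_linearFlow hDc (augInit h)
  rw [← hV] at hVd
  have hV0 : V 0 = augInit h := linearFlow_zero hDc _
  have hVc : ∀ t, (V t).2.1 = h.2.2 := by
    intro t
    have hz : ∀ t, HasDerivAt (fun t => (V t).2.1) 0 t := by
      intro t
      have := (hVd t).prod_snd.prod_fst
      rwa [(hu.fderiv_augField h0 h1 t (V t)).1] at this
    have := is_const_of_deriv_eq_zero (fun t => (hz t).differentiableAt) (fun t => (hz t).deriv) t 0
    simpa [hV0, augInit_apply] using this
  have hγX : S.augField (γ X) = (deriv ubar X, 0, ubar X, fun j => S.profileFlux ubar j X) := by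
    simp only [hγ, augField, augProfile, ← hu.deriv_eq h1, direction_zero]
    congr 3
    funext j
    rw [planarFlux_single, profileFlux]
  have hKl : HasDerivAt (fun ε : ℝ => K (b + ε • h)) (h.1 • S.augField (γ X) + V X) 0 := by
    have h3 : HasFDerivAt K L (b + (0 : ℝ) • h) := by simpa using hKd
    have hl' : HasDerivAt (fun ε : ℝ => b + ε • h) h 0 := by
      simpa using ((hasDerivAt_id (0 : ℝ)).smul_const h).const_add b
    have := h3.comp_hasDerivAt 0 hl'
    rwa [hL] at this
  rw [hγX] at hKl
  have hKb : K b = γ X := by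
    have h2 := hΨ'  1 one_pos
    have h3 := h2.self_of_nhds X ⟨by linarith, by linarith⟩
    rw [sub_self, norm_zero, mul_zero, norm_le_zero_iff, ← linearFlowCLM_apply hDc, map_zero,
      sub_zero, sub_eq_zero] at h3
    rw [hK]
    simp only [hb0]
    exact h3
  have hev : ∀ᶠ p in 𝓝 b, S.shoot p = (K p).1 - p.2.1 ∧ S.meanM p = p.1⁻¹ • (K p).2.2.1 ∧
      ∀ j, S.meanF j p = p.1⁻¹ • (K p).2.2.2 j := by
    have e1 : ∀ᶠ p : WaveParam n m in 𝓝 b, p.1 ∈ Ioo 0 T :=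
      continuous_fst.continuousAt.eventually (Ioo_mem_nhds hX (show b.1 < T by
        change X < T; linarith))
    have e2 := (show Tendsto (augInit : WaveParam n m → _) (𝓝 b) (𝓝 (γ 0)) by
      rw [← hb0]; exact augInit.continuous.tendsto b).eventually hΨ
    filter_upwards [e1, e2] with p hp1 hp2
    exact mean_formulas h0 h1 hT0 hp1 hp2.1 hp2.2
  have hline : Tendsto (fun ε : ℝ => b + ε • h) (𝓝 0) (𝓝 b) := by
    have : Continuous fun ε : ℝ => b + ε • h := by fun_prop
    simpa using this.tendsto 0
  have hevl := hline.eventually hev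
  have hb1 : b.1 = X := rfl
  have hb2 : b.2.2.1 = 0 := rfl
  have hb3 : b.2.2.2.1 = 0 := rfl
  have hKM : (K b).2.2.1 = ∫ x in (0 : ℝ)..X, ubar x := by rw [hKb]; rfl
  have hKF : ∀ j, (K b).2.2.2 j = ∫ x in (0 : ℝ)..X, S.profileFlux ubar j x := by
    intro j; rw [hKb]; rfl
  have hinv : HasDerivAt (fun ε : ℝ => (b + ε • h).1⁻¹) (-(h.1 / X ^ 2)) 0 := by
    have : HasDerivAt (fun ε : ℝ => X + ε * h.1) h.1 0 := by
      simpa using ((hasDerivAt_id (0 : ℝ)).mul_const h.1).const_add X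
    have h4 := this.fun_inv (by simpa using hX.ne')
    simpa [hb1, neg_div] using h4
  have hinvd : DifferentiableAt ℝ (fun p : WaveParam n m => p.1⁻¹) b :=
    differentiableAt_fst.inv (by rw [hb1]; exact hX.ne')
  have hKdiff : DifferentiableAt ℝ K b := hKd.differentiableAt
  have hdird : DifferentiableAt ℝ (fun p : WaveParam n m => direction p.2.2.2.1) b :=
    (contDiff_direction (k := 1)).differentiable one_ne_zero |>.differentiableAt.comp b
      (by fun_prop)
  have hdir : HasDerivAt (fun ε : ℝ => direction (b + ε • h).2.2.2.1) (Fin.cons 0 h.2.2.2.1) 0 := by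
    rw [hasDerivAt_pi]
    intro k
    have := hasDerivAt_direction_line h.2.2.2.1 k
    simpa [hb, baseParam] using this
  refine ⟨fun t => (V t).1, fun t => (fderiv ℝ S.augField (γ t) (V t)).1, fun t => (V t).2.2.1,
    fun j t => (V t).2.2.2 j, by simp [hV0, augInit_apply], by simp [hV0, augInit_apply],
    fun j => by simp [hV0, augInit_apply], fun t => (hVd t).prod_fst, fun t => ?_, fun j t => ?_,
    fun t => ?_, ?_, ?_, fun j => ?_⟩
  · have := (hVd t).prod_snd.prod_snd.prod_fst
    rwa [(hu.fderiv_augField h0 h1 t (V t)).2.1] at this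
  · have := hasDerivAt_pi.1 (hVd t).prod_snd.prod_snd.prod_snd j
    rwa [(hu.fderiv_augField h0 h1 t (V t)).2.2.2 j, hVc] at this
  · have := (hu.fderiv_augField h0 h1 t (V t)).2.2.1
    rwa [hVc] at this
  · refine fderiv_apply_of_line ?_ ?_
    · have : S.shoot =ᶠ[𝓝 b] fun p => (K p).1 - p.2.1 := hev.mono fun p hp => hp.1
      rw [this.differentiableAt_iff]
      fun_prop
    · have : (fun ε : ℝ => S.shoot (b + ε • h)) =ᶠ[𝓝 0]
          fun ε => (K (b + ε • h)).1 - (b + ε • h).2.1 := hevl.mono fun ε hε => hε.1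
      refine HasDerivAt.congr_of_eventuallyEq ?_ this
      have h4 : HasDerivAt (fun ε : ℝ => (b + ε • h).2.1) h.2.1 0 := by
        simpa using ((hasDerivAt_id (0 : ℝ)).smul_const h.2.1).const_add b.2.1
      exact hKl.prod_fst.fun_sub h4
  · refine fderiv_apply_of_line ?_ ?_
    · have : S.density =ᶠ[𝓝 b]
          fun p => (p.1⁻¹ • (K p).2.2.1, p.1⁻¹ • direction p.2.2.2.1) :=
        hev.mono fun p hp => by rw [density, hp.2.1]
      rw [this.differentiableAt_iff]
      exact (hinvd.smul (by fun_prop)).prodMk (hinvd.smul hdird)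
    · have : (fun ε : ℝ => S.density (b + ε • h)) =ᶠ[𝓝 0]
          fun ε => ((b + ε • h).1⁻¹ • (K (b + ε • h)).2.2.1,
            (b + ε • h).1⁻¹ • direction (b + ε • h).2.2.2.1) :=
        hevl.mono fun ε hε => by simp only [density, hε.2.1]
      refine HasDerivAt.congr_of_eventuallyEq ?_ this
      refine ((hinv.fun_smul hKl.prod_snd.prod_snd.prod_fst).prodMk
        (hinv.fun_smul hdir)).congr_deriv ?_
      simp [hKM, hb1, hb3, sub_eq_add_neg]
  · refine fderiv_apply_of_line ?_ ?_
    · have : S.flux j =ᶠ[𝓝 b]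
          fun p => (p.1⁻¹ • (K p).2.2.2 j, (p.2.2.1 * p.1⁻¹) • (Pi.single j 1 : Fin (m + 1) → ℝ)) :=
        hev.mono fun p hp => by rw [flux, hp.2.2 j]
      rw [this.differentiableAt_iff]
      have h5 : DifferentiableAt ℝ (fun p => (K p).2.2.2 j) b :=
        differentiableAt_pi.1 (by fun_prop : DifferentiableAt ℝ (fun p => (K p).2.2.2) b) j
      exact (hinvd.smul h5).prodMk
        ((DifferentiableAt.mul (by fun_prop) hinvd).smul_const _)
    · have : (fun ε : ℝ => S.flux j (b + ε • h)) =ᶠ[𝓝 0]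
          fun ε => ((b + ε • h).1⁻¹ • (K (b + ε • h)).2.2.2 j,
            ((b + ε • h).2.2.1 * (b + ε • h).1⁻¹) • (Pi.single j 1 : Fin (m + 1) → ℝ)) :=
        hevl.mono fun ε hε => by simp only [flux, hε.2.2 j]
      refine HasDerivAt.congr_of_eventuallyEq ?_ this
      have h4 : HasDerivAt (fun ε : ℝ => (b + ε • h).2.2.1) h.2.2.1 0 := by
        simpa using ((hasDerivAt_id (0 : ℝ)).mul_const h.2.2.1).const_add b.2.2.1
      refine ((hinv.fun_smul (hasDerivAt_pi.1 hKl.prod_snd.prod_snd.prod_snd j)).prodMk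
        ((h4.fun_mul hinv).smul_const _)).congr_deriv ?_
      simp [hKF, hb1, hb2, sub_eq_add_neg]

end ViscousSystem

section BlockDet

variable {𝕜 V W : Type*} [Field 𝕜] [AddCommGroup V] [Module 𝕜 V] [AddCommGroup W] [Module 𝕜 W]
  [FiniteDimensional 𝕜 V] [FiniteDimensional 𝕜 W]

/-- The determinant of the block triangular map `(a, y) ↦ (A a, C a + D y)`. -/
lemma LinearMap.det_lower_triangular (A : V →ₗ[𝕜] V) (C : V →ₗ[𝕜] W) (D : W →ₗ[𝕜] W) :
    LinearMap.det ((A ∘ₗ LinearMap.fst 𝕜 V W).prod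
      (C ∘ₗ LinearMap.fst 𝕜 V W + D ∘ₗ LinearMap.snd 𝕜 V W)) = LinearMap.det A * LinearMap.det D := by
  classical
  let b := Module.finBasis 𝕜 V
  let c := Module.finBasis 𝕜 W
  rw [← LinearMap.det_toMatrix (b.prod c), ← LinearMap.det_toMatrix b, ← LinearMap.det_toMatrix c]
  have : LinearMap.toMatrix (b.prod c) (b.prod c) ((A ∘ₗ LinearMap.fst 𝕜 V W).prod
      (C ∘ₗ LinearMap.fst 𝕜 V W + D ∘ₗ LinearMap.snd 𝕜 V W))
      = Matrix.fromBlocks (LinearMap.toMatrix b b A) 0 (LinearMap.toMatrix b c C)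
        (LinearMap.toMatrix c c D) := by
    ext i j
    rcases i with i | i <;> rcases j with j | j <;>
      simp [LinearMap.toMatrix_apply]
  rw [this, Matrix.det_fromBlocks_zero₁₂]

/-- The determinant of the block triangular map `(a, y) ↦ (A a + C y, D y)`. -/
lemma LinearMap.det_upper_triangular (A : V →ₗ[𝕜] V) (C : W →ₗ[𝕜] V) (D : W →ₗ[𝕜] W) :
    LinearMap.det ((A ∘ₗ LinearMap.fst 𝕜 V W + C ∘ₗ LinearMap.snd 𝕜 V W).prod
      (D ∘ₗ LinearMap.snd 𝕜 V W)) = LinearMap.det A * LinearMap.det D := by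
  classical
  let b := Module.finBasis 𝕜 V
  let c := Module.finBasis 𝕜 W
  rw [← LinearMap.det_toMatrix (b.prod c), ← LinearMap.det_toMatrix b, ← LinearMap.det_toMatrix c]
  have : LinearMap.toMatrix (b.prod c) (b.prod c)
      ((A ∘ₗ LinearMap.fst 𝕜 V W + C ∘ₗ LinearMap.snd 𝕜 V W).prod (D ∘ₗ LinearMap.snd 𝕜 V W))
      = Matrix.fromBlocks (LinearMap.toMatrix b b A) (LinearMap.toMatrix c b C) 0
        (LinearMap.toMatrix c c D) := by
    ext i j
    rcases i with i | i <;> rcases j with j | j <;>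
      simp [LinearMap.toMatrix_apply]
  rw [this, Matrix.det_fromBlocks_zero₂₁]

end BlockDet

/-- The coefficients of the first-order form of the eigenvalue equation
`(B w')' - (A₁ w)' + i ρ Q w' + i ρ (P w)' - i ρ A₂ w - ρ² R w - λ w = 0`, together with the
profile `u`, its derivative `p` and the transverse flux `F` of the profile. -/
structure WavePencil (n : ℕ) where
  (B A₁ P Q R A₂ : ℝ → Matrix (Fin n) (Fin n) ℂ)
  (u p F : ℝ → Fin n → ℂ)

/-- The states `(c, v, y, z)` of the first-order system. -/
abbrev PencilState (n : ℕ) : Type := ℂ × (Fin n → ℂ) × (Fin n → ℂ) × (Fin n → ℂ)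

namespace WavePencil

variable {n : ℕ} (C : WavePencil n) (ρ : ℝ) (σ : ℂ)

/-- The coefficient of `c` in the equation for `v`. -/
noncomputable def forcing (x : ℝ) : Fin n → ℂ :=
  (C.F x - C.F 0) - σ • (C.u x - C.u 0) - (C.P x).mulVec (C.p x)

/-- The right-hand side of the equation for `v`. -/
noncomputable def slopeV (x : ℝ) (Y : PencilState n) : Fin n → ℂ :=
  (C.B x)⁻¹.mulVec ((C.A₁ x).mulVec Y.2.1 + Y.2.2.2 + (Complex.I * ρ) • Y.2.2.1
    - (Complex.I * ρ) • (C.P x).mulVec Y.2.1 + Y.1 • C.forcing σ x)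

/-- The right-hand side of the equation for `y`. -/
noncomputable def slopeY (x : ℝ) (Y : PencilState n) : Fin n → ℂ :=
  (C.A₂ x).mulVec Y.2.1 - σ • Y.2.1 - (C.Q x).mulVec (C.slopeV ρ σ x Y)
    - Y.1 • (C.R x).mulVec (C.p x) - (Complex.I * ρ) • (C.R x).mulVec Y.2.1

/-- The linear vector field of the first-order system, over `ℂ`. -/
noncomputable def fieldₗ (x : ℝ) : PencilState n →ₗ[ℂ] PencilState n where
  toFun Y := (0, C.slopeV ρ σ x Y, C.slopeY ρ σ x Y, 0)
  map_add' Y Y' := by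
    have h : C.slopeV ρ σ x (Y + Y') = C.slopeV ρ σ x Y + C.slopeV ρ σ x Y' := by
      simp only [slopeV, ← Matrix.mulVec_add]
      congr 1
      simp only [Prod.fst_add, Prod.snd_add, Matrix.mulVec_add]
      module
    simp only [slopeY, h, Prod.fst_add, Prod.snd_add, Matrix.mulVec_add, Prod.mk_add_mk, add_zero]
    congr 3
    module
  map_smul' c Y := by
    have h : C.slopeV ρ σ x (c • Y) = c • C.slopeV ρ σ x Y := by
      simp only [slopeV, ← Matrix.mulVec_smul]
      congr 1
      simp only [Prod.smul_fst, Prod.smul_snd, Matrix.mulVec_smul]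
      module
    simp only [slopeY, h, Prod.smul_fst, Prod.smul_snd, Matrix.mulVec_smul, RingHom.id_apply,
      Prod.smul_mk, smul_zero]
    congr 3
    module

/-- The linear vector field of the first-order system. -/
noncomputable def field (x : ℝ) : PencilState n →L[ℝ] PencilState n :=
  LinearMap.toContinuousLinearMap ((C.fieldₗ ρ σ x).restrictScalars ℝ)

lemma field_apply (x : ℝ) (Y : PencilState n) :
    C.field ρ σ x Y = (0, C.slopeV ρ σ x Y, C.slopeY ρ σ x Y, 0) := rfl

/-- A family of coefficients depends continuously on a parameter (and on `x`). -/
structure ContinuousFamily {T : Type*} [TopologicalSpace T] (C : T → WavePencil n) : Prop where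
  B : Continuous fun t : T × ℝ => (C t.1).B t.2
  A₁ : Continuous fun t : T × ℝ => (C t.1).A₁ t.2
  P : Continuous fun t : T × ℝ => (C t.1).P t.2
  Q : Continuous fun t : T × ℝ => (C t.1).Q t.2
  R : Continuous fun t : T × ℝ => (C t.1).R t.2
  A₂ : Continuous fun t : T × ℝ => (C t.1).A₂ t.2
  u : Continuous fun t : T × ℝ => (C t.1).u t.2
  p : Continuous fun t : T × ℝ => (C t.1).p t.2
  F : Continuous fun t : T × ℝ => (C t.1).F t.2
  det_ne_zero : ∀ t x, ((C t).B x).det ≠ 0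

lemma ContinuousFamily.comp {T T' : Type*} [TopologicalSpace T] [TopologicalSpace T']
    {C : T → WavePencil n} (h : ContinuousFamily C) {g : T' → T} (hg : Continuous g) :
    ContinuousFamily fun t => C (g t) := by
  have hc : Continuous fun t : T' × ℝ => (g t.1, t.2) := by fun_prop
  exact ⟨h.B.comp hc, h.A₁.comp hc, h.P.comp hc, h.Q.comp hc, h.R.comp hc, h.A₂.comp hc,
    h.u.comp hc, h.p.comp hc, h.F.comp hc, fun t x => h.det_ne_zero _ _⟩

lemma ContinuousFamily.continuous_field {T : Type*} [TopologicalSpace T] {C : T → WavePencil n}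
    (h : ContinuousFamily C) {ρ : T → ℝ} {σ : T → ℂ} (hρ : Continuous ρ) (hσ : Continuous σ) :
    Continuous (Function.uncurry fun t => (C t).field (ρ t) (σ t)) := by
  have hs : Continuous fun t : T × ℝ => (t.1, (0 : ℝ)) := by fun_prop
  have hI : Continuous fun t : T × ℝ => ((C t.1).B t.2)⁻¹ := by
    simp only [Matrix.inv_def, Ring.inverse_eq_inv']
    exact (h.B.matrix_det.inv₀ fun t => h.det_ne_zero _ _).smul h.B.matrix_adjugate
  have hρ' : Continuous fun t : T × ℝ => Complex.I * (ρ t.1 : ℂ) := by fun_prop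
  have hσ' : Continuous fun t : T × ℝ => σ t.1 := by fun_prop
  rw [continuous_clm_apply]
  rintro ⟨c, v, y, z⟩
  have hV : Continuous fun t : T × ℝ => (C t.1).slopeV (ρ t.1) (σ t.1) t.2 (c, v, y, z) := by
    simp only [slopeV]
    refine hI.matrix_mulVec (((((h.A₁.matrix_mulVec continuous_const).add continuous_const).add
      (hρ'.smul continuous_const)).sub (hρ'.smul (h.P.matrix_mulVec continuous_const))).add
      (Continuous.const_smul ?_ c))
    exact ((h.F.sub (h.F.comp hs)).sub (hσ'.smul (h.u.sub (h.u.comp hs)))).sub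
      (h.P.matrix_mulVec h.p)
  have hY : Continuous fun t : T × ℝ => (C t.1).slopeY (ρ t.1) (σ t.1) t.2 (c, v, y, z) := by
    simp only [slopeY]
    refine ((((h.A₂.matrix_mulVec continuous_const).sub (hσ'.smul continuous_const)).sub
      (h.Q.matrix_mulVec hV)).sub ((h.R.matrix_mulVec h.p).const_smul c)).sub
      (hρ'.smul (h.R.matrix_mulVec continuous_const))
  simp only [Function.uncurry, field_apply]
  exact Continuous.prodMk continuous_const (hV.prodMk (hY.prodMk continuous_const))

/-- A single pencil with continuous coefficients. -/
abbrev IsContinuous (C : WavePencil n) : Prop := ContinuousFamily fun _ : Unit => C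

lemma IsContinuous.continuous_field {C : WavePencil n} (h : C.IsContinuous) :
    Continuous (C.field ρ σ) := by
  have h1 : Continuous (Function.uncurry fun _ : Unit => C.field ρ σ) :=
    ContinuousFamily.continuous_field (C := fun _ : Unit => C) h (ρ := fun _ => ρ)
      (σ := fun _ => σ) continuous_const continuous_const
  have h2 : Continuous fun x : ℝ => ((), x) := by fun_prop
  exact (h1.comp h2).congr fun _ => rfl

/-- The solution of the first-order system that starts at `Y`. -/
noncomputable def sol (Y : PencilState n) : ℝ → PencilState n := linearFlow (C.field ρ σ) Y

variable {C ρ σ}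

lemma IsContinuous.sol_add (h : C.IsContinuous) (Y Y' : PencilState n) (x : ℝ) :
    C.sol ρ σ (Y + Y') x = C.sol ρ σ Y x + C.sol ρ σ Y' x :=
  linearFlow_add (h.continuous_field ρ σ) Y Y' x

lemma IsContinuous.sol_smul (h : C.IsContinuous) (c : ℂ) (Y : PencilState n) (x : ℝ) :
    C.sol ρ σ (c • Y) x = c • C.sol ρ σ Y x :=
  linearFlow_smul (𝕜 := ℂ) (h.continuous_field ρ σ)
    (fun t c Y => (C.fieldₗ ρ σ t).map_smul c Y) c Y x

/-- To recognize a solution of the first-order system. -/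
lemma IsContinuous.eq_sol (h : C.IsContinuous) {c : ℂ} {z : Fin n → ℂ} {v v' y y' : ℝ → Fin n → ℂ}
    (hv : ∀ x, HasDerivAt v (v' x) x) (hy : ∀ x, HasDerivAt y (y' x) x)
    (hBv : ∀ x, (C.B x).mulVec (v' x) = (C.A₁ x).mulVec (v x) + z + (Complex.I * ρ) • y x
      - (Complex.I * ρ) • (C.P x).mulVec (v x) + c • C.forcing σ x)
    (hy' : ∀ x, y' x = (C.A₂ x).mulVec (v x) - σ • v x - (C.Q x).mulVec (v' x)
      - c • (C.R x).mulVec (C.p x) - (Complex.I * ρ) • (C.R x).mulVec (v x)) (x : ℝ) :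
    C.sol ρ σ (c, v 0, y 0, z) x = (c, v x, y x, z) := by
  refine (eq_linearFlow (h.continuous_field ρ σ) (α := fun x => (c, v x, y x, z)) ?_ x).symm
  intro t
  have hV : C.slopeV ρ σ t (c, v t, y t, z) = v' t := by
    simp only [slopeV]
    rw [← hBv t, Matrix.mulVec_mulVec, Matrix.nonsing_inv_mul _ (h.det_ne_zero () t).isUnit,
      Matrix.one_mulVec]
  rw [field_apply, hV, slopeY, hV, ← hy' t]
  exact (hasDerivAt_const _ _).prodMk ((hv t).prodMk ((hy t).prodMk (hasDerivAt_const _ _)))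

end WavePencil

namespace WavePencil

variable {n : ℕ} {C : WavePencil n} {ρ : ℝ} {σ κ μ : ℂ} {X : ℝ}

/-- The map `(c, v₀, z) ↦ (v₀ ⬝ p(0), v(X) - μ v₀ - κ c p(0), X⁻¹ (κ z - y(X)))`, where
`(c, v, y, z)` is the solution of the first-order system that starts at `(c, v₀, 0, z)`. -/
noncomputable def monodromy (h : C.IsContinuous) (ρ : ℝ) (σ κ μ : ℂ) (X : ℝ) :
    Module.End ℂ (ℂ × (Fin n → ℂ) × (Fin n → ℂ)) where
  toFun Y := (Y.2.1 ⬝ᵥ C.p 0,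
    (C.sol ρ σ (Y.1, Y.2.1, 0, Y.2.2) X).2.1 - μ • Y.2.1 - (κ * Y.1) • C.p 0,
    (X : ℂ)⁻¹ • (κ • Y.2.2 - (C.sol ρ σ (Y.1, Y.2.1, 0, Y.2.2) X).2.2.1))
  map_add' Y Y' := by
    have e : C.sol ρ σ ((Y + Y').1, (Y + Y').2.1, 0, (Y + Y').2.2) X
        = C.sol ρ σ (Y.1, Y.2.1, 0, Y.2.2) X + C.sol ρ σ (Y'.1, Y'.2.1, 0, Y'.2.2) X := by
      rw [← h.sol_add]; simp
    rw [e]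
    simp only [Prod.fst_add, Prod.snd_add, add_dotProduct, Prod.mk_add_mk]
    congr 2 <;> module
  map_smul' c Y := by
    have e : C.sol ρ σ ((c • Y).1, (c • Y).2.1, 0, (c • Y).2.2) X
        = c • C.sol ρ σ (Y.1, Y.2.1, 0, Y.2.2) X := by
      rw [← h.sol_smul]; simp
    rw [e]
    simp only [Prod.smul_fst, Prod.smul_snd, smul_dotProduct, RingHom.id_apply, Prod.smul_mk,
      smul_eq_mul]
    congr 2 <;> module

lemma monodromy_apply (h : C.IsContinuous) (c : ℂ) (v z : Fin n → ℂ) :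
    monodromy h ρ σ κ μ X (c, v, z) = (v ⬝ᵥ C.p 0,
      (C.sol ρ σ (c, v, 0, z) X).2.1 - μ • v - (κ * c) • C.p 0,
      (X : ℂ)⁻¹ • (κ • z - (C.sol ρ σ (c, v, 0, z) X).2.2.1)) := rfl

lemma continuous_det_of_apply {T V : Type*} [TopologicalSpace T] [NormedAddCommGroup V]
    [NormedSpace ℂ V] [FiniteDimensional ℂ V] {f : T → Module.End ℂ V}
    (hf : ∀ v, Continuous fun t => f t v) : Continuous fun t => LinearMap.det (f t) := by
  let b := Module.finBasis ℂ V
  have e : (fun t => LinearMap.det (f t)) = fun t => (LinearMap.toMatrix b b (f t)).det := by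
    funext t
    rw [LinearMap.det_toMatrix]
  rw [e]
  refine Continuous.matrix_det (continuous_matrix fun i j => ?_)
  simp only [LinearMap.toMatrix_apply]
  exact (LinearMap.continuous_of_finiteDimensional (b.coord i)).comp (hf (b j))

lemma ContinuousFamily.isContinuous {T : Type*} [TopologicalSpace T] {C : T → WavePencil n}
    (h : ContinuousFamily C) (t : T) : (C t).IsContinuous :=
  h.comp (g := fun _ : Unit => t) continuous_const

lemma ContinuousFamily.continuous_det_monodromy {T : Type*} [TopologicalSpace T]
    {C : T → WavePencil n} (h : ContinuousFamily C) {ρ : T → ℝ} {σ κ μ : T → ℂ} (X : ℝ)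
    (hρ : Continuous ρ) (hσ : Continuous σ) (hκ : Continuous κ) (hμ : Continuous μ) :
    Continuous fun t =>
      LinearMap.det (monodromy (h.isContinuous t) (ρ t) (σ t) (κ t) (μ t) X) := by
  refine continuous_det_of_apply ?_
  rintro ⟨c, v, z⟩
  simp only [monodromy_apply]
  have hs : Continuous fun t => (C t).sol (ρ t) (σ t) (c, v, 0, z) X :=
    continuous_linearFlow_param (h.continuous_field hρ hσ) continuous_const X
  have hp : Continuous fun t => (C t).p 0 :=
    h.p.comp (Continuous.prodMk continuous_id continuous_const : Continuous fun t : T => (t, (0 : ℝ)))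
  have h1 : Continuous fun t => v ⬝ᵥ (C t).p 0 := Continuous.dotProduct continuous_const hp
  have h2 : Continuous fun t => ((C t).sol (ρ t) (σ t) (c, v, 0, z) X).2.1 - μ t • v
      - (κ t * c) • (C t).p 0 :=
    (hs.snd.fst.sub (hμ.smul continuous_const)).sub ((hκ.mul continuous_const).smul hp)
  have h3 : Continuous fun t => (X : ℂ)⁻¹ • (κ t • z
      - ((C t).sol (ρ t) (σ t) (c, v, 0, z) X).2.2.1) :=
    Continuous.const_smul (g := fun t => κ t • z
      - ((C t).sol (ρ t) (σ t) (c, v, 0, z) X).2.2.1)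
      ((hκ.smul continuous_const).sub hs.snd.snd.fst) (X : ℂ)⁻¹
  exact h1.prodMk (h2.prodMk h3)

/-- The relations between the coefficients of a pencil that come from a periodic profile. -/
structure IsPeriodic (C : WavePencil n) (X : ℝ) : Prop where
  continuous : C.IsContinuous
  hasDerivAt_u : ∀ x, HasDerivAt C.u (C.p x) x
  hasDerivAt_p : ∃ p' : ℝ → Fin n → ℂ, ∀ x, HasDerivAt C.p (p' x) x ∧
    (C.B x).mulVec (p' x) = (C.A₁ x).mulVec (C.p x) ∧
    HasDerivAt C.F ((C.A₂ x).mulVec (C.p x) - (C.Q x).mulVec (p' x)) x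
  u_period : C.u X = C.u 0
  p_period : C.p X = C.p 0
  F_period : C.F X = C.F 0
  B_period : C.B X = C.B 0
  A₁_period : C.A₁ X = C.A₁ 0
  P_period : C.P X = C.P 0

/-- The flux variable of a solution of the eigenvalue equation. -/
noncomputable def modeFlux (C : WavePencil n) (ρ : ℝ) (w w' : ℝ → Fin n → ℂ) (x : ℝ) : Fin n → ℂ :=
  (C.B x).mulVec (w' x) - (C.A₁ x).mulVec (w x) + (Complex.I * ρ) • (C.P x).mulVec (w x)

/-- `w`, with derivative `w'`, solves the eigenvalue equation with `λ = - i ρ σ`. -/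
def IsMode (C : WavePencil n) (ρ : ℝ) (σ : ℂ) (w w' : ℝ → Fin n → ℂ) : Prop :=
  ∀ x, HasDerivAt w (w' x) x ∧ HasDerivAt (C.modeFlux ρ w w')
    ((Complex.I * ρ) • ((C.A₂ x).mulVec (w x) - σ • w x - (C.Q x).mulVec (w' x)
      - (Complex.I * ρ) • (C.R x).mulVec (w x))) x

lemma IsMode.sum {ι : Type*} [Fintype ι] {w w' : ι → ℝ → Fin n → ℂ}
    (h : ∀ l, C.IsMode ρ σ (w l) (w' l)) (a : ι → ℂ) :
    C.IsMode ρ σ (fun x => ∑ l, a l • w l x) (fun x => ∑ l, a l • w' l x) := by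
  intro x
  refine ⟨HasDerivAt.fun_sum fun l _ => (h l x).1.const_smul (a l), ?_⟩
  have e : C.modeFlux ρ (fun x => ∑ l, a l • w l x) (fun x => ∑ l, a l • w' l x)
      = fun x => ∑ l, a l • C.modeFlux ρ (w l) (w' l) x := by
    funext y
    simp only [modeFlux, Matrix.mulVec_sum, Matrix.mulVec_smul, smul_add, smul_sub,
      Finset.sum_add_distrib, Finset.sum_sub_distrib, Finset.smul_sum, smul_comm (Complex.I * ρ)]
  rw [e]
  refine (HasDerivAt.fun_sum fun l _ => (h l x).2.const_smul (a l)).congr_deriv ?_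
  simp only [Matrix.mulVec_sum, Matrix.mulVec_smul, Finset.smul_sum, ← Finset.sum_sub_distrib]
  refine Finset.sum_congr rfl fun l _ => ?_
  module

/-- The solution of the first-order system given by an eigenmode and a multiple of the derivative
of the profile. -/
lemma IsPeriodic.sol_mode (h : C.IsPeriodic X) (hρ : ρ ≠ 0) {w w' : ℝ → Fin n → ℂ}
    (hw : C.IsMode ρ σ w w') (c : ℂ) (x : ℝ) :
    C.sol ρ σ (c, (Complex.I * c / ρ) • C.p 0 + w 0, 0, C.modeFlux ρ w w' 0) x
      = (c, (Complex.I * c / ρ) • C.p x + w x,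
        (Complex.I * c / ρ) • (C.F x - C.F 0 - σ • (C.u x - C.u 0))
          + (Complex.I * ρ)⁻¹ • (C.modeFlux ρ w w' x - C.modeFlux ρ w w' 0),
        C.modeFlux ρ w w' 0) := by
  obtain ⟨p', hp'⟩ := h.hasDerivAt_p
  have hρ' : (ρ : ℂ) ≠ 0 := by exact_mod_cast hρ
  have hIρ : Complex.I * ρ ≠ 0 := mul_ne_zero Complex.I_ne_zero hρ'
  have key := h.continuous.eq_sol (ρ := ρ) (σ := σ) (c := c) (z := C.modeFlux ρ w w' 0)
    (v := fun x => (Complex.I * c / ρ) • C.p x + w x)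
    (v' := fun x => (Complex.I * c / ρ) • p' x + w' x)
    (y := fun x => (Complex.I * c / ρ) • (C.F x - C.F 0 - σ • (C.u x - C.u 0))
          + (Complex.I * ρ)⁻¹ • (C.modeFlux ρ w w' x - C.modeFlux ρ w w' 0))
    (y' := fun x => (Complex.I * c / ρ) •
        ((C.A₂ x).mulVec (C.p x) - (C.Q x).mulVec (p' x) - σ • C.p x)
      + ((C.A₂ x).mulVec (w x) - σ • w x - (C.Q x).mulVec (w' x)
        - (Complex.I * ρ) • (C.R x).mulVec (w x)))
    (fun x => ((hp' x).1.fun_const_smul _).fun_add (hw x).1) ?_ ?_ ?_ x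
  · simpa using key
  · intro x
    refine HasDerivAt.add ?_ ?_
    · exact ((((hp' x).2.2.sub_const _)).sub (((h.hasDerivAt_u x).sub_const _).const_smul σ)).const_smul
        (Complex.I * c / (ρ : ℂ))
    · refine (((hw x).2.sub_const (C.modeFlux ρ w w' 0)).const_smul (Complex.I * ρ)⁻¹).congr_deriv ?_
      rw [smul_smul, inv_mul_cancel₀ hIρ, one_smul]
  · intro x
    have e1 : Complex.I * ρ * (Complex.I * c / ρ) = -c := by
      field_simp
      rw [Complex.I_sq]; ring
    simp only [Matrix.mulVec_add, Matrix.mulVec_smul, (hp' x).2.1, smul_add, smul_smul, e1,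
      mul_inv_cancel₀ hIρ, forcing]
    simp only [modeFlux]
    module
  · intro x
    have e1 : Complex.I * ρ * (Complex.I * c / ρ) = -c := by
      field_simp
      rw [Complex.I_sq]; ring
    simp only [Matrix.mulVec_add, Matrix.mulVec_smul, smul_add, smul_smul, e1]
    module

lemma IsPeriodic.monodromy_mode (h : C.IsPeriodic X) (hρ : ρ ≠ 0) (hκ : 1 - μ = -(Complex.I * ρ * κ))
    {w w' : ℝ → Fin n → ℂ} (hw : C.IsMode ρ σ w w') (c : ℂ) :
    monodromy h.continuous ρ σ κ μ X
        (c, (Complex.I * c / ρ) • C.p 0 + w 0, C.modeFlux ρ w w' 0)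
      = ((Complex.I / ρ * (C.p 0 ⬝ᵥ C.p 0)) * c + w 0 ⬝ᵥ C.p 0, w X - μ • w 0,
        (-(Complex.I * ρ * X)⁻¹) • (C.modeFlux ρ w w' X - μ • C.modeFlux ρ w w' 0)) := by
  have hρ' : (ρ : ℂ) ≠ 0 := by exact_mod_cast hρ
  have hIρ : Complex.I * ρ ≠ 0 := mul_ne_zero Complex.I_ne_zero hρ'
  rw [monodromy_apply, h.sol_mode hρ hw c X, h.u_period, h.p_period, h.F_period]
  have hμ : μ = 1 + Complex.I * ρ * κ := by linear_combination -hκ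
  refine Prod.ext ?_ (Prod.ext ?_ ?_)
  · simp only [add_dotProduct, smul_dotProduct, smul_eq_mul]
    ring
  · have e : Complex.I * ρ * κ * (Complex.I * c / ρ) = -(κ * c) := by
      field_simp
      rw [Complex.I_sq]; ring
    rw [hμ, add_smul (1 : ℂ), smul_add (Complex.I * ρ * κ), smul_smul (Complex.I * ρ * κ), e]
    module
  · simp only [sub_self, smul_zero, zero_add, hμ]
    have e : κ • C.modeFlux ρ w w' 0
        = (Complex.I * ρ)⁻¹ • ((Complex.I * ρ * κ) • C.modeFlux ρ w w' 0) := by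
      rw [smul_smul, inv_mul_cancel_left₀ hIρ]
    rw [e, mul_inv]
    module

section Det

/-- The columns `(a^l, b^l)` as a square matrix. -/
def stackedMatrix (a b : Fin n ⊕ Fin n → Fin n → ℂ) : Matrix (Fin n ⊕ Fin n) (Fin n ⊕ Fin n) ℂ :=
  Matrix.of fun r l => Sum.elim (fun i => a l i) (fun i => b l i) r

/-- The endomorphism of `ℂ^n × ℂ^n` with the columns `(a^l, b^l)`. -/
noncomputable def stackedMap (a b : Fin n ⊕ Fin n → Fin n → ℂ) :
    Module.End ℂ ((Fin n → ℂ) × (Fin n → ℂ)) :=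
  (LinearEquiv.sumArrowLequivProdArrow (Fin n) (Fin n) ℂ ℂ).toLinearMap
    ∘ₗ Matrix.toLin' (stackedMatrix a b)
    ∘ₗ (LinearEquiv.sumArrowLequivProdArrow (Fin n) (Fin n) ℂ ℂ).symm.toLinearMap

lemma det_stackedMap (a b : Fin n ⊕ Fin n → Fin n → ℂ) :
    LinearMap.det (stackedMap a b) = (stackedMatrix a b).det := by
  rw [stackedMap, LinearMap.det_conj, LinearMap.det_toLin']

lemma stackedMap_apply (a b : Fin n ⊕ Fin n → Fin n → ℂ) (α : Fin n ⊕ Fin n → ℂ) :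
    stackedMap a b (LinearEquiv.sumArrowLequivProdArrow (Fin n) (Fin n) ℂ ℂ α)
      = (∑ l, α l • a l, ∑ l, α l • b l) := by
  simp only [stackedMap, LinearMap.comp_apply, LinearEquiv.coe_coe, LinearEquiv.symm_apply_apply,
    Matrix.toLin'_apply]
  ext i <;> simp [stackedMatrix, Matrix.mulVec, dotProduct, Finset.sum_apply, mul_comm]

/-- The Evans determinant of a family of modes, in terms of the determinant of `monodromy`. -/
lemma IsPeriodic.det_stackedMatrix_eq (h : C.IsPeriodic X) (hX : X ≠ 0) (hp : C.p 0 ⬝ᵥ C.p 0 ≠ 0)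
    (hρ : ρ ≠ 0) (hκ : 1 - μ = -(Complex.I * ρ * κ))
    {w w' : Fin n ⊕ Fin n → ℝ → Fin n → ℂ} (hw : ∀ l, C.IsMode ρ σ (w l) (w' l)) :
    (stackedMatrix (fun l => w l X - μ • w l 0) (fun l => w' l X - μ • w' l 0)).det
      = (-(Complex.I * X)) ^ n * (Complex.I * (C.p 0 ⬝ᵥ C.p 0))⁻¹ * ρ ^ (n + 1)
        * LinearMap.det (monodromy h.continuous ρ σ κ μ X)
        * (stackedMatrix (fun l => w l 0) (fun l => w' l 0)).det := by
  have hρ' : (ρ : ℂ) ≠ 0 := by exact_mod_cast hρ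
  have hX' : (X : ℂ) ≠ 0 := by exact_mod_cast hX
  have hI := Complex.I_ne_zero
  set M := monodromy h.continuous ρ σ κ μ X with hM
  set W := stackedMap (fun l => w l 0) (fun l => w' l 0) with hW
  set E := stackedMap (fun l => w l X - μ • w l 0) (fun l => w' l X - μ • w' l 0) with hE
  let T₀ : (Fin n → ℂ) →ₗ[ℂ] (Fin n → ℂ) :=
    (Complex.I * ρ) • (C.P 0).mulVecLin - (C.A₁ 0).mulVecLin
  let T : Module.End ℂ ((Fin n → ℂ) × (Fin n → ℂ)) :=
    (LinearMap.id ∘ₗ LinearMap.fst ℂ _ _).prod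
      (T₀ ∘ₗ LinearMap.fst ℂ _ _ + (C.B 0).mulVecLin ∘ₗ LinearMap.snd ℂ _ _)
  have hT : LinearMap.det T = (C.B 0).det := by
    rw [LinearMap.det_lower_triangular, LinearMap.det_id, one_mul, ← Matrix.toLin'_apply',
      LinearMap.det_toLin']
  have hTa : ∀ a b, T (a, b) = (a, (Complex.I * ρ) • (C.P 0).mulVec a - (C.A₁ 0).mulVec a
      + (C.B 0).mulVec b) := fun _ _ => rfl
  let s : ℂ := -(Complex.I * ρ * X)⁻¹
  let R : Module.End ℂ ((Fin n → ℂ) × (Fin n → ℂ)) :=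
    LinearMap.prodMap LinearMap.id (s • LinearMap.id)
  have hR : LinearMap.det R = s ^ n := by
    simp [R, LinearMap.det_prodMap]
  let L : Module.End ℂ (ℂ × (Fin n → ℂ) × (Fin n → ℂ)) :=
    (LinearMap.id ∘ₗ LinearMap.fst ℂ _ _).prod
      (LinearMap.toSpanSingleton ℂ _ ((Complex.I / ρ) • (C.p 0, 0)) ∘ₗ LinearMap.fst ℂ _ _
        + (T ∘ₗ W) ∘ₗ LinearMap.snd ℂ _ _)
  have hL : LinearMap.det L = (C.B 0).det * LinearMap.det W := by
    rw [LinearMap.det_lower_triangular, LinearMap.det_id, one_mul, LinearMap.det_comp, hT]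
  let φ : (Fin n → ℂ) × (Fin n → ℂ) →ₗ[ℂ] ℂ :=
    (dotProductBilin ℂ ℂ).flip (C.p 0) ∘ₗ LinearMap.fst ℂ _ _ ∘ₗ W
  let N : Module.End ℂ (ℂ × (Fin n → ℂ) × (Fin n → ℂ)) :=
    (((Complex.I / ρ * (C.p 0 ⬝ᵥ C.p 0)) • LinearMap.id) ∘ₗ LinearMap.fst ℂ _ _
      + φ ∘ₗ LinearMap.snd ℂ _ _).prod ((R ∘ₗ T ∘ₗ E) ∘ₗ LinearMap.snd ℂ _ _)
  have hN : LinearMap.det N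
      = (Complex.I / ρ * (C.p 0 ⬝ᵥ C.p 0)) * (s ^ n * ((C.B 0).det * LinearMap.det E)) := by
    rw [LinearMap.det_upper_triangular, LinearMap.det_comp, LinearMap.det_comp, hT, hR]
    simp
  have hML : M ∘ₗ L = N := by
    refine LinearMap.ext ?_
    rintro ⟨c, α'⟩
    obtain ⟨α, rfl⟩ := (LinearEquiv.sumArrowLequivProdArrow (Fin n) (Fin n) ℂ ℂ).surjective α'
    have hm := IsMode.sum hw α
    have key := h.monodromy_mode hρ hκ hm c
    have eL : L (c, LinearEquiv.sumArrowLequivProdArrow (Fin n) (Fin n) ℂ ℂ α)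
        = (c, (Complex.I * c / ρ) • C.p 0 + ∑ l, α l • w l 0,
          C.modeFlux ρ (fun x => ∑ l, α l • w l x) (fun x => ∑ l, α l • w' l x) 0) := by
      have e1 : L (c, LinearEquiv.sumArrowLequivProdArrow (Fin n) (Fin n) ℂ ℂ α)
          = (c, c • ((Complex.I / (ρ : ℂ)) • (C.p 0, (0 : Fin n → ℂ)))
            + T (W (LinearEquiv.sumArrowLequivProdArrow (Fin n) (Fin n) ℂ ℂ α))) := rfl
      rw [e1, hW, stackedMap_apply, hTa]
      simp only [modeFlux, Prod.smul_mk, Prod.mk_add_mk, smul_zero, zero_add]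
      congr 2
      · module
      · module
    have eN : N (c, LinearEquiv.sumArrowLequivProdArrow (Fin n) (Fin n) ℂ ℂ α)
        = ((Complex.I / ρ * (C.p 0 ⬝ᵥ C.p 0)) * c + (∑ l, α l • w l 0) ⬝ᵥ C.p 0,
          ∑ l, α l • w l X - μ • ∑ l, α l • w l 0,
          (-(Complex.I * ρ * X)⁻¹) •
            (C.modeFlux ρ (fun x => ∑ l, α l • w l x) (fun x => ∑ l, α l • w' l x) X
              - μ • C.modeFlux ρ (fun x => ∑ l, α l • w l x) (fun x => ∑ l, α l • w' l x) 0)) := by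
      have e1 : ∀ v : Fin n ⊕ Fin n → ℝ → Fin n → ℂ, ∑ l, α l • (v l X - μ • v l 0)
          = ∑ l, α l • v l X - μ • ∑ l, α l • v l 0 := by
        intro v
        simp only [smul_sub, Finset.sum_sub_distrib, Finset.smul_sum, smul_comm μ]
      have e2 : N (c, LinearEquiv.sumArrowLequivProdArrow (Fin n) (Fin n) ℂ ℂ α)
          = ((Complex.I / ρ * (C.p 0 ⬝ᵥ C.p 0)) * c
              + (W (LinearEquiv.sumArrowLequivProdArrow (Fin n) (Fin n) ℂ ℂ α)).1 ⬝ᵥ C.p 0,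
            R (T (E (LinearEquiv.sumArrowLequivProdArrow (Fin n) (Fin n) ℂ ℂ α)))) := rfl
      have e3 : ∀ a b, R (a, b) = (a, s • b) := fun _ _ => rfl
      rw [e2, hW, hE, stackedMap_apply, stackedMap_apply, hTa, e3]
      simp only [modeFlux, e1, h.B_period, h.A₁_period, h.P_period, s,
        Matrix.mulVec_sub, Matrix.mulVec_smul]
      congr 2
      module
    rw [LinearMap.comp_apply, eL, eN, hM]
    exact key
  have hdet : LinearMap.det M * LinearMap.det L = LinearMap.det N := by
    rw [← hML, LinearMap.det_comp]
  rw [hL, hN] at hdet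
  rw [← det_stackedMap, ← det_stackedMap, ← hW, ← hE]
  have hB := h.continuous.det_ne_zero () 0
  have hs : s ^ n * (-(Complex.I * ρ * X)) ^ n = 1 := by
    rw [← mul_pow]
    have : s * -(Complex.I * ρ * X) = 1 := by
      simp only [s]
      field_simp
    rw [this, one_pow]
  have h3 : LinearMap.det M * LinearMap.det W
      = (Complex.I / ρ * (C.p 0 ⬝ᵥ C.p 0)) * (s ^ n * LinearMap.det E) :=
    mul_left_cancel₀ hB (by linear_combination hdet)
  have e2 : (-(Complex.I * ρ * X)) ^ n = (-(Complex.I * X)) ^ n * (ρ : ℂ) ^ n := by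
    rw [← mul_pow]; congr 1; ring
  have e3 : LinearMap.det E = (-(Complex.I * ρ * X)) ^ n * (s ^ n * LinearMap.det E) := by
    rw [← mul_assoc, mul_comm (_ ^ n) (s ^ n), hs, one_mul]
  have e4 : s ^ n * LinearMap.det E
      = (Complex.I * (C.p 0 ⬝ᵥ C.p 0))⁻¹ * ρ * (LinearMap.det M * LinearMap.det W) := by
    rw [h3]
    field_simp
  rw [e3, e4, e2]
  ring

lemma IsContinuous.sol_zero (h : C.IsContinuous) (x : ℝ) : C.sol ρ σ 0 x = 0 := by
  simpa using h.sol_smul (ρ := ρ) (σ := σ) 0 0 x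

/-- The initial data of linearly independent modes are linearly independent. -/
lemma IsPeriodic.det_initial_ne_zero (h : C.IsPeriodic X) (hρ : ρ ≠ 0)
    {w w' : Fin n ⊕ Fin n → ℝ → Fin n → ℂ} (hw : ∀ l, C.IsMode ρ σ (w l) (w' l))
    (hli : LinearIndependent ℂ w) :
    (stackedMatrix (fun l => w l 0) (fun l => w' l 0)).det ≠ 0 := by
  intro hdet
  obtain ⟨α, hα, h0⟩ := Matrix.exists_mulVec_eq_zero_iff.2 hdet
  have e := stackedMap_apply (fun l => w l 0) (fun l => w' l 0) α
  have e0 : stackedMap (fun l => w l 0) (fun l => w' l 0)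
      (LinearEquiv.sumArrowLequivProdArrow (Fin n) (Fin n) ℂ ℂ α) = 0 := by
    simp only [stackedMap, LinearMap.comp_apply, LinearEquiv.coe_coe, LinearEquiv.symm_apply_apply,
      Matrix.toLin'_apply, h0, map_zero]
  rw [e0] at e
  have e1 : ∑ l, α l • w l 0 = 0 := (congrArg Prod.fst e).symm
  have e2 : ∑ l, α l • w' l 0 = 0 := (congrArg Prod.snd e).symm
  refine hα ?_
  refine funext (Fintype.linearIndependent_iff.1 hli α ?_)
  funext x
  have key := h.sol_mode hρ (IsMode.sum hw α) 0 x
  have ef : C.modeFlux ρ (fun x => ∑ l, α l • w l x) (fun x => ∑ l, α l • w' l x) 0 = 0 := by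
    simp [modeFlux, e1, e2]
  rw [ef] at key
  simp only [e1, mul_zero, zero_div, zero_smul, zero_add] at key
  have hz := h.continuous.sol_zero (ρ := ρ) (σ := σ) x
  rw [show ((0 : ℂ), (0 : Fin n → ℂ), (0 : Fin n → ℂ), (0 : Fin n → ℂ)) = (0 : PencilState n) from rfl,
    hz] at key
  have := (congrArg (fun Y : PencilState n => Y.2.1) key).symm
  simpa using this

end Det

end WavePencil

/-- The inclusion of `ℝ^n` into `ℂ^n`. -/
noncomputable def complexify (n : ℕ) : (Fin n → ℝ) →L[ℝ] (Fin n → ℂ) :=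
  ContinuousLinearMap.pi fun i => Complex.ofRealCLM.comp (ContinuousLinearMap.proj i)

@[simp] lemma complexify_apply {n : ℕ} (v : Fin n → ℝ) (i : Fin n) :
    complexify n v i = (v i : ℂ) := rfl

lemma complexify_smul {n : ℕ} (r : ℝ) (v : Fin n → ℝ) :
    complexify n (r • v) = (r : ℂ) • complexify n v := by
  ext i; simp

lemma map_ofReal_mulVec_complexify {n : ℕ} (M : Matrix (Fin n) (Fin n) ℝ) (v : Fin n → ℝ) :
    (M.map (fun r : ℝ => (r : ℂ))).mulVec (complexify n v) = complexify n (M.mulVec v) := by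
  ext i; simp [Matrix.mulVec, dotProduct]

lemma complexify_dotProduct {n : ℕ} (v w : Fin n → ℝ) :
    complexify n v ⬝ᵥ complexify n w = ((v ⬝ᵥ w : ℝ) : ℂ) := by
  simp [dotProduct]

namespace ViscousSystem

variable {n m : ℕ} {S : ViscousSystem n m} {ubar : ℝ → Fin n → ℝ} {X : ℝ} {q : Fin n → ℝ}

lemma linB_mulVec (j k : Fin (m + 1)) (x : ℝ) (v : Fin n → ℝ) :
    (S.linB ubar j k x).mulVec (complexify n v) = complexify n ((S.B j k (ubar x)).mulVec v) :=
  map_ofReal_mulVec_complexify _ _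

lemma linA_mulVec (j : Fin (m + 1)) (x : ℝ) (v : Fin n → ℝ) :
    (S.linA ubar j x).mulVec (complexify n v) = complexify n (S.realA ubar j x v) := by
  rw [linA, map_ofReal_mulVec_complexify, LinearMap.toMatrix'_mulVec]
  rfl

lemma IsPeriodicProfile.contDiff_linB (h : S.IsPeriodicProfile ubar X q) (h0 : S.H0) (h1 : S.H1)
    (j k : Fin (m + 1)) (a b : Fin n) : ContDiff ℝ 1 fun x => S.linB ubar j k x a b := by
  have e : ContDiff ℝ 1 fun x => S.B j k (ubar x) a b := by
    rw [← contDiffOn_univ]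
    exact ((h0.2 j k a b).of_le (by norm_num)).comp (h.contDiff_deriv h0 h1).1.contDiffOn
      fun x _ => h.mem_U x
  exact Complex.ofRealCLM.contDiff.comp e

lemma IsPeriodicProfile.contDiff_linA (h : S.IsPeriodicProfile ubar X q) (h0 : S.H0) (h1 : S.H1)
    (j : Fin (m + 1)) (a b : Fin n) : ContDiff ℝ 1 fun x => S.linA ubar j x a b := by
  have hu := h.contDiff_deriv h0 h1
  have comp1 : ∀ {G : Type} [NormedAddCommGroup G] [NormedSpace ℝ G] {g : (Fin n → ℝ) → G},
      ContDiffOn ℝ 2 g S.U → ContDiff ℝ 1 fun x => fderiv ℝ g (ubar x) := by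
    intro G _ _ g hg
    rw [← contDiffOn_univ]
    exact (hg.fderiv_of_isOpen S.isOpen_U (m := 1) (by norm_num)).comp hu.1.contDiffOn
      fun x _ => h.mem_U x
  have e : ContDiff ℝ 1 fun x => fderiv ℝ (S.f j) (ubar x) (Pi.single b 1) a
      - ∑ c, fderiv ℝ (fun u => S.B j 0 u a c) (ubar x) (Pi.single b 1) * deriv ubar x c := by
    refine ContDiff.sub ?_ (ContDiff.sum fun c _ => ?_)
    · exact contDiff_pi.1 ((comp1 (h0.1 j)).clm_apply contDiff_const) a
    · exact ((comp1 (h0.2 j 0 a c)).clm_apply contDiff_const).mul (contDiff_pi.1 hu.2 c)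
  have e2 : (fun x => S.linA ubar j x a b) = fun x => ((fderiv ℝ (S.f j) (ubar x) (Pi.single b 1) a
      - ∑ c, fderiv ℝ (fun u => S.B j 0 u a c) (ubar x) (Pi.single b 1) * deriv ubar x c : ℝ) : ℂ) := by
    funext x
    simp only [linA, Matrix.map_apply, LinearMap.toMatrix'_apply, ContinuousLinearMap.coe_coe]
    rw [sub_apply, Pi.sub_apply]
    congr 2
    rw [← fderiv_mulVec_apply h0 j 0 (h.mem_U x)]
  rw [e2]
  exact Complex.ofRealCLM.contDiff.comp e

lemma IsPeriodicProfile.continuous_linB (h : S.IsPeriodicProfile ubar X q) (h0 : S.H0) (h1 : S.H1)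
    (j k : Fin (m + 1)) : Continuous (S.linB ubar j k) :=
  continuous_matrix fun a b => (h.contDiff_linB h0 h1 j k a b).continuous

lemma IsPeriodicProfile.continuous_linA (h : S.IsPeriodicProfile ubar X q) (h0 : S.H0) (h1 : S.H1)
    (j : Fin (m + 1)) : Continuous (S.linA ubar j) :=
  continuous_matrix fun a b => (h.contDiff_linA h0 h1 j a b).continuous

lemma differentiable_mulVec {A : ℝ → Matrix (Fin n) (Fin n) ℂ} {w : ℝ → Fin n → ℂ}
    (hA : ∀ a b, ContDiff ℝ 1 fun x => A x a b) (hw : Differentiable ℝ w) :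
    Differentiable ℝ fun x => (A x).mulVec (w x) := by
  rw [differentiable_pi]
  intro a
  simp only [Matrix.mulVec, dotProduct]
  refine Differentiable.fun_sum fun b _ => ?_
  exact ((hA a b).differentiable (by norm_num)).fun_mul (differentiable_pi.1 hw b)

lemma IsPeriodicProfile.deriv_ubar_period (h : S.IsPeriodicProfile ubar X q) (h1 : S.H1) :
    ubar X = ubar 0 ∧ deriv ubar X = deriv ubar 0 := by
  have e : ubar X = ubar 0 := by simpa using h.periodic 0
  exact ⟨e, by rw [h.deriv_eq h1, h.deriv_eq h1, e]⟩

lemma IsPeriodicProfile.hasDerivAt_profileFlux (h : S.IsPeriodicProfile ubar X q) (h0 : S.H0)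
    (h1 : S.H1) (j : Fin (m + 1)) (x : ℝ) :
    HasDerivAt (S.profileFlux ubar j) (S.realA ubar j x (deriv ubar x)
      - (S.B j 0 (ubar x)).mulVec (deriv (deriv ubar) x)) x := by
  have hf : HasFDerivAt (S.f j) (fderiv ℝ (S.f j) (ubar x)) (ubar x) :=
    (((h0.1 j).contDiffAt (S.isOpen_U.mem_nhds (h.mem_U x))).differentiableAt
      (by norm_num)).hasFDerivAt
  have hp : HasDerivAt (deriv ubar) (deriv (deriv ubar) x) x :=
    ((h.contDiff_deriv h0 h1).2.differentiable (by norm_num) x).hasDerivAt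
  refine ((hf.comp_hasDerivAt x (h.hasDerivAt x)).sub
    (hasDerivAt_mulVec_comp h0 j 0 (h.mem_U x) (h.hasDerivAt x) hp)).congr_deriv ?_
  rw [realA, sub_apply]
  abel

lemma IsPeriodicProfile.profileFlux_zero (h : S.IsPeriodicProfile ubar X q) (x : ℝ) :
    S.profileFlux ubar 0 x = q := by
  have e := (h.solves x).2.2
  rw [normalB_single] at e
  rw [profileFlux, e]
  simp [Pi.single_apply]

lemma IsPeriodicProfile.mulVec_deriv_deriv (h : S.IsPeriodicProfile ubar X q) (h0 : S.H0)
    (h1 : S.H1) (x : ℝ) :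
    (S.B 0 0 (ubar x)).mulVec (deriv (deriv ubar) x) = S.realA ubar 0 x (deriv ubar x) := by
  have e := h.hasDerivAt_profileFlux h0 h1 0 x
  rw [show S.profileFlux ubar 0 = fun _ => q from funext h.profileFlux_zero] at e
  exact (sub_eq_zero.1 (e.unique (hasDerivAt_const x q))).symm

variable (S ubar) in
/-- The coefficients of the linearization about the profile at the transverse frequency `ρ η`. -/
noncomputable def pencil (η : Fin m → ℝ) : WavePencil n where
  B := S.linB ubar 0 0
  A₁ := S.linA ubar 0
  P x := ∑ k : Fin m, (η k : ℂ) • S.linB ubar 0 k.succ x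
  Q x := ∑ j : Fin m, (η j : ℂ) • S.linB ubar j.succ 0 x
  R x := ∑ j : Fin m, ∑ k : Fin m, ((η j : ℂ) * (η k : ℂ)) • S.linB ubar j.succ k.succ x
  A₂ x := ∑ j : Fin m, (η j : ℂ) • S.linA ubar j.succ x
  u x := complexify n (ubar x)
  p x := complexify n (deriv ubar x)
  F x := ∑ j : Fin m, (η j : ℂ) • complexify n (S.profileFlux ubar j.succ x)

lemma IsPeriodicProfile.det_linB_ne_zero (h : S.IsPeriodicProfile ubar X q) (h1 : S.H1) (x : ℝ) :
    (S.linB ubar 0 0 x).det ≠ 0 := by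
  have e := det_normalB_ne_zero h1 (h.mem_U x) (ν := Pi.single 0 1) (by simp [Pi.single_apply])
  rw [normalB_single] at e
  have e2 : (S.linB ubar 0 0 x).det = (((S.B 0 0 (ubar x)).det : ℝ) : ℂ) :=
    (Complex.ofRealHom.map_det (S.B 0 0 (ubar x))).symm
  rw [e2]
  exact_mod_cast e

lemma IsPeriodicProfile.continuousFamily_pencil (h : S.IsPeriodicProfile ubar X q) (h0 : S.H0)
    (h1 : S.H1) : WavePencil.ContinuousFamily (S.pencil ubar) := by
  have hη : ∀ k, Continuous fun t : (Fin m → ℝ) × ℝ => ((t.1 k : ℝ) : ℂ) := fun k => by fun_prop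
  have hB : ∀ j k, Continuous fun t : (Fin m → ℝ) × ℝ => S.linB ubar j k t.2 := fun j k =>
    (h.continuous_linB h0 h1 j k).comp continuous_snd
  have hA : ∀ j, Continuous fun t : (Fin m → ℝ) × ℝ => S.linA ubar j t.2 := fun j =>
    (h.continuous_linA h0 h1 j).comp continuous_snd
  refine ⟨hB 0 0, hA 0, ?_, ?_, ?_, ?_, ?_, ?_, ?_, fun _ x => h.det_linB_ne_zero h1 x⟩
  · simp only [pencil]
    exact continuous_finsetSum _ fun k _ => (hη k).fun_smul (hB _ _)
  · simp only [pencil]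
    exact continuous_finsetSum _ fun k _ => (hη k).fun_smul (hB _ _)
  · simp only [pencil]
    exact continuous_finsetSum _ fun j _ => continuous_finsetSum _ fun k _ =>
      ((hη j).fun_mul (hη k)).fun_smul (hB _ _)
  · simp only [pencil]
    exact continuous_finsetSum _ fun k _ => (hη k).fun_smul (hA _)
  · exact (complexify n).continuous.comp (h.continuous.comp continuous_snd)
  · exact (complexify n).continuous.comp ((h.contDiff_deriv h0 h1).2.continuous.comp continuous_snd)
  · simp only [pencil]
    exact continuous_finsetSum _ fun k _ => (hη k).fun_smul ((complexify n).continuous.comp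
      ((h.continuous_profileFlux h0 h1 _).comp continuous_snd))

lemma sum_smul_mulVec {ι : Type*} [Fintype ι] (c : ι → ℂ) (A : ι → Matrix (Fin n) (Fin n) ℂ)
    (v : Fin n → ℂ) : (∑ i, c i • A i).mulVec v = ∑ i, c i • (A i).mulVec v := by
  rw [Matrix.sum_mulVec]
  simp only [Matrix.smul_mulVec]

lemma IsPeriodicProfile.isPeriodic_pencil (h : S.IsPeriodicProfile ubar X q) (h0 : S.H0)
    (h1 : S.H1) (η : Fin m → ℝ) : (S.pencil ubar η).IsPeriodic X := by
  obtain ⟨hu, hp⟩ := h.deriv_ubar_period h1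
  have hB : ∀ j k, S.linB ubar j k X = S.linB ubar j k 0 := fun j k => by rw [linB, linB, hu]
  have hA : ∀ j, S.linA ubar j X = S.linA ubar j 0 := fun j => by rw [linA, linA, hu, hp]
  have hF : ∀ j, S.profileFlux ubar j X = S.profileFlux ubar j 0 := fun j => by
    rw [profileFlux, profileFlux, hu, hp]
  have hc : ∀ {g : ℝ → Fin n → ℝ} {g' : Fin n → ℝ} {x : ℝ}, HasDerivAt g g' x →
      HasDerivAt (fun x => complexify n (g x)) (complexify n g') x := fun hg =>
    (complexify n).hasFDerivAt.comp_hasDerivAt _ hg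
  refine ⟨(h.continuousFamily_pencil h0 h1).isContinuous η, fun x => hc (h.hasDerivAt x),
    ⟨fun x => complexify n (deriv (deriv ubar) x), fun x => ⟨?_, ?_, ?_⟩⟩, ?_, ?_, ?_, hB 0 0, hA 0, ?_⟩
  · exact hc ((h.contDiff_deriv h0 h1).2.differentiable (by norm_num) x).hasDerivAt
  · simp only [pencil, linB_mulVec, linA_mulVec, h.mulVec_deriv_deriv h0 h1]
  · refine (HasDerivAt.fun_sum (u := Finset.univ) fun j _ =>
      (hc (h.hasDerivAt_profileFlux h0 h1 j.succ x)).fun_const_smul (η j : ℂ)).congr_deriv ?_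
    simp only [pencil, sum_smul_mulVec, linB_mulVec, linA_mulVec, map_sub, smul_sub,
      Finset.sum_sub_distrib]
  · simp only [pencil, hu]
  · simp only [pencil, hp]
  · simp only [pencil, hF]
  · simp only [pencil, hB]

lemma IsPeriodicProfile.isMode_of_isEigenSolution (h : S.IsPeriodicProfile ubar X q) (h0 : S.H0)
    (h1 : S.H1) {η : Fin m → ℝ} {ρ : ℝ} {σ : ℂ} {w : ℝ → Fin n → ℂ}
    (hw : S.IsEigenSolution ubar (ρ • η) (-Complex.I * ρ * σ) w) :
    (S.pencil ubar η).IsMode ρ σ w (deriv w) := by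
  obtain ⟨hw2, he⟩ := hw
  have hw1 : Differentiable ℝ w := hw2.differentiable (by norm_num)
  have hw' : Differentiable ℝ (deriv w) :=
    (hw2.iterate_deriv' 1 1).differentiable (by norm_num)
  intro x
  refine ⟨(hw1 x).hasDerivAt, ?_⟩
  have d1 : Differentiable ℝ fun y => (S.linB ubar 0 0 y).mulVec (deriv w y) :=
    differentiable_mulVec (h.contDiff_linB h0 h1 0 0) hw'
  have d2 : Differentiable ℝ fun y => (S.linA ubar 0 y).mulVec (w y) :=
    differentiable_mulVec (h.contDiff_linA h0 h1 0) hw1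
  have d3 : Differentiable ℝ fun y =>
      ∑ k : Fin m, (((ρ • η) k : ℝ) : ℂ) • (S.linB ubar 0 k.succ y).mulVec (w y) :=
    Differentiable.fun_sum fun k _ =>
      (differentiable_mulVec (h.contDiff_linB h0 h1 0 k.succ) hw1).fun_const_smul _
  have e : (S.pencil ubar η).modeFlux ρ w (deriv w) = fun y =>
      (S.linB ubar 0 0 y).mulVec (deriv w y) - (S.linA ubar 0 y).mulVec (w y)
        + Complex.I • ∑ k : Fin m, (((ρ • η) k : ℝ) : ℂ) • (S.linB ubar 0 k.succ y).mulVec (w y) := by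
    funext y
    simp only [WavePencil.modeFlux, pencil, sum_smul_mulVec, Finset.smul_sum, smul_smul,
      Pi.smul_apply, smul_eq_mul, Complex.ofReal_mul, mul_assoc]
  rw [e]
  refine (((d1 x).hasDerivAt.sub (d2 x).hasDerivAt).add
    ((d3 x).hasDerivAt.const_smul Complex.I)).congr_deriv ?_
  have hx := he x
  have e1 : Complex.I • ∑ j : Fin m, (((ρ • η) j : ℝ) : ℂ) • (S.linB ubar j.succ 0 x).mulVec (deriv w x)
      = (Complex.I * ρ) • ((S.pencil ubar η).Q x).mulVec (deriv w x) := by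
    simp only [pencil, sum_smul_mulVec, Finset.smul_sum, smul_smul,
      Pi.smul_apply, smul_eq_mul, Complex.ofReal_mul, mul_assoc]
  have e2 : Complex.I • ∑ j : Fin m, (((ρ • η) j : ℝ) : ℂ) • (S.linA ubar j.succ x).mulVec (w x)
      = (Complex.I * ρ) • ((S.pencil ubar η).A₂ x).mulVec (w x) := by
    simp only [pencil, sum_smul_mulVec, Finset.smul_sum, smul_smul,
      Pi.smul_apply, smul_eq_mul, Complex.ofReal_mul, mul_assoc]
  have e3 : ∑ j : Fin m, ∑ k : Fin m, ((((ρ • η) j : ℝ) : ℂ) * (((ρ • η) k : ℝ) : ℂ)) •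
        (S.linB ubar j.succ k.succ x).mulVec (w x)
      = ((ρ : ℂ) * ρ) • ((S.pencil ubar η).R x).mulVec (w x) := by
    simp only [pencil, Matrix.sum_mulVec, Matrix.smul_mulVec, Finset.smul_sum, smul_smul,
      Pi.smul_apply, smul_eq_mul, Complex.ofReal_mul]
    refine Finset.sum_congr rfl fun j _ => Finset.sum_congr rfl fun k _ => ?_
    congr 1
    ring
  rw [e1, e2, e3] at hx
  have hI : Complex.I * ρ * (Complex.I * ρ) = -((ρ : ℂ) * ρ) := by
    linear_combination ((ρ : ℂ) * ρ) * Complex.I_mul_I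
  simp only [smul_sub, smul_smul, hI]
  rw [← sub_eq_zero] at hx ⊢
  rw [← hx]
  module

lemma IsPeriodicProfile.deriv_zero_ne_zero (h : S.IsPeriodicProfile ubar X q) (h0 : S.H0)
    (h1 : S.H1) : deriv ubar 0 ≠ 0 := by
  intro hz
  obtain ⟨x, hx⟩ := h.nonconstant
  have hs : S.slope (ubar 0) (0, 0, q) = 0 := by rw [← h.deriv_eq h1, hz]
  have hI : ∀ y, y ∈ Ioo (-(|x| + 1)) (|x| + 1) ↔ |y| < |x| + 1 := fun y => by
    rw [mem_Ioo, abs_lt]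
  have key := solution_unique_of_contDiffOn (φ := ubar) (ψ := fun _ => ubar 0) S.isOpen_U
    ((contDiffOn_slope_left h0 h1 (0, 0, q)).of_le (m := 1) (by norm_num))
    (α := -(|x| + 1)) (β := |x| + 1) (t₀ := 0)
    (fun t _ => ⟨h.mem_U t, by rw [← h.deriv_eq h1]; exact h.hasDerivAt t⟩)
    (fun t _ => ⟨h.mem_U 0, by rw [hs]; exact hasDerivAt_const _ _⟩)
    ((hI 0).2 (by rw [abs_zero]; positivity)) rfl
  exact hx (key ((hI x).2 (by linarith)))

end ViscousSystem

lemma differentiable_det {ι : Type*} [Fintype ι] [DecidableEq ι] {A : ℂ → Matrix ι ι ℂ}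
    (hA : ∀ i j, Differentiable ℂ fun z => A z i j) : Differentiable ℂ fun z => (A z).det := by
  simp only [Matrix.det_apply']
  exact Differentiable.fun_sum fun τ _ => (differentiable_const _).fun_mul
    (Differentiable.fun_finsetProd fun i _ => hA _ _)

lemma continuous_dslope_exp : Continuous (dslope Complex.exp 0) := by
  rw [← continuousOn_univ, continuousOn_dslope univ_mem]
  exact ⟨Complex.continuous_exp.continuousOn, Complex.differentiable_exp 0⟩

lemma mul_dslope_exp (z : ℂ) : z * dslope Complex.exp 0 z = Complex.exp z - 1 := by
  have := sub_smul_dslope Complex.exp 0 z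
  simpa using this

/-- A continuous function that is entire in `z` for all parameters outside the hyperplane
`t.1 = 0` is entire in `z` for all parameters. -/
lemma differentiable_of_continuous_of_ne {V : Type*} [TopologicalSpace V] {G : ℝ × V → ℂ → ℂ}
    (hGc : Continuous (Function.uncurry G))
    (hG : ∀ t : ℝ × V, t.1 ≠ 0 → Differentiable ℂ (G t)) (t : ℝ × V) : Differentiable ℂ (G t) := by
  obtain ⟨ρ, ξ⟩ := t
  by_cases hρ : ρ ≠ 0
  · exact hG _ hρ
  push Not at hρ
  subst hρ
  have hb : (𝓝[≠] (0 : ℝ)).NeBot := inferInstance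
  have htend : Tendsto (fun s : ℝ => (s, ξ)) (𝓝[≠] 0) (𝓝 (0, ξ)) :=
    ((by fun_prop : Continuous fun s : ℝ => (s, ξ)).tendsto' 0 (0, ξ) rfl).mono_left
      nhdsWithin_le_nhds
  intro z₀
  have hU : IsOpen (Metric.ball (0 : ℂ) (‖z₀‖ + 1)) := Metric.isOpen_ball
  have hz₀ : z₀ ∈ Metric.ball (0 : ℂ) (‖z₀‖ + 1) := by simp
  refine DifferentiableOn.differentiableAt (s := Metric.ball (0 : ℂ) (‖z₀‖ + 1)) ?_
    (hU.mem_nhds hz₀)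
  have hu : TendstoUniformlyOn (fun (s : ℝ) z => G (s, ξ) z) (G (0, ξ)) (𝓝[≠] 0)
      (Metric.ball (0 : ℂ) (‖z₀‖ + 1)) := by
    rw [Metric.tendstoUniformlyOn_iff]
    intro ε hε
    filter_upwards [htend.eventually (eventually_forall_norm_sub_lt hGc (0, ξ) (‖z₀‖ + 1) ε hε)]
      with s hs z hz
    rw [dist_comm, dist_eq_norm]
    exact hs z (by simpa using (Metric.mem_ball.1 hz).le)
  refine hu.tendstoLocallyUniformlyOn.differentiableOn ?_ hU
  filter_upwards [self_mem_nhdsWithin] with s hs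
  exact (hG (s, ξ) hs).differentiableOn

namespace ViscousSystem

variable {n m : ℕ} {S : ViscousSystem n m} {ubar : ℝ → Fin n → ℝ} {X : ℝ} {q : Fin n → ℝ}

/-- The Evans function in the scaled variables `(ρ ξ, - i ρ σ)`, with its power of `ρ` and its
dependence on the basis of solutions removed. -/
noncomputable def IsPeriodicProfile.reducedEvans (h : S.IsPeriodicProfile ubar X q) (h0 : S.H0)
    (h1 : S.H1) (t : ℝ × (Fin (m + 1) → ℝ)) (σ : ℂ) : ℂ :=
  LinearMap.det (WavePencil.monodromy
    ((h.continuousFamily_pencil h0 h1).isContinuous fun j => t.2 j.succ) t.1 σ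
    (X * t.2 0 * dslope Complex.exp 0 (Complex.I * X * (t.1 * t.2 0)))
    (Complex.exp (Complex.I * X * (t.1 * t.2 0))) X)

lemma IsPeriodicProfile.continuous_reducedEvans (h : S.IsPeriodicProfile ubar X q) (h0 : S.H0)
    (h1 : S.H1) : Continuous (Function.uncurry (h.reducedEvans h0 h1)) := by
  have hg : Continuous fun s : (ℝ × (Fin (m + 1) → ℝ)) × ℂ => fun j : Fin m => s.1.2 j.succ := by
    fun_prop
  have hz : Continuous fun s : (ℝ × (Fin (m + 1) → ℝ)) × ℂ =>
      Complex.I * X * ((s.1.1 : ℂ) * (s.1.2 0 : ℂ)) := by fun_prop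
  have hξ : Continuous fun s : (ℝ × (Fin (m + 1) → ℝ)) × ℂ => (X : ℂ) * (s.1.2 0 : ℂ) := by fun_prop
  exact ((h.continuousFamily_pencil h0 h1).comp hg).continuous_det_monodromy X
    (continuous_fst.comp continuous_fst) continuous_snd
    (hξ.fun_mul (continuous_dslope_exp.comp hz)) (Complex.continuous_exp.comp hz)

/-- The Wronskian at `0` of a basis of solutions. -/
noncomputable def initialDet (w : (Fin m → ℝ) → ℂ → (Fin n ⊕ Fin n) → ℝ → Fin n → ℂ)
    (η : Fin m → ℝ) (lam : ℂ) : ℂ :=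
  (WavePencil.stackedMatrix (fun l => w η lam l 0) (fun l => deriv (w η lam l) 0)).det

lemma IsEvansBasis.initialDet_ne_zero (h : S.IsPeriodicProfile ubar X q) (h0 : S.H0) (h1 : S.H1)
    {w : (Fin m → ℝ) → ℂ → (Fin n ⊕ Fin n) → ℝ → Fin n → ℂ} (hw : S.IsEvansBasis ubar w)
    (η : Fin m → ℝ) (lam : ℂ) : initialDet w η lam ≠ 0 := by
  refine (h.isPeriodic_pencil h0 h1 η).det_initial_ne_zero (ρ := 1) (σ := Complex.I * lam)
    one_ne_zero (fun l => h.isMode_of_isEigenSolution h0 h1 ?_) (hw.independent η lam)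
  have e : -Complex.I * ((1 : ℝ) : ℂ) * (Complex.I * lam) = lam := by
    push_cast
    linear_combination (-lam) * Complex.I_mul_I
  rw [one_smul, e]
  exact hw.solution η lam l

lemma IsEvansBasis.differentiable_initialDet
    {w : (Fin m → ℝ) → ℂ → (Fin n ⊕ Fin n) → ℝ → Fin n → ℂ} (hw : S.IsEvansBasis ubar w)
    (η : Fin m → ℝ) : Differentiable ℂ (initialDet w η) := by
  refine differentiable_det fun r l => ?_
  rcases r with i | i
  · exact differentiable_pi.1 (hw.holomorphic η l 0) i
  · exact differentiable_pi.1 (hw.holomorphic_deriv η l 0) i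

lemma IsEvansBasis.differentiable_evans
    {w : (Fin m → ℝ) → ℂ → (Fin n ⊕ Fin n) → ℝ → Fin n → ℂ} (hw : S.IsEvansBasis ubar w)
    (ξ : Fin (m + 1) → ℝ) : Differentiable ℂ (evans w X ξ) := by
  refine differentiable_det fun r l => ?_
  rcases r with i | i
  · exact (differentiable_pi.1 (hw.holomorphic _ l X) i).fun_sub
      ((differentiable_pi.1 (hw.holomorphic _ l 0) i).const_mul _)
  · exact (differentiable_pi.1 (hw.holomorphic_deriv _ l X) i).fun_sub
      ((differentiable_pi.1 (hw.holomorphic_deriv _ l 0) i).const_mul _)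

lemma IsEvansBasis.evans_eq (h : S.IsPeriodicProfile ubar X q) (h0 : S.H0) (h1 : S.H1)
    {w : (Fin m → ℝ) → ℂ → (Fin n ⊕ Fin n) → ℝ → Fin n → ℂ} (hw : S.IsEvansBasis ubar w)
    {ρ : ℝ} (hρ : ρ ≠ 0) (ξ : Fin (m + 1) → ℝ) (σ : ℂ) :
    evans w X (ρ • ξ) (-Complex.I * ρ * σ)
      = (-(Complex.I * X)) ^ n * (Complex.I * ((deriv ubar 0 ⬝ᵥ deriv ubar 0 : ℝ) : ℂ))⁻¹
        * ρ ^ (n + 1) * h.reducedEvans h0 h1 (ρ, ξ) σ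
        * initialDet w (fun j => (ρ • ξ) j.succ) (-Complex.I * ρ * σ) := by
  set η : Fin m → ℝ := fun j => ξ j.succ with hη
  have hp : (S.pencil ubar η).p 0 ⬝ᵥ (S.pencil ubar η).p 0
      = ((deriv ubar 0 ⬝ᵥ deriv ubar 0 : ℝ) : ℂ) := complexify_dotProduct _ _
  have hp0 : (S.pencil ubar η).p 0 ⬝ᵥ (S.pencil ubar η).p 0 ≠ 0 := by
    rw [hp]
    have := h.deriv_zero_ne_zero h0 h1
    exact_mod_cast (fun e => this (dotProduct_self_eq_zero.1 e))
  have key := (h.isPeriodic_pencil h0 h1 η).det_stackedMatrix_eq h.period_pos.ne' hp0 hρ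
    (σ := σ) (κ := X * ξ 0 * dslope Complex.exp 0 (Complex.I * X * (ρ * ξ 0)))
    (μ := Complex.exp (Complex.I * X * (ρ * ξ 0)))
    (by linear_combination mul_dslope_exp (Complex.I * X * (ρ * ξ 0)))
    (w := w (fun j => (ρ • ξ) j.succ) (-Complex.I * ρ * σ))
    (w' := fun l => deriv (w (fun j => (ρ • ξ) j.succ) (-Complex.I * ρ * σ) l))
    (fun l => h.isMode_of_isEigenSolution h0 h1 (hw.solution _ _ l))
  rw [hp] at key
  have e : evans w X (ρ • ξ) (-Complex.I * ρ * σ) = (WavePencil.stackedMatrix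
      (fun l => w (fun j => (ρ • ξ) j.succ) (-Complex.I * ρ * σ) l X
        - Complex.exp (Complex.I * X * (ρ * ξ 0)) • w (fun j => (ρ • ξ) j.succ) (-Complex.I * ρ * σ) l 0)
      (fun l => deriv (w (fun j => (ρ • ξ) j.succ) (-Complex.I * ρ * σ) l) X
        - Complex.exp (Complex.I * X * (ρ * ξ 0)) •
          deriv (w (fun j => (ρ • ξ) j.succ) (-Complex.I * ρ * σ) l) 0)).det := by
    simp only [evans, WavePencil.stackedMatrix, Pi.smul_apply, smul_eq_mul, Complex.ofReal_mul,
      Pi.sub_apply]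
  rw [e]
  exact key

lemma IsEvansBasis.differentiable_reducedEvans (h : S.IsPeriodicProfile ubar X q) (h0 : S.H0)
    (h1 : S.H1) {w : (Fin m → ℝ) → ℂ → (Fin n ⊕ Fin n) → ℝ → Fin n → ℂ}
    (hw : S.IsEvansBasis ubar w) (t : ℝ × (Fin (m + 1) → ℝ)) :
    Differentiable ℂ (h.reducedEvans h0 h1 t) := by
  refine differentiable_of_continuous_of_ne (h.continuous_reducedEvans h0 h1) ?_ t
  rintro ⟨ρ, ξ⟩ hρ
  have hρ' : (ρ : ℂ) ≠ 0 := by exact_mod_cast hρ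
  have hX : (X : ℂ) ≠ 0 := by exact_mod_cast h.period_pos.ne'
  set K : ℂ := (-(Complex.I * X)) ^ n * (Complex.I * ((deriv ubar 0 ⬝ᵥ deriv ubar 0 : ℝ) : ℂ))⁻¹
    with hK
  have hK0 : K ≠ 0 := by
    refine mul_ne_zero (pow_ne_zero _ (neg_ne_zero.2 (mul_ne_zero Complex.I_ne_zero hX)))
      (inv_ne_zero (mul_ne_zero Complex.I_ne_zero ?_))
    have := h.deriv_zero_ne_zero h0 h1
    exact_mod_cast (fun e => this (dotProduct_self_eq_zero.1 e))
  have hd := fun σ => IsEvansBasis.initialDet_ne_zero h h0 h1 hw (fun j => (ρ • ξ) j.succ)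
    (-Complex.I * ρ * σ)
  have hl : Differentiable ℂ fun σ : ℂ => -Complex.I * ρ * σ := by fun_prop
  have e : h.reducedEvans h0 h1 (ρ, ξ) = fun σ => evans w X (ρ • ξ) (-Complex.I * ρ * σ)
      / (K * ρ ^ (n + 1) * initialDet w (fun j => (ρ • ξ) j.succ) (-Complex.I * ρ * σ)) := by
    funext σ
    rw [hw.evans_eq h h0 h1 hρ ξ σ, eq_div_iff
      (mul_ne_zero (mul_ne_zero hK0 (pow_ne_zero _ hρ')) (hd σ))]
    ring
  rw [e]
  exact ((hw.differentiable_evans (X := X) (ρ • ξ)).comp hl).fun_div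
    (((hw.differentiable_initialDet _).comp hl).const_mul _)
    fun σ => mul_ne_zero (mul_ne_zero hK0 (pow_ne_zero _ hρ')) (hd σ)

end ViscousSystem

/-- A complex linear map that restricts to a real one has the same determinant. -/
lemma LinearMap.det_eq_ofReal_det {V : Type*} {W : Type*} [AddCommGroup V] [Module ℝ V] [AddCommGroup W]
    [Module ℂ W] {ι : Type*} [Fintype ι] [DecidableEq ι] (b : Module.Basis ι ℝ V)
    (c : Module.Basis ι ℂ W) (e : V → W) (hb : ∀ i, e (b i) = c i)
    (hr : ∀ v i, c.repr (e v) i = (b.repr v i : ℂ)) {f : Module.End ℝ V} {g : Module.End ℂ W}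
    (hfg : ∀ v, g (e v) = e (f v)) : LinearMap.det g = ((LinearMap.det f : ℝ) : ℂ) := by
  rw [← LinearMap.det_toMatrix b, ← LinearMap.det_toMatrix c]
  have : LinearMap.toMatrix c c g = (LinearMap.toMatrix b b f).map (fun r : ℝ => (r : ℂ)) := by
    ext i j
    rw [LinearMap.toMatrix_apply, ← hb, hfg, hr, Matrix.map_apply, LinearMap.toMatrix_apply]
  rw [this]
  exact (Complex.ofRealHom.map_det _).symm

namespace ViscousSystem

variable {n m : ℕ} (S : ViscousSystem n m) (ubar : ℝ → Fin n → ℝ) (X : ℝ) (q : Fin n → ℝ)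
  (ξ : Fin (m + 1) → ℝ) (σ : ℝ)

/-- The variation of the wave parameters that corresponds to the initial data `(c, v, z)` of the
first-order system at `ρ = 0`. -/
noncomputable def longParam : ℝ × (Fin n → ℝ) × (Fin n → ℝ) →ₗ[ℝ] WaveParam n m where
  toFun x := (-(x.1 * X * ξ 0), x.2.1, x.1 * σ, x.1 • (fun j : Fin m => ξ j.succ),
    x.1 • (∑ j : Fin m, ξ j.succ • S.profileFlux ubar j.succ 0 - σ • ubar 0) - x.2.2)
  map_add' x y := by
    simp only [Prod.fst_add, Prod.snd_add, Prod.mk_add_mk]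
    refine Prod.ext (by ring) (Prod.ext rfl (Prod.ext (by ring) (Prod.ext ?_ ?_))) <;>
      (simp only; module)
  map_smul' c x := by
    simp only [Prod.smul_fst, Prod.smul_snd, smul_eq_mul, RingHom.id_apply, Prod.smul_mk]
    refine Prod.ext (by ring) (Prod.ext rfl (Prod.ext (by ring) (Prod.ext ?_ ?_))) <;>
      (simp only; module)

lemma longParam_apply (c : ℝ) (v z : Fin n → ℝ) : S.longParam ubar X ξ σ (c, v, z)
    = (-(c * X * ξ 0), v, c * σ, c • (fun j : Fin m => ξ j.succ),
      c • (∑ j : Fin m, ξ j.succ • S.profileFlux ubar j.succ 0 - σ • ubar 0) - z) := rfl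

/-- The map `σ d(M, Ω N) - ∑ j, ξ_j d(F^j, S Ω e_j)` at the profile. -/
noncomputable def dSymbol : WaveParam n m →ₗ[ℝ] (Fin n → ℝ) × (Fin (m + 1) → ℝ) :=
  σ • (fderiv ℝ S.density (baseParam m ubar X q)).toLinearMap
    - ∑ j, ξ j • (fderiv ℝ (S.flux j) (baseParam m ubar X q)).toLinearMap

lemma dSymbol_apply (p : WaveParam n m) : S.dSymbol ubar X q ξ σ p
    = σ • fderiv ℝ S.density (baseParam m ubar X q) p
      - ∑ j, ξ j • fderiv ℝ (S.flux j) (baseParam m ubar X q) p := by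
  simp [dSymbol]

/-- The real form of `WavePencil.monodromy` at `ρ = 0`. -/
noncomputable def realMonodromy : Module.End ℝ (ℝ × (Fin n → ℝ) × (Fin n → ℝ)) :=
  LinearMap.prod ((dotProductBilin ℝ ℝ).flip (deriv ubar 0) ∘ₗ LinearMap.fst ℝ _ _ ∘ₗ LinearMap.snd ℝ _ _)
    (LinearMap.prod ((fderiv ℝ S.shoot (baseParam m ubar X q)).toLinearMap ∘ₗ S.longParam ubar X ξ σ)
      (LinearMap.fst ℝ _ _ ∘ₗ S.dSymbol ubar X q ξ σ ∘ₗ S.longParam ubar X ξ σ))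

lemma realMonodromy_apply (x : ℝ × (Fin n → ℝ) × (Fin n → ℝ)) :
    S.realMonodromy ubar X q ξ σ x = (x.2.1 ⬝ᵥ deriv ubar 0,
      fderiv ℝ S.shoot (baseParam m ubar X q) (S.longParam ubar X ξ σ x),
      (S.dSymbol ubar X q ξ σ (S.longParam ubar X ξ σ x)).1) := rfl

variable {S ubar X q ξ σ}

lemma IsPeriodicProfile.dSymbol_snd (h : S.IsPeriodicProfile ubar X q) (h0 : S.H0) (h1 : S.H1)
    (p : WaveParam n m) : (S.dSymbol ubar X q ξ σ p).2
      = σ • (X⁻¹ • (Fin.cons 0 p.2.2.2.1 : Fin (m + 1) → ℝ)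
            - (p.1 / X ^ 2) • (Pi.single 0 1 : Fin (m + 1) → ℝ)) - (p.2.2.1 * X⁻¹) • ξ := by
  obtain ⟨v, v', μ, φ, -, -, -, -, -, -, -, -, hd, hf⟩ := h.exists_variation h0 h1 p
  rw [dSymbol_apply, hd]
  simp only [hf, Prod.snd_sub, Prod.smul_snd, Prod.snd_sum]
  congr 1
  ext i
  simp [Finset.sum_apply, Pi.single_apply, mul_comm]

lemma IsPeriodicProfile.dSymbol_longParam_snd (h : S.IsPeriodicProfile ubar X q) (h0 : S.H0)
    (h1 : S.H1) (x : ℝ × (Fin n → ℝ) × (Fin n → ℝ)) :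
    (S.dSymbol ubar X q ξ σ (S.longParam ubar X ξ σ x)).2 = 0 := by
  have hX := h.period_pos.ne'
  rw [h.dSymbol_snd h0 h1]
  simp only [longParam, LinearMap.coe_mk, AddHom.coe_mk]
  ext i
  refine Fin.cases ?_ (fun i => ?_) i
  · simp
    field_simp
    ring
  · simp
    ring

/-- The complex first-order system at `ρ = 0` and real `σ` describes the variation of the wave. -/
lemma IsPeriodicProfile.monodromy_zero (h : S.IsPeriodicProfile ubar X q) (h0 : S.H0) (h1 : S.H1)
    (hc : (S.pencil ubar fun j => ξ j.succ).IsContinuous) (x : ℝ × (Fin n → ℝ) × (Fin n → ℝ)) :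
    WavePencil.monodromy hc 0 (σ : ℂ) (X * ξ 0) 1 X
        ((x.1 : ℂ), complexify n x.2.1, complexify n x.2.2)
      = (((S.realMonodromy ubar X q ξ σ x).1 : ℂ), complexify n (S.realMonodromy ubar X q ξ σ x).2.1,
          complexify n (S.realMonodromy ubar X q ξ σ x).2.2) := by
  obtain ⟨c, v₀, z⟩ := x
  have hX := h.period_pos.ne'
  obtain ⟨hu, hp⟩ := h.deriv_ubar_period h1
  obtain ⟨v, v', μ, φ, hv0, hμ0, hφ0, hv, hμ, hφ, hB, hs, hd, hf⟩ :=
    h.exists_variation h0 h1 (S.longParam ubar X ξ σ (c, v₀, z))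
  simp only [longParam, LinearMap.coe_mk, AddHom.coe_mk] at hv0 hφ hB hs hd hf
  have hcx : ∀ {g : ℝ → Fin n → ℝ} {g' : Fin n → ℝ} {x : ℝ}, HasDerivAt g g' x →
      HasDerivAt (fun x => complexify n (g x)) (complexify n g') x := fun hg =>
    (complexify n).hasFDerivAt.comp_hasDerivAt _ hg
  have hφX : φ 0 X = -(∑ j : Fin m, (c * ξ j.succ) • ∫ x in (0 : ℝ)..X, S.profileFlux ubar j.succ x)
      + (c * σ) • (∫ x in (0 : ℝ)..X, ubar x)
      + X • (c • (∑ j : Fin m, ξ j.succ • S.profileFlux ubar j.succ 0 - σ • ubar 0) - z) := by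
    have hI : ∀ {g : ℝ → Fin n → ℝ}, Continuous g → ∀ t,
        HasDerivAt (fun t => ∫ x in (0 : ℝ)..t, g x) (g t) t := fun hg t =>
      intervalIntegral.integral_hasDerivAt_right (hg.intervalIntegrable _ _)
        hg.stronglyMeasurable.stronglyMeasurableAtFilter hg.continuousAt
    have hD : ∀ t, HasDerivAt (fun t => φ 0 t
        - (-(∑ j : Fin m, (c * ξ j.succ) • ∫ x in (0 : ℝ)..t, S.profileFlux ubar j.succ x)
          + (c * σ) • (∫ x in (0 : ℝ)..t, ubar x)
          + t • (c • (∑ j : Fin m, ξ j.succ • S.profileFlux ubar j.succ 0 - σ • ubar 0) - z))) 0 t := by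
      intro t
      refine ((hφ 0 t).fun_sub ((((HasDerivAt.fun_sum fun j _ =>
        (hI (h.continuous_profileFlux h0 h1 (Fin.succ j)) t).fun_const_smul (c * ξ j.succ)).fun_neg).fun_add
          ((hI h.continuous t).fun_const_smul (c * σ))).fun_add
          ((hasDerivAt_id t).smul_const _))).congr_deriv ?_
      rw [hB t]
      simp only [Pi.smul_apply, smul_eq_mul]
      module
    have := is_const_of_deriv_eq_zero (fun t => (hD t).differentiableAt) (fun t => (hD t).deriv) X 0
    simp only [hφ0, intervalIntegral.integral_same, smul_zero, zero_smul, Finset.sum_const_zero,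
      neg_zero, add_zero, sub_zero] at this
    exact sub_eq_zero.1 this
  have hy : ∀ x, HasDerivAt (fun x => ∑ j : Fin m, ξ j.succ • φ j.succ x - σ • μ x)
      (∑ j : Fin m, ξ j.succ • (S.realA ubar j.succ x (v x)
        - (S.B j.succ 0 (ubar x)).mulVec (v' x)
        - ∑ k : Fin m, (c • (fun j : Fin m => ξ j.succ)) k •
            (S.B j.succ k.succ (ubar x)).mulVec (deriv ubar x)) - σ • v x) x := fun x =>
    (HasDerivAt.fun_sum fun j _ => (hφ j.succ x).fun_const_smul _).fun_sub
      ((hμ x).fun_const_smul σ)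
  have hsol := hc.eq_sol (ρ := 0) (σ := (σ : ℂ)) (c := (c : ℂ)) (z := complexify n z)
    (fun x => hcx (hv x)) (fun x => hcx (hy x)) ?_ ?_ X
  · have hy0 : complexify n (∑ j : Fin m, ξ j.succ • φ j.succ 0 - σ • μ 0) = 0 := by
      simp [hφ0, hμ0]
    rw [hy0, hv0] at hsol
    rw [WavePencil.monodromy_apply, hsol, realMonodromy_apply]
    rw [longParam_apply]
    refine Prod.ext ?_ (Prod.ext ?_ ?_)
    · exact complexify_dotProduct _ _
    · simp only
      rw [hs, hp]
      simp only [pencil]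
      simp only [map_sub, map_add, complexify_smul]
      push_cast
      module
    · simp only
      have e1 : ((X : ℂ)⁻¹ • (((X : ℂ) * (ξ 0 : ℂ)) • complexify n z
          - complexify n (∑ j : Fin m, ξ j.succ • φ j.succ X - σ • μ X)))
          = complexify n (X⁻¹ • ((X * ξ 0) • z - (∑ j : Fin m, ξ j.succ • φ j.succ X - σ • μ X))) := by
        simp only [complexify_smul, map_sub]
        push_cast
        rfl
      rw [e1]
      congr 1
      rw [dSymbol_apply, hd]
      simp only [hf, Prod.fst_sub, Prod.smul_fst, Prod.fst_sum]
      rw [Fin.sum_univ_succ]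
      have hF : ∀ j, S.profileFlux ubar j X = S.profileFlux ubar j 0 := fun j => by
        rw [profileFlux, profileFlux, hu, hp]
      have e2 : ∑ j : Fin m, ξ j.succ • (X⁻¹ • (-(c * X * ξ 0) • S.profileFlux ubar j.succ X
            + φ j.succ X) - (-(c * X * ξ 0) / X ^ 2) • ∫ x in (0 : ℝ)..X, S.profileFlux ubar j.succ x)
          = X⁻¹ • (-(c * X * ξ 0) • ∑ j : Fin m, ξ j.succ • S.profileFlux ubar j.succ 0
              + ∑ j : Fin m, ξ j.succ • φ j.succ X)
            - (-(c * X * ξ 0) / X ^ 2) • ∑ j : Fin m, ξ j.succ •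
              ∫ x in (0 : ℝ)..X, S.profileFlux ubar j.succ x := by
        simp only [Finset.smul_sum, ← Finset.sum_add_distrib, ← Finset.sum_sub_distrib, hF]
        refine Finset.sum_congr rfl fun j _ => ?_
        module
      have e3 : ∑ j : Fin m, (c * ξ j.succ) • (∫ x in (0 : ℝ)..X, S.profileFlux ubar j.succ x)
          = c • ∑ j : Fin m, ξ j.succ • ∫ x in (0 : ℝ)..X, S.profileFlux ubar j.succ x := by
        simp only [Finset.smul_sum, mul_smul]
      have e4 : ∫ x in (0 : ℝ)..X, S.profileFlux ubar 0 x = X • q := by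
        simp only [h.profileFlux_zero, intervalIntegral.integral_const, sub_zero]
      rw [e2, e4, h.profileFlux_zero, hφX, e3, hu]
      generalize (∑ j : Fin m, ξ j.succ • ∫ x in (0 : ℝ)..X, S.profileFlux ubar j.succ x) = s₁
      generalize (∑ j : Fin m, ξ j.succ • S.profileFlux ubar j.succ 0) = s₂
      generalize (∑ j : Fin m, ξ j.succ • φ j.succ X) = s₃
      match_scalars <;> field_simp <;> ring
  · intro x
    simp only [pencil, WavePencil.forcing, linA_mulVec, linB_mulVec, hB x, sum_smul_mulVec]
    simp only [map_sub, map_add, map_sum, complexify_smul, Pi.smul_apply, smul_eq_mul,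
      Complex.ofReal_zero, mul_zero, zero_smul, mul_smul, ← Finset.smul_sum]
    module
  · intro x
    have hR : ∀ b : Fin m → Fin m → Fin n → ℂ,
        (c : ℂ) • ∑ j : Fin m, ∑ k : Fin m, ((ξ j.succ : ℂ) * (ξ k.succ : ℂ)) • b j k
          = ∑ j : Fin m, (ξ j.succ : ℂ) • ∑ k : Fin m, ((c : ℂ) * (ξ k.succ : ℂ)) • b j k := by
      intro b
      simp only [Finset.smul_sum, smul_smul]
      refine Finset.sum_congr rfl fun j _ => Finset.sum_congr rfl fun k _ => ?_
      congr 1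
      ring
    simp only [pencil, linA_mulVec, linB_mulVec, Matrix.sum_mulVec, Matrix.smul_mulVec]
    rw [hR]
    simp only [map_sub, map_sum, complexify_smul, Pi.smul_apply, smul_eq_mul,
      Complex.ofReal_mul, Complex.ofReal_zero, mul_zero, zero_smul, smul_sub,
      Finset.sum_sub_distrib]
    module

end ViscousSystem

namespace ViscousSystem

variable {n m : ℕ} (S : ViscousSystem n m) (ubar : ℝ → Fin n → ℝ) (X : ℝ) (q : Fin n → ℝ)
  (ξ : Fin (m + 1) → ℝ) (σ : ℝ)

/-- The constraints `δa ⬝ ubar'(0)` and `dH` that cut out the tangent space of the waves. -/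
noncomputable def dConstraint : WaveParam n m →ₗ[ℝ] ℝ × (Fin n → ℝ) :=
  LinearMap.prod ((dotProductBilin ℝ ℝ).flip (deriv ubar 0) ∘ₗ LinearMap.fst ℝ _ _ ∘ₗ
    LinearMap.snd ℝ _ _) (fderiv ℝ S.shoot (baseParam m ubar X q)).toLinearMap

lemma dConstraint_apply (p : WaveParam n m) : S.dConstraint ubar X q p
    = (p.2.1 ⬝ᵥ deriv ubar 0, fderiv ℝ S.shoot (baseParam m ubar X q) p) := rfl

variable {S ubar X q}

lemma dConstraint_eq_zero_iff (p : WaveParam n m) :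
    S.dConstraint ubar X q p = 0 ↔ p ∈ S.waveTangent ubar X q := by
  rw [dConstraint_apply, Prod.mk_eq_zero, and_comm]
  rfl

/-- The constraints and the averaged densities are coordinates of the wave parameters. -/
lemma Nondegenerate.coords_injective (h : S.Nondegenerate ubar X q) : Function.Injective
    ((S.dConstraint ubar X q).prod (fderiv ℝ S.density (baseParam m ubar X q)).toLinearMap) := by
  rw [injective_iff_map_eq_zero]
  intro p hp
  obtain ⟨hp1, hp2⟩ := Prod.mk_eq_zero.1 hp
  have hmem := (dConstraint_eq_zero_iff p).1 hp1
  have : (⟨p, hmem⟩ : S.waveTangent ubar X q) = 0 := by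
    apply h.injective
    rw [map_zero]
    exact hp2
  exact congrArg Subtype.val this

/-- The coordinates of the wave parameters given by the constraints and the averaged densities. -/
noncomputable def Nondegenerate.coords (h : S.Nondegenerate ubar X q) :
    WaveParam n m ≃ₗ[ℝ] (ℝ × (Fin n → ℝ)) × ((Fin n → ℝ) × (Fin (m + 1) → ℝ)) :=
  LinearEquiv.ofInjectiveOfFinrankEq
    ((S.dConstraint ubar X q).prod (fderiv ℝ S.density (baseParam m ubar X q)).toLinearMap)
    h.coords_injective (by simp; ring)

lemma Nondegenerate.coords_apply (h : S.Nondegenerate ubar X q) (p : WaveParam n m) :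
    h.coords p = (S.dConstraint ubar X q p, fderiv ℝ S.density (baseParam m ubar X q) p) := rfl

lemma Nondegenerate.dSymbol_coords_symm (h : S.Nondegenerate ubar X q)
    (b : (Fin n → ℝ) × (Fin (m + 1) → ℝ)) :
    S.dSymbol ubar X q ξ σ (h.coords.symm (0, b)) = σ • b - S.averagedSymbol h ξ b := by
  set t := (LinearEquiv.ofBijective (S.dDensity ubar X q) h).symm b with ht
  have hb : S.dDensity ubar X q t = b :=
    (LinearEquiv.ofBijective (S.dDensity ubar X q) h).apply_symm_apply b
  have e : h.coords.symm (0, b) = (t : WaveParam n m) := by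
    rw [LinearEquiv.symm_apply_eq, h.coords_apply, (dConstraint_eq_zero_iff _).2 t.2, ← hb]
    rfl
  rw [e, dSymbol_apply]
  congr 1
  · rw [← hb]; rfl
  · simp only [averagedSymbol, LinearMap.sum_apply, LinearMap.smul_apply, LinearMap.comp_apply,
      LinearEquiv.coe_coe]
    rfl

lemma Nondegenerate.det_constraint_dSymbol (h : S.Nondegenerate ubar X q) :
    LinearMap.det (((S.dConstraint ubar X q).prod (S.dSymbol ubar X q ξ σ)) ∘ₗ
      h.coords.symm.toLinearMap) = (S.averagedSymbol h ξ).charpoly.eval σ := by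
  rw [LinearMap.eval_charpoly]
  have e : ((S.dConstraint ubar X q).prod (S.dSymbol ubar X q ξ σ)) ∘ₗ h.coords.symm.toLinearMap
      = (LinearMap.id ∘ₗ LinearMap.fst ℝ _ _).prod
        ((S.dSymbol ubar X q ξ σ ∘ₗ h.coords.symm.toLinearMap ∘ₗ LinearMap.inl ℝ _ _) ∘ₗ
          LinearMap.fst ℝ _ _
          + (algebraMap ℝ (Module.End ℝ _) σ - S.averagedSymbol h ξ) ∘ₗ LinearMap.snd ℝ _ _) := by
    refine LinearMap.ext ?_
    rintro ⟨a, b⟩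
    have e1 : S.dConstraint ubar X q (h.coords.symm (a, b)) = a := by
      have := h.coords.apply_symm_apply (a, b)
      rw [h.coords_apply] at this
      exact congrArg Prod.fst this
    have e2 : S.dSymbol ubar X q ξ σ (h.coords.symm (a, b))
        = S.dSymbol ubar X q ξ σ (h.coords.symm (a, 0)) + (σ • b - S.averagedSymbol h ξ b) := by
      rw [← h.dSymbol_coords_symm, ← map_add, ← map_add, Prod.mk_add_mk, add_zero, zero_add]
    exact Prod.ext e1 e2
  rw [e, LinearMap.det_lower_triangular, LinearMap.det_id, one_mul]

/-- The regrouping of the components. -/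
def regroup (n m : ℕ) : ((ℝ × (Fin n → ℝ)) × ((Fin n → ℝ) × (Fin (m + 1) → ℝ))) ≃ₗ[ℝ]
    (ℝ × (Fin n → ℝ) × (Fin n → ℝ)) × (Fin (m + 1) → ℝ) where
  toFun y := ((y.1.1, y.1.2, y.2.1), y.2.2)
  invFun y := ((y.1.1, y.1.2.1), (y.1.2.2, y.2))
  map_add' _ _ := rfl
  map_smul' _ _ := rfl
  left_inv _ := rfl
  right_inv _ := rfl

/-- The parametrization `(c, v, z, θ) ↦ (θ_1, v, c, (θ_2, …, θ_d), -z)` of the wave parameters. -/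
def paramEquiv (n m : ℕ) :
    ((ℝ × (Fin n → ℝ) × (Fin n → ℝ)) × (Fin (m + 1) → ℝ)) ≃ₗ[ℝ] WaveParam n m where
  toFun y := (y.2 0, y.1.2.1, y.1.1, fun j => y.2 j.succ, -y.1.2.2)
  invFun p := ((p.2.2.1, p.2.1, -p.2.2.2.2), Fin.cons p.1 p.2.2.2.1)
  map_add' x y := by
    refine Prod.ext rfl (Prod.ext rfl (Prod.ext rfl (Prod.ext rfl ?_)))
    simp [add_comm]
  map_smul' c x := by
    refine Prod.ext rfl (Prod.ext rfl (Prod.ext rfl (Prod.ext rfl ?_)))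
    simp
  left_inv y := by
    refine Prod.ext (Prod.ext rfl (Prod.ext rfl ?_)) ?_
    · simp
    · ext i
      refine Fin.cases ?_ (fun i => ?_) i <;> simp
  right_inv p := by
    refine Prod.ext rfl (Prod.ext rfl (Prod.ext rfl (Prod.ext ?_ ?_)))
    · simp
    · simp

variable (S ubar X q) in
/-- The shear that carries `paramEquiv` to the parametrization that extends `longParam`. -/
noncomputable def shear : Module.End ℝ ((ℝ × (Fin n → ℝ) × (Fin n → ℝ)) × (Fin (m + 1) → ℝ)) :=
  LinearMap.prod
    ((LinearMap.prod ((σ • LinearMap.id) ∘ₗ LinearMap.fst ℝ _ _)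
      (LinearMap.toSpanSingleton ℝ _ ((0 : Fin n → ℝ),
          -(∑ j : Fin m, ξ j.succ • S.profileFlux ubar j.succ 0 - σ • ubar 0)) ∘ₗ
        LinearMap.fst ℝ _ _ + LinearMap.id ∘ₗ LinearMap.snd ℝ _ _)) ∘ₗ LinearMap.fst ℝ _ _)
    ((LinearMap.toSpanSingleton ℝ _ (Fin.cons (-(X * ξ 0)) fun j => ξ j.succ : Fin (m + 1) → ℝ) ∘ₗ
      LinearMap.fst ℝ _ _) ∘ₗ LinearMap.fst ℝ _ _ + LinearMap.id ∘ₗ LinearMap.snd ℝ _ _)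

lemma det_shear : LinearMap.det (S.shear ubar X ξ σ) = σ := by
  rw [shear, LinearMap.det_lower_triangular, LinearMap.det_lower_triangular]
  simp

lemma paramEquiv_shear (x : ℝ × (Fin n → ℝ) × (Fin n → ℝ)) (θ : Fin (m + 1) → ℝ) :
    paramEquiv n m (S.shear ubar X ξ σ (x, θ))
      = S.longParam ubar X ξ σ x + (θ 0, 0, 0, fun j => θ j.succ, 0) := by
  obtain ⟨c, v, z⟩ := x
  have e : S.shear ubar X ξ σ ((c, v, z), θ) = ((σ • c, c • (0 : Fin n → ℝ) + v,
      c • (-(∑ j : Fin m, ξ j.succ • S.profileFlux ubar j.succ 0 - σ • ubar 0)) + z),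
      c • (Fin.cons (-(X * ξ 0)) fun j => ξ j.succ : Fin (m + 1) → ℝ) + θ) := rfl
  rw [e, longParam_apply]
  simp only [paramEquiv, LinearEquiv.coe_mk, LinearMap.coe_mk, AddHom.coe_mk, Prod.mk_add_mk]
  refine Prod.ext ?_ (Prod.ext ?_ (Prod.ext ?_ (Prod.ext ?_ ?_)))
  · simp; ring
  · simp
  · simp [mul_comm]
  · ext j; simp
  · simp only; module

/-- At `ρ = 0` the reduced Evans function is the characteristic polynomial of the averaged
system, up to a constant and a power of `σ`. -/
lemma Nondegenerate.exists_det_realMonodromy (h : S.Nondegenerate ubar X q)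
    (hu : S.IsPeriodicProfile ubar X q) (h0 : S.H0) (h1 : S.H1) :
    ∃ Γ : ℝ, Γ ≠ 0 ∧ ∀ (ξ : Fin (m + 1) → ℝ) (σ : ℝ), σ ≠ 0 →
      LinearMap.det (S.realMonodromy ubar X q ξ σ) * σ ^ m
        = Γ * (S.averagedSymbol h ξ).charpoly.eval σ := by
  have hX := hu.period_pos.ne'
  let d : Fin (m + 1) → ℝ := Fin.cons (-(X ^ 2)⁻¹) fun _ => X⁻¹
  let D : Module.End ℝ (Fin (m + 1) → ℝ) := Matrix.toLin' (Matrix.diagonal d)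
  have hD : LinearMap.det D ≠ 0 := by
    simp only [D, LinearMap.det_toLin', Matrix.det_diagonal]
    refine Finset.prod_ne_zero_iff.2 fun i _ => ?_
    refine Fin.cases ?_ (fun i => ?_) i
    · simp [d, hX]
    · simp [d, hX]
  let E : Module.End ℝ ((ℝ × (Fin n → ℝ) × (Fin n → ℝ)) × (Fin (m + 1) → ℝ)) :=
    ((paramEquiv n m).trans (h.coords.trans (regroup n m))).toLinearMap
  have hE : LinearMap.det E ≠ 0 :=
    (LinearEquiv.isUnit_det' ((paramEquiv n m).trans (h.coords.trans (regroup n m)))).ne_zero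
  refine ⟨LinearMap.det E / LinearMap.det D, div_ne_zero hE hD, fun ξ σ hσ => ?_⟩
  let T : Module.End ℝ ((ℝ × (Fin n → ℝ)) × ((Fin n → ℝ) × (Fin (m + 1) → ℝ))) :=
    ((S.dConstraint ubar X q).prod (S.dSymbol ubar X q ξ σ)) ∘ₗ h.coords.symm.toLinearMap
  have hT : LinearMap.det T = (S.averagedSymbol h ξ).charpoly.eval σ :=
    h.det_constraint_dSymbol ξ σ
  let ι : (Fin (m + 1) → ℝ) →ₗ[ℝ] WaveParam n m :=
    (paramEquiv n m).toLinearMap ∘ₗ LinearMap.inr ℝ _ _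
  have hι : ∀ θ, ι θ = (θ 0, 0, 0, fun j => θ j.succ, 0) := fun θ =>
    Prod.ext rfl (Prod.ext rfl (Prod.ext rfl (Prod.ext rfl neg_zero)))
  let Cθ : (Fin (m + 1) → ℝ) →ₗ[ℝ] ℝ × (Fin n → ℝ) × (Fin n → ℝ) :=
    LinearMap.fst ℝ _ _ ∘ₗ (regroup n m).toLinearMap ∘ₗ
      ((S.dConstraint ubar X q).prod (S.dSymbol ubar X q ξ σ)) ∘ₗ ι
  have key : ((regroup n m).toLinearMap ∘ₗ T ∘ₗ (regroup n m).symm.toLinearMap) ∘ₗ E ∘ₗ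
      S.shear ubar X ξ σ
      = (S.realMonodromy ubar X q ξ σ ∘ₗ LinearMap.fst ℝ _ _ + Cθ ∘ₗ LinearMap.snd ℝ _ _).prod
        ((σ • D) ∘ₗ LinearMap.snd ℝ _ _) := by
    refine LinearMap.ext ?_
    rintro ⟨x, θ⟩
    have e1 : (((regroup n m).toLinearMap ∘ₗ T ∘ₗ (regroup n m).symm.toLinearMap) ∘ₗ E ∘ₗ
        S.shear ubar X ξ σ) (x, θ)
        = regroup n m (S.dConstraint ubar X q (S.longParam ubar X ξ σ x + ι θ),
          S.dSymbol ubar X q ξ σ (S.longParam ubar X ξ σ x + ι θ)) := by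
      rw [hι, ← paramEquiv_shear]
      simp only [LinearMap.comp_apply, T, E, LinearEquiv.coe_coe, LinearEquiv.trans_apply,
        LinearEquiv.symm_apply_apply]
      rfl
    rw [e1, map_add, map_add]
    have e2 : (S.dSymbol ubar X q ξ σ (ι θ)).2 = σ • D θ := by
      rw [hu.dSymbol_snd h0 h1, hι]
      ext i
      refine Fin.cases ?_ (fun i => ?_) i
      · simp only [D, d, Matrix.toLin'_apply, Pi.smul_apply, Matrix.mulVec_diagonal, Fin.cons_zero,
          Pi.sub_apply, Pi.single_eq_same, smul_eq_mul]
        ring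
      · simp [D, d, Matrix.mulVec_diagonal]
    have e3 : ∀ a a' : ℝ × (Fin n → ℝ), ∀ b b' : (Fin n → ℝ) × (Fin (m + 1) → ℝ),
        regroup n m (a + a', b + b')
          = ((a.1, a.2, b.1) + (a'.1, a'.2, b'.1), b.2 + b'.2) := fun _ _ _ _ => rfl
    rw [e3, hu.dSymbol_longParam_snd h0 h1, e2, zero_add]
    rfl
  have hdet := congrArg LinearMap.det key
  rw [LinearMap.det_upper_triangular, LinearMap.det_comp, LinearMap.det_comp, LinearMap.det_conj, hT,
    det_shear, LinearMap.det_smul, Module.finrank_fin_fun] at hdet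
  rw [div_mul_eq_mul_div, eq_div_iff hD]
  apply mul_left_cancel₀ hσ
  rw [pow_succ] at hdet
  linear_combination -hdet

end ViscousSystem

namespace ViscousSystem

variable {n m : ℕ} {S : ViscousSystem n m} {ubar : ℝ → Fin n → ℝ} {X : ℝ} {q : Fin n → ℝ}

lemma IsPeriodicProfile.reducedEvans_zero_ofReal (h : S.IsPeriodicProfile ubar X q) (h0 : S.H0)
    (h1 : S.H1) (ξ : Fin (m + 1) → ℝ) (σ : ℝ) : h.reducedEvans h0 h1 (0, ξ) σ
      = ((LinearMap.det (S.realMonodromy ubar X q ξ σ) : ℝ) : ℂ) := by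
  have e1 : (X : ℂ) * ξ 0 * dslope Complex.exp 0 (Complex.I * X * (((0 : ℝ) : ℂ) * ξ 0)) = X * ξ 0 := by
    simp [dslope_same]
  have e2 : Complex.exp (Complex.I * X * (((0 : ℝ) : ℂ) * ξ 0)) = 1 := by simp
  rw [reducedEvans]
  simp only [e1, e2]
  refine LinearMap.det_eq_ofReal_det
    ((Module.Basis.singleton Unit ℝ).prod ((Pi.basisFun ℝ (Fin n)).prod (Pi.basisFun ℝ (Fin n))))
    ((Module.Basis.singleton Unit ℂ).prod ((Pi.basisFun ℂ (Fin n)).prod (Pi.basisFun ℂ (Fin n))))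
    (fun x => ((x.1 : ℂ), complexify n x.2.1, complexify n x.2.2)) ?_ ?_
    fun x => h.monodromy_zero h0 h1 _ x
  · have hs : ∀ i : Fin n, complexify n (Pi.single i 1) = Pi.single i 1 := by
      intro i
      ext j
      by_cases hij : j = i <;> simp [hij]
    rintro (i | i | i) <;> simp [hs]
  · rintro v (i | i | i) <;> simp

end ViscousSystem

section PolynomialFactor

open Polynomial

/-- A monic complex polynomial of degree `N + m` that is `z ^ m` times a continuous function splits
as `X ^ m ∏ (X - a_j)`. -/
lemma Polynomial.exists_eq_X_pow_mul_prod {p : ℂ[X]} {m N : ℕ} (hp : p.Monic)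
    (hdeg : p.natDegree = N + m) {g : ℂ → ℂ} (hg : Continuous g) (h : ∀ z, p.eval z = g z * z ^ m) :
    ∃ a : Fin N → ℂ, p = X ^ m * ∏ j, (X - C (a j)) ∧ ∀ z, g z = ∏ j, (z - a j) := by
  have heq : ∀ f₁ f₂ : ℂ → ℂ, Continuous f₁ → Continuous f₂ → (∀ z, z ≠ 0 → f₁ z = f₂ z) → f₁ = f₂ := by
    intro f₁ f₂ c₁ c₂ hf
    exact Continuous.ext_on (dense_compl_singleton (0 : ℂ)) c₁ c₂ fun z hz => hf z hz
  obtain ⟨r, hr, hnd⟩ := p.exists_eq_pow_rootMultiplicity_mul_and_not_dvd hp.ne_zero 0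
  set k := p.rootMultiplicity 0 with hk
  rw [C_0, sub_zero] at hr hnd
  have hmk : m ≤ k := by
    by_contra hlt
    push Not at hlt
    have h2 := heq (fun z => r.eval z) (fun z => g z * z ^ (m - k)) r.continuous
      (hg.mul (continuous_pow _)) (fun z hz => by
        have := h z
        rw [hr, eval_mul, eval_pow, eval_X] at this
        refine mul_left_cancel₀ (pow_ne_zero k hz) ?_
        rw [this, mul_left_comm, ← pow_add, Nat.add_sub_cancel' hlt.le])
    have h3 := congrFun h2 0
    simp only [zero_pow (Nat.sub_ne_zero_of_lt hlt), mul_zero] at h3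
    exact hnd (X_dvd_iff.2 (by rw [coeff_zero_eq_eval_zero, h3]))
  obtain ⟨s, hs⟩ : X ^ m ∣ p := (pow_dvd_pow X hmk).trans ⟨r, hr⟩
  have hsm : s.Monic := (monic_X_pow m).of_mul_monic_left (hs ▸ hp)
  have hsd : s.natDegree = N := by
    have := congrArg natDegree hs
    rw [(monic_X_pow m).natDegree_mul hsm, natDegree_X_pow, hdeg] at this
    omega
  have hsplit : s.Splits := IsAlgClosed.splits s
  have hcard : s.roots.card = N := by rw [← hsd, hsplit.natDegree_eq_card_roots]
  obtain ⟨l, hl⟩ : ∃ l : List ℂ, (l : Multiset ℂ) = s.roots := ⟨s.roots.toList, by simp⟩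
  have hlen : l.length = N := by rw [← hcard, ← hl, Multiset.coe_card]
  subst hlen
  have hprod : s = ∏ j, (X - C (l.get j)) := by
    have e1 := hsplit.eq_prod_roots_of_monic hsm
    rw [← hl, Multiset.map_coe, Multiset.prod_coe] at e1
    rw [e1, ← List.prod_ofFn]
    congr 1
    apply List.ext_get <;> simp
  refine ⟨l.get, by rw [hs, hprod], ?_⟩
  refine congrFun (heq g (fun z => ∏ j, (z - l.get j)) hg (by fun_prop) fun z hz => ?_)
  have := h z
  rw [hs, hprod, eval_mul, eval_pow, eval_X, eval_prod, mul_comm] at this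
  simp only [eval_sub, eval_X, eval_C] at this
  exact (mul_right_cancel₀ (pow_ne_zero m hz) this).symm

end PolynomialFactor

namespace ViscousSystem

variable {n m : ℕ} {S : ViscousSystem n m} {ubar : ℝ → Fin n → ℝ} {X : ℝ} {q : Fin n → ℝ}

lemma averagedSymbol_smul (h : S.Nondegenerate ubar X q) (t : ℝ) (ξ : Fin (m + 1) → ℝ) :
    S.averagedSymbol h (t • ξ) = t • S.averagedSymbol h ξ := by
  simp only [averagedSymbol, Pi.smul_apply, smul_eq_mul, mul_smul, Finset.smul_sum]

lemma eval_charpoly_averagedSymbol_smul (h : S.Nondegenerate ubar X q) (t : ℝ)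
    (ξ : Fin (m + 1) → ℝ) (z : ℂ) :
    ((S.averagedSymbol h (t • ξ)).charpoly.map (algebraMap ℝ ℂ)).eval (t * z)
      = t ^ (n + (m + 1)) * ((S.averagedSymbol h ξ).charpoly.map (algebraMap ℝ ℂ)).eval z := by
  have e : (S.averagedSymbol h (t • ξ)).charpoly.comp (Polynomial.C t * Polynomial.X)
      = Polynomial.C (t ^ (n + (m + 1))) * (S.averagedSymbol h ξ).charpoly := by
    refine Polynomial.funext fun σ => ?_
    rw [Polynomial.eval_comp, Polynomial.eval_mul, Polynomial.eval_mul, Polynomial.eval_C,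
      Polynomial.eval_C, Polynomial.eval_X, LinearMap.eval_charpoly, LinearMap.eval_charpoly,
      averagedSymbol_smul, map_mul]
    have e1 : algebraMap ℝ (Module.End ℝ ((Fin n → ℝ) × (Fin (m + 1) → ℝ))) t * algebraMap ℝ _ σ
        - t • S.averagedSymbol h ξ = t • (algebraMap ℝ _ σ - S.averagedSymbol h ξ) := by
      rw [smul_sub, Algebra.smul_def t (algebraMap ℝ _ σ)]
    rw [e1, LinearMap.det_smul]
    simp
  have e2 := congrArg (fun p => (p.map (algebraMap ℝ ℂ)).eval z) e
  simpa [Polynomial.map_comp] using e2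

lemma IsEvansBasis.exists_reducedEvans_zero (h : S.IsPeriodicProfile ubar X q) (h0 : S.H0)
    (h1 : S.H1) (hnd : S.Nondegenerate ubar X q)
    {w : (Fin m → ℝ) → ℂ → (Fin n ⊕ Fin n) → ℝ → Fin n → ℂ} (hw : S.IsEvansBasis ubar w) :
    ∃ (Γ : ℂ) (b : (Fin (m + 1) → ℝ) → Fin (n + 1) → ℂ), Γ ≠ 0 ∧
      (∀ ξ z, h.reducedEvans h0 h1 (0, ξ) z = Γ * ∏ j, (z - b ξ j)) ∧
      (∀ ρ : ℝ, 0 < ρ → ∀ ξ j, b (ρ • ξ) j = ρ * b ξ j) ∧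
      ∀ ξ, (S.averagedSymbol hnd ξ).charpoly.map (algebraMap ℝ ℂ)
        = Polynomial.X ^ m * ∏ j, (Polynomial.X - Polynomial.C (b ξ j)) := by
  obtain ⟨Γ, hΓ, hdet⟩ := hnd.exists_det_realMonodromy h h0 h1
  have hΓ' : (Γ : ℂ) ≠ 0 := by exact_mod_cast hΓ
  have hGd := fun ξ : Fin (m + 1) → ℝ => hw.differentiable_reducedEvans h h0 h1 (0, ξ)
  -- the identity for real `σ` extends to all complex `σ`
  have hid : ∀ (ξ : Fin (m + 1) → ℝ) (z : ℂ), h.reducedEvans h0 h1 (0, ξ) z * z ^ m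
      = Γ * ((S.averagedSymbol hnd ξ).charpoly.map (algebraMap ℝ ℂ)).eval z := by
    intro ξ
    have ha1 : AnalyticOnNhd ℂ (fun z => h.reducedEvans h0 h1 (0, ξ) z * z ^ m) univ :=
      ((hGd ξ).fun_mul (differentiable_id.fun_pow m)).differentiableOn.analyticOnNhd isOpen_univ
    have ha2 : AnalyticOnNhd ℂ (fun z =>
        (Γ : ℂ) * ((S.averagedSymbol hnd ξ).charpoly.map (algebraMap ℝ ℂ)).eval z) univ :=
      ((Polynomial.differentiable _).const_mul _).differentiableOn.analyticOnNhd isOpen_univ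
    have htend : Tendsto (fun s : ℝ => (s : ℂ)) (𝓝[≠] 0) (𝓝[≠] 0) :=
      tendsto_nhdsWithin_iff.2 ⟨(Complex.continuous_ofReal.tendsto' 0 0 rfl).mono_left
        nhdsWithin_le_nhds, by
          filter_upwards [self_mem_nhdsWithin] with s hs
          exact Complex.ofReal_ne_zero.2 hs⟩
    refine congrFun (ha1.eq_of_frequently_eq ha2 (z₀ := 0) (htend.frequently ?_))
    refine Eventually.frequently ?_
    filter_upwards [self_mem_nhdsWithin] with s hs
    rw [h.reducedEvans_zero_ofReal h0 h1, ← Complex.coe_algebraMap, Polynomial.eval_map_algebraMap,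
      Polynomial.aeval_algebraMap_apply, Polynomial.coe_aeval_eq_eval, Complex.coe_algebraMap]
    exact_mod_cast hdet ξ s hs
  have hex : ∀ ξ : Fin (m + 1) → ℝ, ∃ a : Fin (n + 1) → ℂ,
      (S.averagedSymbol hnd ξ).charpoly.map (algebraMap ℝ ℂ)
        = Polynomial.X ^ m * ∏ j, (Polynomial.X - Polynomial.C (a j)) ∧
      ∀ z, (Γ : ℂ)⁻¹ * h.reducedEvans h0 h1 (0, ξ) z = ∏ j, (z - a j) := by
    intro ξ
    refine Polynomial.exists_eq_X_pow_mul_prod ((LinearMap.charpoly_monic _).map _) ?_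
      ((hGd ξ).continuous.const_mul _) fun z => ?_
    · rw [(LinearMap.charpoly_monic _).natDegree_map, LinearMap.charpoly_natDegree]
      simp
      ring
    · rw [mul_assoc, hid ξ z, inv_mul_cancel_left₀ hΓ']
  choose b₀ hb₀ hb₀' using hex
  let b : (Fin (m + 1) → ℝ) → Fin (n + 1) → ℂ := fun ξ j => ‖ξ‖ * b₀ (‖ξ‖⁻¹ • ξ) j
  have hb : ∀ ξ, (S.averagedSymbol hnd ξ).charpoly.map (algebraMap ℝ ℂ)
      = Polynomial.X ^ m * ∏ j, (Polynomial.X - Polynomial.C (b ξ j)) := by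
    intro ξ
    rcases eq_or_ne ξ 0 with rfl | hξ
    · have e0 : S.averagedSymbol hnd 0 = 0 := by simp [averagedSymbol]
      rw [e0, LinearMap.charpoly_zero]
      simp only [b, norm_zero, Complex.ofReal_zero, zero_mul, Polynomial.C_0, sub_zero,
        Finset.prod_const, Finset.card_univ, Fintype.card_fin, Polynomial.map_pow,
        Polynomial.map_X, ← pow_add]
      congr 1
      simp
      ring
    · have hn : (‖ξ‖ : ℂ) ≠ 0 := by exact_mod_cast norm_ne_zero_iff.2 hξ
      have hξ' : ‖ξ‖ • (‖ξ‖⁻¹ • ξ) = ξ := smul_inv_smul₀ (norm_ne_zero_iff.2 hξ) ξ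
      refine Polynomial.funext fun z => ?_
      have e := eval_charpoly_averagedSymbol_smul hnd ‖ξ‖ (‖ξ‖⁻¹ • ξ) (z / ‖ξ‖)
      rw [hξ', mul_div_cancel₀ z hn, hb₀ (‖ξ‖⁻¹ • ξ)] at e
      rw [e]
      simp only [Polynomial.eval_mul, Polynomial.eval_pow, Polynomial.eval_X, Polynomial.eval_prod,
        Polynomial.eval_sub, Polynomial.eval_C]
      have e2 : ∏ j, (z - b ξ j) = (‖ξ‖ : ℂ) ^ (n + 1) * ∏ j, (z / ‖ξ‖ - b₀ (‖ξ‖⁻¹ • ξ) j) := by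
        have : (‖ξ‖ : ℂ) ^ (n + 1) = ∏ _j : Fin (n + 1), (‖ξ‖ : ℂ) := by simp
        rw [this, ← Finset.prod_mul_distrib]
        refine Finset.prod_congr rfl fun j _ => ?_
        simp only [b]
        field_simp
      rw [e2, div_pow]
      have hnm : (‖ξ‖ : ℂ) ^ m ≠ 0 := pow_ne_zero _ hn
      field_simp
      ring
  refine ⟨Γ, b, hΓ', fun ξ z => ?_, fun ρ hρ ξ j => ?_, hb⟩
  · obtain ⟨a, ha, ha'⟩ : ∃ a : Fin (n + 1) → ℂ,
      (S.averagedSymbol hnd ξ).charpoly.map (algebraMap ℝ ℂ)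
        = Polynomial.X ^ m * ∏ j, (Polynomial.X - Polynomial.C (a j)) ∧
      ∀ z, (Γ : ℂ)⁻¹ * h.reducedEvans h0 h1 (0, ξ) z = ∏ j, (z - a j) :=
      ⟨b₀ ξ, hb₀ ξ, hb₀' ξ⟩
    have e1 : ∏ j, (Polynomial.X - Polynomial.C (a j))
        = ∏ j, (Polynomial.X - Polynomial.C (b ξ j)) :=
      mul_left_cancel₀ (pow_ne_zero m Polynomial.X_ne_zero) (ha.symm.trans (hb ξ))
    have e2 := congrArg (Polynomial.eval z) e1
    simp only [Polynomial.eval_prod, Polynomial.eval_sub, Polynomial.eval_X, Polynomial.eval_C] at e2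
    rw [← e2, ← ha', mul_inv_cancel_left₀ hΓ']
  · have e1 : (‖ρ • ξ‖)⁻¹ • ρ • ξ = ‖ξ‖⁻¹ • ξ := by
      rw [norm_smul, Real.norm_of_nonneg hρ.le, smul_smul, mul_inv, mul_right_comm,
        inv_mul_cancel₀ hρ.ne', one_mul]
    simp only [b, e1]
    rw [norm_smul, Real.norm_of_nonneg hρ.le]
    push_cast
    ring

end ViscousSystem

theorem corollary1 {n m : ℕ} (hm : 1 ≤ m) (S : ViscousSystem n m)
    (ubar : ℝ → Fin n → ℝ) (X : ℝ) (q : Fin n → ℝ)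
    (hubar : S.IsPeriodicProfile ubar X q)
    (h0 : S.H0) (h1 : S.H1) (h2 : S.H2 ubar X q)
    (hnd : S.Nondegenerate ubar X q)
    (w : (Fin m → ℝ) → ℂ → (Fin n ⊕ Fin n) → ℝ → Fin n → ℂ)
    (hw : S.IsEvansBasis ubar w) :
    ∃ r > (0 : ℝ), ∃ ε > (0 : ℝ), ∃ Λ a : Fin (n + 1) → (Fin (m + 1) → ℝ) → ℂ,
      -- the `a j ξ` are the eigenvalues of `𝒜(ξ)`, with `d - 1 = m` zero eigenvalues left out
      (∀ ξ, (S.averagedSymbol hnd ξ).charpoly.map (algebraMap ℝ ℂ) =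
        Polynomial.X ^ m * ∏ j, (Polynomial.X - Polynomial.C (a j ξ))) ∧
      -- the zeros of the Evans function near the origin are the `n + 1` surfaces `lam = Λ j ξ`
      (∀ ξ, ‖ξ‖ < ε → ∀ j, ‖Λ j ξ‖ < r) ∧
      (∀ ξ, ‖ξ‖ < ε → ∀ lam : ℂ, ‖lam‖ < r →
        (evans w X ξ lam = 0 ↔ ∃ j, lam = Λ j ξ)) ∧
      -- with multiplicity
      (∀ ξ, ‖ξ‖ < ε → ∀ lam : ℂ, ‖lam‖ < r →
        analyticOrderAt (evans w X ξ) lam = {j | Λ j ξ = lam}.encard) ∧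
      -- which vary continuously, as an unordered `(n + 1)`-tuple
      (∀ ξ₀, ‖ξ₀‖ < ε → ∀ κ > (0 : ℝ), ∀ᶠ ξ in 𝓝 ξ₀,
        ∃ σ : Equiv.Perm (Fin (n + 1)), ∀ j, ‖Λ j ξ - Λ (σ j) ξ₀‖ < κ) ∧
      -- and satisfy `Λ j ξ = -i a j ξ + o(|ξ|)`
      (∀ j, (fun ξ => Λ j ξ - (-Complex.I * a j ξ)) =o[𝓝 0] fun ξ => ‖ξ‖) := by
  obtain ⟨Γ, b, hΓ, hb, hbs, hchar⟩ := hw.exists_reducedEvans_zero hubar h0 h1 hnd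
  have hX : (X : ℂ) ≠ 0 := by exact_mod_cast hubar.period_pos.ne'
  have hK : (-(Complex.I * X)) ^ n
      * (Complex.I * ((deriv ubar 0 ⬝ᵥ deriv ubar 0 : ℝ) : ℂ))⁻¹ ≠ 0 := by
    refine mul_ne_zero (pow_ne_zero _ (neg_ne_zero.2 (mul_ne_zero Complex.I_ne_zero hX)))
      (inv_ne_zero (mul_ne_zero Complex.I_ne_zero ?_))
    have := hubar.deriv_zero_ne_zero h0 h1
    exact_mod_cast (fun e => this (dotProduct_self_eq_zero.1 e))
  have hW := hw.initialDet_ne_zero hubar h0 h1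
  obtain ⟨r, hr, ε, hε, Λ, a, ha, hΛ, hcont, hasymp⟩ := exists_root_surfaces
    (G := hubar.reducedEvans h0 h1)
    (Ev := fun ξ lam => evans w X ξ lam / ViscousSystem.initialDet w (fun j => ξ j.succ) lam)
    (hubar.continuous_reducedEvans h0 h1) (hw.differentiable_reducedEvans hubar h0 h1) hK
    (fun ρ hρ ξ z => by
      rw [hw.evans_eq hubar h0 h1 hρ ξ z, mul_div_assoc, div_self (hW _ _), mul_one])
    hΓ hb hbs
  have hroots : ∀ ξ, ‖ξ‖ < ε → HasRootList (evans w X ξ) r fun j => Λ j ξ := by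
    intro ξ hξ
    obtain ⟨hlt, g, hg, hg0, hfac⟩ := hΛ ξ hξ
    refine ⟨hlt, fun z => g z * ViscousSystem.initialDet w (fun j => ξ j.succ) z,
      hg.fun_mul (hw.differentiable_initialDet _), fun z hz => mul_ne_zero (hg0 z hz) (hW _ _),
      fun z => ?_⟩
    rw [← mul_assoc, ← hfac z, div_mul_cancel₀ _ (hW _ _)]
  refine ⟨r, hr, ε, hε, Λ, a, fun ξ => ?_, fun ξ hξ => (hroots ξ hξ).1, fun ξ hξ lam hlam => ?_,
    fun ξ hξ lam hlam => (hroots ξ hξ).analyticOrderAt_eq hlam.le, hcont, hasymp⟩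
  · obtain ⟨τ, hτ⟩ := ha ξ
    rw [hchar ξ]
    simp only [hτ]
    rw [Equiv.prod_comp τ fun j => Polynomial.X - Polynomial.C (b ξ j)]
  · obtain ⟨-, g, -, hg0, hfac⟩ := hroots ξ hξ
    rw [hfac, mul_eq_zero, or_iff_left (hg0 lam hlam.le), Finset.prod_eq_zero_iff]
    simp [sub_eq_zero]
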